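/- Let $F$ be a totally real number field of degree $d\ge 3$ with no field strictly between $\mathbb{Q}$ and $F$, with ring of integers $\mathcal O_F$; for $\alpha\in F$ let $\alpha_1,\dots,\alpha_d\in\mathbb{R}$ be its images under the real embeddings. Let $k>2$ be an even integer and let $f(\tau)=\sum_{n\ge1}c(n)q^n\in S_{dk}$ be a cusp form of weight $dk$ on $\mathrm{SL}_2(\mathbb{Z})$, $q=\mathbf e(\tau)$, $\mathbf e(x)=e^{2\pi i x}$. Let $$E_{F,k}(\tau_1,\dots,\tau_d)=1+\zeta_F(k)^{-1}\sum_{[\mathfrak a]\in \mathrm{Cl}(F)}\mathrm{Nm}(\mathfrak a)^k\sum_{(c,\delta)\in\mathfrak a^2/\mathcal O_F^\times,\ c\ne0}\ \prod_{j=1}^d(c_j\tau_j+\delta_j)^{-k}$$ be the Hecke Eisenstein series of parallel weight $k$, let $E^\Delta_{F,k}(\tau)=E_{F,k}(\tau,\dots,\tau)$, and let $\langle g,f\rangle=\int_{\mathrm{SL}_2(\mathbb{Z})\backslash\mathbb{H}}g(\tau)\overline{f(\tau)}\,v^{dk}\,\frac{du\,dv}{v^2}$ for $\tau = u+iv$.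 For $\beta\in F$ put $A_\beta=|\mathrm{Nm}(c)|/\mathrm{Nm}(\mathcal O_Fc+\mathcal O_F\delta)$ for any $c,\delta\in F$ with $c\neq0$ and $\beta=\delta/c$. Let $B\subset\mathrm{SL}_2$ be the subgroup of upper triangular matrices, identify $\beta\in\mathbb{P}^1(F)=F\cup\{\infty\}$ with the class in $B(F)\backslash\mathrm{SL}_2(F)$ of the matrices with bottom row $(1,\beta)$ if $\beta\in F$ and $(0,1)$ if $\beta=\infty$, and let $S_0\subset F$ be any set such that $S_0\cup\{\infty\}$ is a set of representatives of $B(F)\backslash\mathrm{SL}_2(F)/\mathrm{SL}_2(\mathbb{Z})$. For $m\ge1$ and $\ell, r\ge0$ put $$P_{m,k,\ell}(x_1,\dots,x_m)=(x_1\cdots x_m)^{k+\ell}\,(\partial_{x_1}+\dots+\partial_{x_m})^\ell\,(x_1\cdots x_m)^{-k},\qquad Q_{m,r}(x_1,\dots,x_m)=(x_1\cdots x_m)^r.$$ Then $E^\Delta_{F,k}\,\overline f\,v^{dk}$ is integrable over $\mathrm{SL}_2(\mathbb{Z})\backslash\mathbb{H}$ with respect to $du\,dv/v^2$, and $$\langle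 E^\Delta_{F,k},f\rangle=\frac{i\,\Gamma(dk-1)}{2\,(4\pi)^{dk-2}\,\Gamma(k)}\sum_{\beta\in S_0}A_\beta^{-k}\sum_{\ell=0}^{k-1}\binom{k-1}{\ell}(2\pi i)^{k-1-\ell}\sum_{j=1}^d\left(\frac{P_{d-1,k,\ell}}{Q_{d-1,k+\ell}}\right)\big((\beta_j-\beta_{j'})_{j'\ne j}\big)\sum_{n\ge1}\frac{\mathbf e(n\beta_j)\,\overline{c(n)}}{n^{(d-1)k+\ell}},$$ where the series over $n$ and the series over $\beta\in S_0$ (of the whole finite sum over $\ell$ and $j$) converge absolutely. -/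

import Mathlib

open UpperHalfPlane
open scoped NumberField MatrixGroups ComplexConjugate nonZeroDivisors BigOperators

noncomputable section

namespace HeckeDiagonal

/-! ### Hecke's Eisenstein series of a totally real field -/

section Eisenstein

variable (F : Type*) [Field F] [NumberField F]

/-- An integral ideal in a given class of the (wide) ideal class group. -/
def classRep (C : ClassGroup (𝓞 F)) : Ideal (𝓞 F) :=
  (Function.surjInv (ClassGroup.mk0_surjective (R := 𝓞 F)) C : (Ideal (𝓞 F))⁰)

theorem classRep_ne_zero (C : ClassGroup (𝓞 F)) : classRep F C ≠ 0 :=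
  nonZeroDivisors.ne_zero (Function.surjInv (ClassGroup.mk0_surjective (R := 𝓞 F)) C).2

theorem mk0_classRep (C : ClassGroup (𝓞 F)) :
    ClassGroup.mk0 ⟨classRep F C, mem_nonZeroDivisors_of_ne_zero (classRep_ne_zero F C)⟩ = C :=
  Function.surjInv_eq (ClassGroup.mk0_surjective (R := 𝓞 F)) C

variable {F}

/-- The pairs `(c, d) ∈ 𝔞²` with `c ≠ 0`. -/
def Pairs (𝔞 : Ideal (𝓞 F)) : Type _ :=
  {p : 𝓞 F × 𝓞 F // p.1 ∈ 𝔞 ∧ p.2 ∈ 𝔞 ∧ p.1 ≠ 0}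

/-- Two pairs are equivalent if they differ by a unit of `𝓞 F`. -/
def pairSetoid (𝔞 : Ideal (𝓞 F)) : Setoid (Pairs 𝔞) where
  r p q := ∃ u : (𝓞 F)ˣ, q.1 = ((u : 𝓞 F) * p.1.1, (u : 𝓞 F) * p.1.2)
  iseqv :=
    { refl := fun p => ⟨1, by simp⟩
      symm := by
        rintro p q ⟨u, hu⟩
        exact ⟨u⁻¹, by simp [hu]⟩
      trans := by
        rintro p q r ⟨u, hu⟩ ⟨v, hv⟩
        exact ⟨v * u, by simp [hu, hv, mul_assoc]⟩ }

/-- `∏ⱼ (cⱼ τⱼ + dⱼ)^(-k)`, the product being over the real embeddings of `F`. -/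
def pairTerm (k : ℕ) (τ : (F →+* ℝ) → ℍ) (c d : 𝓞 F) : ℂ :=
  ∏ σ : F →+* ℝ, (((σ (c : F) : ℝ) : ℂ) * (τ σ : ℂ) + ((σ (d : F) : ℝ) : ℂ)) ^ (-(k : ℤ))

/-- Hecke's Eisenstein series of parallel weight `k`,
`1 + ζ_F(k)⁻¹ ∑_{[𝔞]} Nm(𝔞)^k ∑_{(c,d) ∈ 𝔞²/𝓞ˣ, c ≠ 0} ∏ⱼ (cⱼ τⱼ + dⱼ)^(-k)`.
For a totally real field and even `k > 2` the series converges absolutely and neither the choice of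
the ideals nor that of the pairs modulo units matters. -/
def heckeE (k : ℕ) (τ : (F →+* ℝ) → ℍ) : ℂ :=
  1 + (NumberField.dedekindZeta F (k : ℂ))⁻¹ *
    ∑ C : ClassGroup (𝓞 F), ((Ideal.absNorm (classRep F C) : ℕ) : ℂ) ^ k *
      ∑' q : Quotient (pairSetoid (classRep F C)), pairTerm k τ q.out.1.1 q.out.1.2

variable (F) in
/-- The diagonal restriction `τ ↦ E_{F,k}(τ, …, τ)`. -/
def heckeEDiag (k : ℕ) (τ : ℍ) : ℂ := heckeE (F := F) k (fun _ => τ)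

/-- `A_β = |Nm(c)| / Nm(𝓞 c + 𝓞 d)` for `β = d / c`, computed with `(c, d) = (1, β)`. -/
def A (β : F) : ℚ :=
  (FractionalIdeal.absNorm
    (FractionalIdeal.spanSingleton (𝓞 F)⁰ 1 + FractionalIdeal.spanSingleton (𝓞 F)⁰ β))⁻¹

/-- Any presentation `β = d / c` computes `A_β`. -/
theorem A_div (c d : F) (hc : c ≠ 0) :
    A (d / c) = |Algebra.norm ℚ c| / FractionalIdeal.absNorm
      (FractionalIdeal.spanSingleton (𝓞 F)⁰ c + FractionalIdeal.spanSingleton (𝓞 F)⁰ d) := by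
  have h : FractionalIdeal.spanSingleton (𝓞 F)⁰ c + FractionalIdeal.spanSingleton (𝓞 F)⁰ d =
      FractionalIdeal.spanSingleton (𝓞 F)⁰ c * (FractionalIdeal.spanSingleton (𝓞 F)⁰ 1 +
        FractionalIdeal.spanSingleton (𝓞 F)⁰ (d / c)) := by
    rw [mul_add, FractionalIdeal.spanSingleton_mul_spanSingleton,
      FractionalIdeal.spanSingleton_mul_spanSingleton, mul_one, mul_div_cancel₀ _ hc]
  have hn : |Algebra.norm ℚ c| ≠ 0 := by simpa using hc
  rw [h, map_mul, FractionalIdeal.absNorm_span_singleton, A, div_mul_eq_div_div, div_self hn,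
    one_div]

end Eisenstein

/-! ### The double coset `B(F) \ SL₂(F) / SL₂(ℤ)` -/

section Cosets

variable (F : Type*) [Field F]

/-- The standard Borel subgroup of upper triangular matrices. -/
def borelSubgroup : Subgroup SL(2, F) where
  carrier := {g | g 1 0 = 0}
  one_mem' := by simp
  mul_mem' := by
    intro a b ha hb
    simp only [Set.mem_ofPred_eq] at ha hb ⊢
    simp [Matrix.mul_apply, Fin.sum_univ_two, ha, hb]
  inv_mem' := by
    intro a ha
    simp only [Set.mem_ofPred_eq] at ha ⊢
    simp [Matrix.SpecialLinearGroup.SL2_inv_expl, ha]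

/-- The image of `SL₂(ℤ)` in `SL₂(F)`. -/
def sl2Z : Subgroup SL(2, F) :=
  (Matrix.SpecialLinearGroup.map (n := Fin 2) (Int.castRingHom F)).range

variable {F}

/-- The matrix with bottom row `(1, β)` for `β ∈ F`, and the identity, with bottom row `(0, 1)`,
for `∞`. Modulo `B(F)` on the left this is the identification `ℙ¹(F) ≅ B(F) \ SL₂(F)`. -/
def cuspLift (p : OnePoint F) : SL(2, F) :=
  p.elim 1 (fun β => ⟨!![0, -1; 1, β], by simp [Matrix.det_fin_two]⟩)

theorem cuspLift_infty : cuspLift (OnePoint.infty : OnePoint F) = 1 := rfl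

theorem cuspLift_coe (β : F) : (cuspLift (β : OnePoint F)).1 = !![0, -1; 1, β] := rfl

/-- `S₀ ∪ {∞} ⊆ ℙ¹(F)` is a set of representatives of `B(F) \ SL₂(F) / SL₂(ℤ)`. -/
def IsRepSet (S₀ : Set F) : Prop :=
  Set.BijOn (fun p : OnePoint F => DoubleCoset.mk (borelSubgroup F) (sl2Z F) (cuspLift p))
    (insert OnePoint.infty ((fun β : F => (β : OnePoint F)) '' S₀)) Set.univ

end Cosets

/-! ### The polynomials `P` and `Q` -/

section Polynomials

variable {ι : Type*} [Fintype ι]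

/-- `Q_{m,r}(x) = (x₁⋯xₘ)^r`. -/
def Q (r : ℕ) (x : ι → ℝ) : ℝ := (∏ j, x j) ^ r

variable [DecidableEq ι]

/-- The operator `∂/∂x₁ + ⋯ + ∂/∂xₘ`. -/
def sumPartial (g : (ι → ℝ) → ℝ) : (ι → ℝ) → ℝ :=
  fun x => ∑ j, fderiv ℝ g x (Pi.single j 1)

/-- `P_{m,k,ℓ}(x) = (x₁⋯xₘ)^(k+ℓ) (∂₁ + ⋯ + ∂ₘ)^ℓ (x₁⋯xₘ)^(-k)`
(at points with nonzero coordinates). -/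
def P (k l : ℕ) (x : ι → ℝ) : ℝ :=
  (∏ j, x j) ^ (k + l) * (sumPartial^[l] (fun y : ι → ℝ => (∏ j, y j) ^ (-(k : ℤ)))) x

end Polynomials

/-! ### The terms of the formula -/

/-- The Petersson inner product `∫_{SL₂(ℤ)\ℍ} g(τ) conj(f(τ)) v^w du dv / v²` in weight `w`; the
measure on `ℍ` is `du dv / v²`. -/
def peterssonInner (w : ℤ) (g f : ℍ → ℂ) : ℂ :=
  ∫ τ in ModularGroup.fd, petersson w f g τ

/-- `𝐞(x) = exp(2πix)`. -/
def e (x : ℝ) : ℂ := Complex.exp (2 * Real.pi * Complex.I * x)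

/-- The `n`-th Fourier coefficient `c(n)` of `f = ∑ c(n) qⁿ`. -/
def coeff (f : ℍ → ℂ) (n : ℕ) : ℂ := (qExpansion 1 f).coeff n

section Terms

variable {F : Type*} [Field F] [NumberField F]

/-- The differences `βⱼ - βⱼ'` for `j' ≠ j`; the real embedding `σ` plays the role of `j`. -/
def differences (β : F) (σ : F →+* ℝ) : {σ' : F →+* ℝ // σ' ≠ σ} → ℝ :=
  fun σ' => σ β - σ'.1 β

/-- The summand `𝐞(nx) conj(c(n)) / n^s` of the twisted Dirichlet series. -/
def dirichletTerm (f : ℍ → ℂ) (x : ℝ) (s : ℕ) (n : ℕ+) : ℂ :=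
  e ((n : ℕ) * x) * conj (coeff f n) / ((n : ℕ) : ℂ) ^ s

open scoped Classical in
/-- The contribution of `β` to the inner product, up to a constant. -/
def betaTerm (d k : ℕ) (f : ℍ → ℂ) (β : F) : ℂ :=
  ((A β : ℚ) : ℂ) ^ (-(k : ℤ)) *
    ∑ l ∈ Finset.range k, ((k - 1).choose l : ℂ) * (2 * Real.pi * Complex.I) ^ (k - 1 - l) *
      ∑ σ : F →+* ℝ,
        ((P k l (differences β σ) / Q (k + l) (differences β σ) : ℝ) : ℂ) *
          ∑' n : ℕ+, dirichletTerm f (σ β) ((d - 1) * k + l) n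

end Terms

end HeckeDiagonal

end

/-! Pull `c` out of each linear form. As `k` is even, a pair `(c, δ)` of slope `β = δ/c` contributes
`|Nm c|^(-k) ∏ (τ + β_j)^(-k)`. Pairs modulo units, over all ideal classes, correspond to a slope
together with an integral ideal `I = (𝓞c + 𝓞δ)𝔞⁻¹` (`slopeIdealEquiv`), and `|Nm c| = A_β Nm(I)
Nm(𝔞)`. The sum over `I` is therefore `ζ_F(k)` and cancels the normalisation, leaving `1 + ∑_β
A_β^(-k) ∏ (τ + β_j)^(-k)` (`heckeEDiag_eq_tsum`). Balancing each pair by a unit makes the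
convergence uniform on the fundamental domain, so the pairing with `f` may be integrated term by
term (`summable_peterssonTerm`).

`SL₂(ℤ)` permutes the slope terms in weight `dk` (`slopeTerm_slash`), the constant `1` playing the
role of slope `∞`. The orbit of `∞` is `ℙ¹(ℚ)`; it unfolds to the integral of `conj f` over a strip,
which vanishes because `c(0) = 0` (`tsum_integral_ratCast_eq_zero`). An irrational `β` generates
`F`, so it has degree `d ≥ 3` and satisfies no rational quadratic equation. Its stabiliser is thus
`±1` (`mobius_injOn`), and its orbit unfolds to an integral over all of `ℍ`
(`hasSum_integral_repSet`).

That integral is explicit. The `β_j` are distinct, so `∏ (τ + β_j)^(-k)` has a partial fraction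
expansion, whose coefficients are Taylor coefficients given by `P/Q` (`fracCoeff_eq`). Fourier
inversion gives its `n`-th Fourier coefficient along a horizontal line, the `q`-expansion of `f`
pairs these with `conj c(n)`, and the remaining integral over `v` is a Gamma integral, producing the
powers of `n` (`integral_peterssonTerm`). -/

namespace HeckeDiagonal

/-! ### Laplace transforms of monomials -/

section Laplace

open MeasureTheory Set Filter Topology

/-- The integrand of the Laplace transform of a monomial is integrable. -/
theorem integrableOn_pow_mul_cexp (m : ℕ) {a : ℂ} (ha : a.re < 0) :
    IntegrableOn (fun t : ℝ => (t : ℂ) ^ m * Complex.exp (a * t)) (Ioi 0) := by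
  have h := integrableOn_rpow_mul_exp_neg_mul_rpow (p := 1) (s := m) (b := -a.re)
    (by have : (0 : ℝ) ≤ m := m.cast_nonneg
        linarith) one_pos (by linarith)
  refine Integrable.mono' h (by fun_prop) ?_
  filter_upwards [ae_restrict_mem measurableSet_Ioi] with t ht
  rw [norm_mul, norm_pow, Complex.norm_real, Real.norm_of_nonneg (le_of_lt ht),
    Complex.norm_exp]
  simp [Real.rpow_one]

theorem integral_pow_mul_cexp (m : ℕ) {a : ℂ} (ha : a.re < 0) :
    ∫ t in Ioi (0 : ℝ), (t : ℂ) ^ m * Complex.exp (a * t) = m.factorial / (-a) ^ (m + 1) := by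
  have ha0 : a ≠ 0 := by rintro rfl; simp at ha
  induction m with
  | zero =>
    have := integral_exp_mul_complex_Ioi ha 0
    simpa [neg_div, div_neg] using this
  | succ m ih =>
    have hderiv : ∀ t ∈ Ici (0 : ℝ), HasDerivAt
        (fun t : ℝ => (t : ℂ) ^ (m + 1) * Complex.exp (a * t))
        ((m + 1) * ((t : ℂ) ^ m * Complex.exp (a * t)) +
          a * ((t : ℂ) ^ (m + 1) * Complex.exp (a * t))) t := by
      intro t _
      have h1 : HasDerivAt (fun z : ℂ => z ^ (m + 1) * Complex.exp (a * z))
          ((m + 1) * ((t : ℂ) ^ m * Complex.exp (a * t)) +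
          a * ((t : ℂ) ^ (m + 1) * Complex.exp (a * t))) (t : ℂ) := by
        have := (hasDerivAt_pow (m + 1) (t : ℂ)).mul
          (((hasDerivAt_id (t : ℂ)).const_mul a).cexp)
        refine this.congr_deriv ?_
        simp
        ring
      exact h1.comp_ofReal
    have hlim : Tendsto (fun t : ℝ => (t : ℂ) ^ (m + 1) * Complex.exp (a * t)) atTop (𝓝 0) := by
      rw [tendsto_zero_iff_norm_tendsto_zero]
      have := tendsto_rpow_mul_exp_neg_mul_atTop_nhds_zero (m + 1 : ℕ) (-a.re) (by linarith)
      refine this.congr' ?_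
      filter_upwards [eventually_ge_atTop 0] with t ht
      rw [norm_mul, norm_pow, Complex.norm_real, Real.norm_of_nonneg ht, Complex.norm_exp,
        Real.rpow_natCast]
      simp
    have i1 := (integrableOn_pow_mul_cexp m ha).const_mul ((m : ℂ) + 1)
    have i2 := (integrableOn_pow_mul_cexp (m + 1) ha).const_mul a
    have key := integral_Ioi_of_hasDerivAt_of_tendsto' hderiv (i1.add i2) hlim
    rw [integral_add i1 i2, integral_const_mul, integral_const_mul, ih] at key
    have : a * ∫ t in Ioi (0 : ℝ), (t : ℂ) ^ (m + 1) * Complex.exp (a * t) =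
        -((m + 1) * (m.factorial / (-a) ^ (m + 1))) := by
      simp at key
      linear_combination key
    have hna : -a ≠ 0 := neg_ne_zero.mpr ha0
    rw [eq_div_iff (pow_ne_zero _ hna), Nat.factorial_succ, pow_succ]
    have h2 : m.factorial / (-a) ^ (m + 1) * (-a) ^ (m + 1) = (m.factorial : ℂ) :=
      div_mul_cancel₀ _ (pow_ne_zero _ hna)
    push_cast
    linear_combination -(-a) ^ (m + 1) * this + (m + 1) * h2

end Laplace

/-! ### Partial fractions of a product of equal powers -/

section PartialFractions

open Polynomial Filter Topology

variable {ι : Type*} [Fintype ι] [DecidableEq ι]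

/-- The coefficient of `(z + b j)⁻⁽ᵏ⁻ˡ⁾` in the partial fraction expansion of
`∏ (z + b j)⁻ᵏ`. -/
noncomputable def fracCoeff (k : ℕ) (b : ι → ℝ) (j : ι) (l : ℕ) : ℝ :=
  iteratedDeriv l (fun t : ℝ => ∏ i ∈ Finset.univ.erase j, (t + (b i - b j)) ^ (-(k : ℤ))) 0 /
    l.factorial

/-- Divide `1` by the product of the pairwise coprime `(X + b i)^k`, expanding in powers of each
linear factor: the digits are constants because their degree is below one. -/
theorem exists_partialFraction [Nonempty ι] {k : ℕ} (hk : 0 < k) {b : ι → ℝ}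
    (hb : Function.Injective b) :
    ∃ c : ι → Fin k → ℝ, (1 : ℝ[X]) = ∑ i, ∑ l, C (c i l) * (X + C (b i)) ^ l.1 *
      ∏ j ∈ Finset.univ.erase i, (X + C (b j)) ^ k := by
  obtain ⟨q, r, hr, h⟩ := eq_quo_mul_prod_pow_add_sum_rem_mul_prod_pow (s := Finset.univ)
    (1 : ℝ[X]) (g := fun i => X + C (b i)) (fun i _ => monic_X_add_C _)
    (by
      intro i _ j _ hij
      have := pairwise_coprime_X_sub_C (K := ℝ) (s := fun i => - b i)
        (fun x y h => hb (neg_injective h)) hij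
      simpa [Function.onFun] using this) (fun _ => k)
  have hrc : ∀ i l, r i l = C ((r i l).coeff 0) := by
    intro i l
    apply eq_C_of_degree_le_zero
    have := hr i (Finset.mem_univ _) l
    rw [degree_X_add_C] at this
    exact Nat.WithBot.lt_one_iff_le_zero.mp this
  -- The quotient times a monic polynomial of degree `card ι * k` equals `1` minus the digit terms,
  -- all of smaller degree.
  have hq : q = 0 := by
    by_contra hq
    have hmon : ∀ s : Finset ι, (∏ i ∈ s, (X + C (b i)) ^ k).Monic := fun s =>
      monic_prod_of_monic _ _ fun i _ => (monic_X_add_C _).pow _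
    have hdeg : ∀ s : Finset ι, (∏ i ∈ s, (X + C (b i)) ^ k).natDegree = s.card * k := by
      intro s
      rw [natDegree_prod_of_monic _ _ fun i _ => (monic_X_add_C _).pow _]
      simp [natDegree_pow]
    have hD : 0 < Fintype.card ι * k := Nat.mul_pos Fintype.card_pos hk
    have hlt : (1 - ∑ i, ∑ l, r i l * (X + C (b i)) ^ l.1 *
        ∏ j ∈ Finset.univ.erase i, (X + C (b j)) ^ k).degree <
        ((Fintype.card ι * k : ℕ) : WithBot ℕ) := by
      refine (degree_sub_le _ _).trans_lt (max_lt ?_ ?_)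
      · rw [degree_one]
        exact_mod_cast hD
      · refine (degree_sum_le _ _).trans_lt ((Finset.sup_lt_iff (WithBot.bot_lt_coe _)).mpr ?_)
        intro i _
        refine (degree_sum_le _ _).trans_lt ((Finset.sup_lt_iff (WithBot.bot_lt_coe _)).mpr ?_)
        intro l _
        rw [hrc i l]
        refine degree_le_natDegree.trans_lt ?_
        rw [Nat.cast_lt]
        rw [mul_assoc]
        refine (natDegree_C_mul_le _ _).trans_lt (natDegree_mul_le.trans_lt ?_)
        rw [hdeg, natDegree_pow, natDegree_X_add_C, Finset.card_erase_of_mem (Finset.mem_univ _),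
          Finset.card_univ]
        have : Fintype.card ι * k = k + (Fintype.card ι - 1) * k := by
          obtain ⟨n, hn⟩ := Nat.exists_eq_succ_of_ne_zero (Fintype.card_ne_zero (α := ι))
          rw [hn]; simp; ring
        have := l.2
        omega
    have heq : q * ∏ i, (X + C (b i)) ^ k = 1 - ∑ i, ∑ l, r i l * (X + C (b i)) ^ l.1 *
        ∏ j ∈ Finset.univ.erase i, (X + C (b j)) ^ k := by
      rw [eq_sub_iff_add_eq]; exact h.symm
    rw [← heq, degree_eq_natDegree (mul_ne_zero hq (hmon _).ne_zero), Nat.cast_lt,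
      natDegree_mul hq (hmon _).ne_zero, hdeg, Finset.card_univ] at hlt
    omega
  refine ⟨fun i l => (r i l).coeff 0, ?_⟩
  rw [hq, zero_mul, zero_add] at h
  refine h.trans (Finset.sum_congr rfl fun i _ => Finset.sum_congr rfl fun l _ => ?_)
  rw [← hrc i l]

/-- Expand at the pole `-b j`: dividing by the other factors exhibits the coefficients at `j` as the
Taylor coefficients, up to order `k - 1`, of the product of the remaining inverse powers. -/
theorem partialFraction_coeff {k : ℕ} {b : ι → ℝ}
    (hb : Function.Injective b) {c : ι → Fin k → ℝ}
    (h : (1 : ℝ[X]) = ∑ i, ∑ l, C (c i l) * (X + C (b i)) ^ l.1 *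
      ∏ j ∈ Finset.univ.erase i, (X + C (b j)) ^ k) (j : ι) (l : Fin k) :
    c j l = fracCoeff k b j l := by
  set g : ℝ → ℝ := fun t => ∏ i ∈ Finset.univ.erase j, (t + (b i - b j)) ^ (-(k : ℤ)) with hg
  set p : ℝ → ℝ := fun t => ∏ i ∈ Finset.univ.erase j, (t + (b i - b j)) ^ k with hp
  set w : ℝ → ℝ := fun t => ∑ i ∈ Finset.univ.erase j, ∑ m : Fin k, c i m *
    (t + (b i - b j)) ^ m.1 * ∏ j' ∈ (Finset.univ.erase i).erase j, (t + (b j' - b j)) ^ k with hw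
  have hne : ∀ i ∈ Finset.univ.erase j, b i - b j ≠ 0 := fun i hi =>
    sub_ne_zero.mpr fun e => (Finset.ne_of_mem_erase hi) (hb e)
  have hp0 : p 0 ≠ 0 := by
    simp only [hp, zero_add]
    exact Finset.prod_ne_zero_iff.mpr fun i hi => pow_ne_zero _ (hne i hi)
  have hpc : ContDiff ℝ ⊤ p := by
    simp only [hp]
    fun_prop
  have hwc : ContDiff ℝ ⊤ w := by
    simp only [hw]
    fun_prop
  have hpe : ∀ᶠ t in 𝓝 (0 : ℝ), p t ≠ 0 := hpc.continuous.continuousAt.eventually_ne hp0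
  have hgp : ∀ t, g t = (p t)⁻¹ := by
    intro t
    simp only [hg, hp, ← Finset.prod_inv_distrib, zpow_neg, zpow_natCast]
  -- Evaluation at `t - b j` puts the pole at the origin; every term with `i ≠ j` carries the factor
  -- `t ^ k`, invisible to derivatives at `0` of order below `k`.
  have heval : ∀ t : ℝ, 1 = (∑ m : Fin k, c j m * t ^ m.1) * p t + t ^ k * w t := by
    intro t
    have := congrArg (Polynomial.eval (t - b j)) h
    rw [← Finset.add_sum_erase _ _ (Finset.mem_univ j)] at this
    simp only [eval_one, eval_add, eval_finsetSum, eval_mul, eval_C, eval_pow, eval_X,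
      eval_prod] at this
    rw [this, Finset.sum_mul, hw]
    simp only [Finset.mul_sum]
    congr 1
    · refine Finset.sum_congr rfl fun m _ => ?_
      rw [hp]
      congr 1
      · simp
      · refine Finset.prod_congr rfl fun i _ => ?_
        congr 1; ring
    · refine Finset.sum_congr rfl fun i hi => Finset.sum_congr rfl fun m _ => ?_
      have hji : j ∈ Finset.univ.erase i :=
        Finset.mem_erase.mpr ⟨(Finset.ne_of_mem_erase hi).symm, Finset.mem_univ _⟩
      rw [← Finset.mul_prod_erase _ _ hji]
      have e : ∀ i, t - b j + b i = t + (b i - b j) := fun i => by ring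
      simp only [e, sub_self, add_zero]
      ring
  have hev : g =ᶠ[𝓝 0] fun t => (∑ m : Fin k, c j m * t ^ m.1) + t ^ k * (w t * (p t)⁻¹) := by
    filter_upwards [hpe] with t ht
    rw [hgp]
    have := heval t
    field_simp
    linear_combination this
  have hhc : ContDiffAt ℝ (l : ℕ) (fun t => w t * (p t)⁻¹) 0 :=
    (hwc.contDiffAt.of_le le_top).mul ((hpc.contDiffAt.of_le le_top).inv hp0)
  rw [fracCoeff, hev.iteratedDeriv_eq, eq_div_iff (by positivity)]
  rw [iteratedDeriv_fun_add (by fun_prop) (ContDiffAt.mul (by fun_prop) hhc),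
    iteratedDeriv_fun_mul (by fun_prop) hhc, iteratedDeriv_fun_sum (fun i _ => by fun_prop)]
  have h1 : ∀ m ∈ Finset.range (l + 1), ((l : ℕ).choose m : ℝ) *
      iteratedDeriv m (fun t : ℝ => t ^ k) 0 *
      iteratedDeriv (l - m) (fun t => w t * (p t)⁻¹) 0 = 0 := by
    intro m hm
    have : m ≠ k := by have := l.2; have := Finset.mem_range.mp hm; omega
    rw [iteratedDeriv_fun_pow_zero, if_neg this]
    simp
  rw [Finset.sum_eq_zero h1, add_zero, Finset.sum_eq_single l]
  · rw [iteratedDeriv_const_mul_field, iteratedDeriv_fun_pow_zero, if_pos rfl]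
  · intro m _ hml
    rw [iteratedDeriv_const_mul_field, iteratedDeriv_fun_pow_zero, if_neg, Nat.cast_zero,
      mul_zero]
    exact fun e => hml (Fin.ext e.symm)
  · simp

theorem prod_zpow_eq_sum_fracCoeff [Nonempty ι] {k : ℕ} (hk : 0 < k) {b : ι → ℝ}
    (hb : Function.Injective b) {z : ℂ} (hz : ∀ j, z + b j ≠ 0) :
    ∏ j, (z + b j) ^ (-(k : ℤ)) =
      ∑ j, ∑ l ∈ Finset.range k, (fracCoeff k b j l : ℂ) * ((z + b j) ^ (k - l))⁻¹ := by
  obtain ⟨c, hc⟩ := exists_partialFraction hk hb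
  have h1 := congrArg (Polynomial.aeval z) hc
  simp only [map_one, map_sum, map_mul, map_pow, map_add, aeval_X, aeval_C, map_prod,
    Complex.coe_algebraMap] at h1
  simp only [zpow_neg, zpow_natCast]
  rw [← one_mul (∏ j, _), h1, Finset.sum_mul]
  refine Finset.sum_congr rfl fun i _ => ?_
  rw [Finset.sum_mul, Finset.sum_range]
  refine Finset.sum_congr rfl fun l _ => ?_
  rw [← partialFraction_coeff hb hc, ← Finset.mul_prod_erase _ _ (Finset.mem_univ i),
    Finset.prod_inv_distrib]
  have hP : ∏ j ∈ Finset.univ.erase i, (z + b j) ^ k ≠ 0 :=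
    Finset.prod_ne_zero_iff.mpr fun j _ => pow_ne_zero _ (hz j)
  have hsplit : (z + b i) ^ k = (z + b i) ^ (k - l.1) * (z + b i) ^ l.1 := by
    rw [← pow_add]; congr 1; have := l.2; omega
  rw [hsplit]
  have h3 := pow_ne_zero l.1 (hz i)
  have h4 := pow_ne_zero (k - l.1) (hz i)
  field_simp

end PartialFractions


/-! ### Fourier coefficients along horizontal lines -/

section FourierIntegral

open MeasureTheory Set Filter Topology
open scoped FourierTransform RealInnerProductSpace

variable {ι : Type*} [Fintype ι]

/-- The product `∏ (z + b j)⁻ᵏ`. -/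
noncomputable def prodPow (k : ℕ) (b : ι → ℝ) (z : ℂ) : ℂ := ∏ j, (z + b j) ^ (-(k : ℤ))

/-- Two powers of a single factor already give quadratic decay; everything else is bounded using `|z
+ b j| ≥ im z`. -/
theorem norm_prodPow_le [Nonempty ι] {k : ℕ} (hk : 2 ≤ k) (b : ι → ℝ) {v : ℝ} (hv : 0 < v) :
    ∃ C B : ℝ, ∀ u : ℝ, ‖prodPow k b (u + v * Complex.I)‖ ≤ C * (1 + (u + B) ^ 2)⁻¹ := by
  classical
  obtain ⟨j₀⟩ := ‹Nonempty ι›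
  have hnorm : ∀ (u : ℝ) j, v ≤ ‖(u : ℂ) + v * Complex.I + b j‖ := by
    intro u j
    have := Complex.abs_im_le_norm ((u : ℂ) + v * Complex.I + b j)
    simp [abs_of_pos hv] at this
    exact this
  have hsq : ∀ u : ℝ, min 1 (v ^ 2) * (1 + (u + b j₀) ^ 2) ≤
      ‖(u : ℂ) + v * Complex.I + b j₀‖ ^ 2 := by
    intro u
    rw [← Complex.normSq_eq_norm_sq, Complex.normSq_apply]
    simp
    nlinarith [min_le_left 1 (v ^ 2), min_le_right 1 (v ^ 2), sq_nonneg (u + b j₀)]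
  have hm : 0 < min 1 (v ^ 2) := lt_min one_pos (by positivity)
  refine ⟨(v ^ (k - 2))⁻¹ * (min 1 (v ^ 2))⁻¹ * ∏ j ∈ Finset.univ.erase j₀, (v ^ k)⁻¹, b j₀,
    fun u => ?_⟩
  rw [prodPow, norm_prod, ← Finset.mul_prod_erase _ _ (Finset.mem_univ j₀)]
  simp only [zpow_neg, zpow_natCast, norm_inv, norm_pow]
  have h1 : (‖(u : ℂ) + v * Complex.I + b j₀‖ ^ k)⁻¹ ≤
      (v ^ (k - 2))⁻¹ * ((min 1 (v ^ 2))⁻¹ * (1 + (u + b j₀) ^ 2)⁻¹) := by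
    rw [← mul_inv, ← mul_inv]
    apply inv_anti₀ (by positivity)
    calc v ^ (k - 2) * (min 1 (v ^ 2) * (1 + (u + b j₀) ^ 2))
        ≤ ‖(u : ℂ) + v * Complex.I + b j₀‖ ^ (k - 2) * ‖(u : ℂ) + v * Complex.I + b j₀‖ ^ 2 := by
          gcongr
          · exact hnorm u j₀
          · exact hsq u
      _ = _ := by rw [← pow_add]; congr 1; omega
  have h2 : ∏ j ∈ Finset.univ.erase j₀, (‖(u : ℂ) + v * Complex.I + b j‖ ^ k)⁻¹ ≤
      ∏ j ∈ Finset.univ.erase j₀, (v ^ k)⁻¹ := by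
    refine Finset.prod_le_prod (fun _ _ => by positivity) fun j _ => ?_
    apply inv_anti₀ (by positivity)
    gcongr
    exact hnorm u j
  calc _ ≤ ((v ^ (k - 2))⁻¹ * ((min 1 (v ^ 2))⁻¹ * (1 + (u + b j₀) ^ 2)⁻¹)) *
        ∏ j ∈ Finset.univ.erase j₀, (v ^ k)⁻¹ := by
        gcongr
    _ = _ := by ring

theorem add_ne_zero_of_im_pos (u b : ℝ) {v : ℝ} (hv : 0 < v) :
    (u : ℂ) + v * Complex.I + b ≠ 0 := by
  intro h
  have := congrArg Complex.im h
  simp at this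
  exact hv.ne' this

theorem continuous_prodPow (k : ℕ) (b : ι → ℝ) {v : ℝ} (hv : 0 < v) :
    Continuous fun u : ℝ => prodPow k b (u + v * Complex.I) := by
  unfold prodPow
  refine continuous_finsetProd _ fun j _ => ?_
  exact Continuous.zpow₀ (by fun_prop) _ fun u => Or.inl (add_ne_zero_of_im_pos u _ hv)

theorem integrable_prodPow [Nonempty ι] {k : ℕ} (hk : 2 ≤ k) (b : ι → ℝ) {v : ℝ} (hv : 0 < v) :
    Integrable fun u : ℝ => prodPow k b (u + v * Complex.I) := by
  obtain ⟨C, B, h⟩ := norm_prodPow_le hk b hv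
  refine Integrable.mono' ((integrable_inv_one_add_sq.comp_add_right B).const_mul C)
    (continuous_prodPow k b hv).aestronglyMeasurable (Eventually.of_forall h)

variable [DecidableEq ι]

/-- The density whose Laplace transform along vertical lines is `∏ (z + b j)⁻ᵏ`. -/
noncomputable def laplaceDensity (k : ℕ) (b : ι → ℝ) (t : ℝ) : ℂ :=
  ∑ j, ∑ l ∈ Finset.range k, (fracCoeff k b j l : ℂ) *
    ((-(2 * Real.pi * Complex.I)) ^ (k - l) / ((k - l - 1).factorial : ℂ)) *
      ((t : ℂ) ^ (k - l - 1) * Complex.exp (2 * Real.pi * Complex.I * b j * t))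

theorem continuous_laplaceDensity (k : ℕ) (b : ι → ℝ) : Continuous (laplaceDensity k b) := by
  unfold laplaceDensity
  fun_prop

theorem laplaceDensity_mul_cexp (k : ℕ) (b : ι → ℝ) (z : ℂ) (t : ℝ) :
    laplaceDensity k b t * Complex.exp (2 * Real.pi * Complex.I * z * t) =
    ∑ j, ∑ l ∈ Finset.range k, (fracCoeff k b j l : ℂ) *
    ((-(2 * Real.pi * Complex.I)) ^ (k - l) / ((k - l - 1).factorial : ℂ)) *
      ((t : ℂ) ^ (k - l - 1) * Complex.exp (2 * Real.pi * Complex.I * (z + b j) * t)) := by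
  rw [laplaceDensity, Finset.sum_mul]
  refine Finset.sum_congr rfl fun j _ => ?_
  rw [Finset.sum_mul]
  refine Finset.sum_congr rfl fun l _ => ?_
  rw [show 2 * Real.pi * Complex.I * (z + b j) * (t : ℂ) =
    2 * Real.pi * Complex.I * b j * t + 2 * Real.pi * Complex.I * z * t by ring, Complex.exp_add]
  ring

theorem re_two_pi_I_mul_neg {z : ℂ} (hz : 0 < z.im) (x : ℝ) :
    (2 * Real.pi * Complex.I * (z + x)).re < 0 := by
  simp
  positivity

theorem integrableOn_laplaceDensity_mul_cexp (k : ℕ) (b : ι → ℝ) {z : ℂ} (hz : 0 < z.im) :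
    IntegrableOn (fun t : ℝ => laplaceDensity k b t *
      Complex.exp (2 * Real.pi * Complex.I * z * t)) (Ioi 0) := by
  simp only [laplaceDensity_mul_cexp]
  refine integrable_finsetSum _ fun j _ => integrable_finsetSum _ fun l _ => ?_
  exact (integrableOn_pow_mul_cexp _ (re_two_pi_I_mul_neg hz _)).const_mul _

/-- Each partial fraction `(z + b j)^(-(k-l))` is the Laplace transform of a monomial of degree `k -
l - 1` times an exponential; the constants in `laplaceDensity` are chosen for this. -/
theorem integral_laplaceDensity_mul_cexp [Nonempty ι] {k : ℕ} (hk : 0 < k) {b : ι → ℝ}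
    (hb : Function.Injective b) {z : ℂ} (hz : 0 < z.im) :
    ∫ t in Ioi (0 : ℝ), laplaceDensity k b t * Complex.exp (2 * Real.pi * Complex.I * z * t) =
      prodPow k b z := by
  have hi : ∀ j l, IntegrableOn (fun t : ℝ => (fracCoeff k b j l : ℂ) *
    ((-(2 * Real.pi * Complex.I)) ^ (k - l) / ((k - l - 1).factorial : ℂ)) *
      ((t : ℂ) ^ (k - l - 1) * Complex.exp (2 * Real.pi * Complex.I * (z + b j) * t))) (Ioi 0) :=
    fun j l => (integrableOn_pow_mul_cexp _ (re_two_pi_I_mul_neg hz _)).const_mul _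
  have hz0 : ∀ j, z + b j ≠ 0 := fun j h => by
    have := congrArg Complex.im h
    simp at this
    exact hz.ne' this
  simp only [laplaceDensity_mul_cexp]
  rw [integral_finsetSum _ fun j _ => integrable_finsetSum _ fun l _ => hi j l, prodPow,
    prod_zpow_eq_sum_fracCoeff hk hb hz0]
  refine Finset.sum_congr rfl fun j _ => ?_
  rw [integral_finsetSum _ fun l _ => hi j l]
  refine Finset.sum_congr rfl fun l hl => ?_
  rw [integral_const_mul, integral_pow_mul_cexp _ (re_two_pi_I_mul_neg hz _)]
  have hkl : k - l - 1 + 1 = k - l := by have := Finset.mem_range.mp hl; omega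
  rw [hkl, show -(2 * Real.pi * Complex.I * (z + b j)) = -(2 * Real.pi * Complex.I) * (z + b j) by
    ring, mul_pow]
  have h1 : (-(2 * Real.pi * Complex.I)) ^ (k - l) ≠ 0 :=
    pow_ne_zero _ (neg_ne_zero.mpr Complex.two_pi_I_ne_zero)
  have h2 := pow_ne_zero (k - l) (hz0 j)
  have h3 : ((k - l - 1).factorial : ℂ) ≠ 0 := by exact_mod_cast Nat.factorial_ne_zero _
  field_simp

/-- The Fourier coefficient of `∏ (z + b j)⁻ᵏ` along a horizontal line in the upper half plane. -/
theorem integral_prodPow_mul_cexp [Nonempty ι] {k : ℕ} (hk : 2 ≤ k) {b : ι → ℝ}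
    (hb : Function.Injective b) {v : ℝ} (hv : 0 < v) {x : ℝ} (hx : 0 < x) :
    ∫ u : ℝ, prodPow k b (u + v * Complex.I) * Complex.exp (-(2 * Real.pi * Complex.I * x * u)) =
      laplaceDensity k b x * Complex.exp (-(2 * Real.pi * v * x)) := by
  -- The damped density, cut off to `t > 0`, has inverse Fourier transform `prodPow` on the line of
  -- height `v`; Fourier inversion at `x > 0` needs continuity only there, not at the cut-off.
  set F : ℝ → ℂ := (Ioi (0 : ℝ)).indicator
    (fun t => laplaceDensity k b t * Complex.exp (-(2 * Real.pi * v * t))) with hF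
  have hexp : ∀ u t : ℝ, Complex.exp (2 * Real.pi * Complex.I * (u + v * Complex.I) * t) =
      Complex.exp (2 * Real.pi * Complex.I * u * t) * Complex.exp (-(2 * Real.pi * v * t)) := by
    intro u t
    rw [← Complex.exp_add]
    congr 1
    linear_combination 2 * Real.pi * v * t * Complex.I_mul_I
  have hFint : Integrable F := by
    rw [hF, integrable_indicator_iff measurableSet_Ioi]
    have := integrableOn_laplaceDensity_mul_cexp k b (z := (0 : ℝ) + v * Complex.I) (by simpa)
    refine this.congr_fun (fun t _ => ?_) measurableSet_Ioi
    simp only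
    rw [hexp]
    simp
  have hinv : 𝓕⁻ F = fun u : ℝ => prodPow k b (u + v * Complex.I) := by
    ext u
    rw [Real.fourierInv_eq', ← integral_laplaceDensity_mul_cexp (by omega) hb (by simpa),
      ← integral_indicator measurableSet_Ioi]
    refine integral_congr_ae (Eventually.of_forall fun t => ?_)
    simp only [hF, indicator]
    split_ifs with h
    · rw [hexp, smul_eq_mul]
      simp only [RCLike.inner_apply, conj_trivial]
      push_cast
      rw [show 2 * Real.pi * (u * t) * Complex.I = 2 * Real.pi * Complex.I * u * t by ring]
      ring
    · simp
  have hcont : ContinuousAt F x := by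
    have h1 : ContinuousAt (fun t : ℝ => laplaceDensity k b t *
        Complex.exp (-(2 * Real.pi * v * t))) x :=
      ((continuous_laplaceDensity k b).mul (by fun_prop)).continuousAt
    refine h1.congr ?_
    filter_upwards [Ioi_mem_nhds hx] with t ht
    simp [hF, mem_Ioi.mp ht]
  have hfour : 𝓕 F = fun u : ℝ => (𝓕⁻ F) (-u) := by
    ext u
    rw [Real.fourierInv_eq_fourier_neg, neg_neg]
  have key := hFint.fourier_fourierInv_eq
    (by rw [hfour, hinv]; exact (integrable_prodPow hk b hv).comp_neg) hcont
  rw [hinv, Real.fourier_eq'] at key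
  have hFx : F x = laplaceDensity k b x * Complex.exp (-(2 * Real.pi * v * x)) := by
    simp [hF, hx]
  rw [← hFx, ← key]
  refine integral_congr_ae (Eventually.of_forall fun u => ?_)
  simp only [RCLike.inner_apply, conj_trivial, smul_eq_mul]
  push_cast
  rw [mul_comm]
  congr 2
  ring

end FourierIntegral

/-! ### `P/Q` as derivatives along the diagonal -/

section Polynomials

open Filter Topology

theorem isOpen_forall_ne_zero {ι : Type*} [Finite ι] :
    IsOpen {x : ι → ℝ | ∀ i, x i ≠ 0} := by
  rw [Set.ofPred_forall]
  exact isOpen_iInter_of_finite fun i => isOpen_ne.preimage (continuous_apply i)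

variable {ι : Type*} [Fintype ι] [DecidableEq ι]

theorem sumPartial_eq (g : (ι → ℝ) → ℝ) (x : ι → ℝ) :
    sumPartial g x = fderiv ℝ g x (fun _ => 1) := by
  rw [sumPartial, ← map_sum]
  congr 1
  ext i
  simp [Finset.sum_apply, Pi.single_apply]

/-- The operator differentiates in the direction `(1, …, 1)`, so its iterates are ordinary
derivatives along `t ↦ x + t`. The equality is needed for all `t` near `0`, not just at `0`, so that
the induction can differentiate it. -/
theorem sumPartial_iterate {g : (ι → ℝ) → ℝ} (hg : ContDiffOn ℝ ⊤ g {x | ∀ i, x i ≠ 0}) (l : ℕ) :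
    ContDiffOn ℝ ⊤ (sumPartial^[l] g) {x | ∀ i, x i ≠ 0} ∧
    ∀ x : ι → ℝ, (∀ i, x i ≠ 0) → ∀ᶠ t in 𝓝 (0 : ℝ),
      sumPartial^[l] g (fun i => x i + t) = iteratedDeriv l (fun t => g (fun i => x i + t)) t := by
  induction l with
  | zero => exact ⟨hg, fun x _ => by simp⟩
  | succ l ih =>
    rw [Function.iterate_succ_apply']
    refine ⟨?_, fun x hx => ?_⟩
    · have : sumPartial (sumPartial^[l] g) = fun x => fderiv ℝ (sumPartial^[l] g) x (fun _ => 1) :=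
        funext fun x => sumPartial_eq _ _
      rw [this]
      exact (ih.1.fderiv_of_isOpen isOpen_forall_ne_zero le_top).clm_apply contDiffOn_const
    · have hnear : ∀ᶠ t in 𝓝 (0 : ℝ), ∀ i, x i + t ≠ 0 := by
        have hc : Continuous fun t : ℝ => fun i => x i + t := by fun_prop
        exact hc.continuousAt.eventually_mem
          (isOpen_forall_ne_zero.mem_nhds (by simpa using hx))
      filter_upwards [(ih.2 x hx).eventually_nhds, hnear] with t ht hne
      rw [iteratedDeriv_succ, sumPartial_eq, ← EventuallyEq.deriv_eq ht]
      have hd : DifferentiableAt ℝ (sumPartial^[l] g) (fun i => x i + t) :=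
        (ih.1.contDiffAt (isOpen_forall_ne_zero.mem_nhds hne)).differentiableAt (by simp)
      have hc : HasDerivAt (fun t : ℝ => fun i => x i + t) (fun _ => (1 : ℝ)) t :=
        hasDerivAt_pi.mpr fun i => (hasDerivAt_id t).const_add (x i)
      exact (hd.hasFDerivAt.comp_hasDerivAt t hc).deriv.symm

theorem P_div_Q (k l : ℕ) {x : ι → ℝ} (hx : ∀ i, x i ≠ 0) :
    P k l x / Q (k + l) x = iteratedDeriv l (fun t : ℝ => ∏ i, (x i + t) ^ (-(k : ℤ))) 0 := by
  have hg : ContDiffOn ℝ ⊤ (fun y : ι → ℝ => (∏ j, y j) ^ (-(k : ℤ))) {x | ∀ i, x i ≠ 0} := by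
    simp only [zpow_neg, zpow_natCast]
    refine ContDiffOn.inv (by fun_prop) fun y hy => ?_
    exact pow_ne_zero _ (Finset.prod_ne_zero_iff.mpr fun i _ => hy i)
  have h0 := ((sumPartial_iterate hg l).2 x hx).self_of_nhds
  have hQ : (∏ j, x j) ^ (k + l) ≠ 0 :=
    pow_ne_zero _ (Finset.prod_ne_zero_iff.mpr fun i _ => hx i)
  simp only [add_zero] at h0
  rw [P, Q, mul_div_cancel_left₀ _ hQ, h0]
  simp only [Finset.prod_zpow]

/-- The two sides use opposite differences. Negating all of them is harmless for even `k` but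
reverses `t`, whence the sign `(-1)^l`. -/
theorem fracCoeff_eq {k : ℕ} (hk : Even k) {b : ι → ℝ} (hb : Function.Injective b) (j : ι) (l : ℕ) :
    fracCoeff k b j l = (-1) ^ l * (P k l (fun i : {i // i ≠ j} => b j - b i) /
      Q (k + l) (fun i : {i // i ≠ j} => b j - b i)) / l.factorial := by
  rw [P_div_Q k l (fun i => sub_ne_zero.mpr fun e => i.2 (hb e).symm), fracCoeff]
  congr 1
  set G : ℝ → ℝ := fun t => ∏ i : {i // i ≠ j}, (b j - b i + t) ^ (-(k : ℤ)) with hG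
  have : (fun t : ℝ => ∏ i ∈ Finset.univ.erase j, (t + (b i - b j)) ^ (-(k : ℤ))) =
      fun t : ℝ => G (-t) := by
    ext t
    rw [hG, Finset.prod_subtype (p := fun i => i ≠ j) (Finset.univ.erase j) (by simp)
      (fun i => (t + (b i - b j)) ^ (-(k : ℤ)))]
    refine Finset.prod_congr rfl fun i _ => ?_
    rw [← Even.neg_zpow ((Int.even_coe_nat k).mpr hk).neg]
    congr 1; ring
  rw [this, iteratedDeriv_comp_neg]
  simp

end Polynomials


/-! ### Tiling the upper half plane by translates of the fundamental domain -/

section Unfolding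

open MeasureTheory Set Filter Topology
open scoped Modular Pointwise

theorem measurePreserving_sl_smul (g : SL(2, ℤ)) :
    MeasurePreserving (fun τ : ℍ => g • τ) volume volume :=
  measurePreserving_smul (g : GL (Fin 2) ℝ) (volume : Measure ℍ)

theorem measurableEmbedding_sl_smul (g : SL(2, ℤ)) :
    MeasurableEmbedding (fun τ : ℍ => g • τ) :=
  (Homeomorph.smul (g : GL (Fin 2) ℝ)).measurableEmbedding

theorem volume_eq_zero_of_image {s : Set ℍ} (h : volume (UpperHalfPlane.coe '' s) = 0) :
    volume s = 0 := by
  rw [volume_eq_lintegral]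
  exact setLIntegral_measure_zero _ _ h

theorem complex_volume_re_eq (x : ℝ) : volume {z : ℂ | z.re = x} = 0 := by
  have h := Complex.volume_preserving_equiv_real_prod.measure_preimage
    (s := ({x} : Set ℝ) ×ˢ (univ : Set ℝ)) (by measurability)
  rw [Measure.volume_eq_prod, Measure.prod_prod] at h
  simp only [Real.volume_singleton, zero_mul] at h
  convert h using 2
  ext z
  simp [Complex.measurableEquivRealProd]

/-- The boundary lies on two vertical lines and the unit circle. -/
theorem volume_fd_diff_fdo : volume (𝒟 \ 𝒟ᵒ) = 0 := by
  apply volume_eq_zero_of_image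
  refine measure_mono_null (t := {z : ℂ | z.re = 1 / 2} ∪ {z : ℂ | z.re = -(1 / 2)} ∪
    Metric.sphere 0 1) ?_ ?_
  · rintro _ ⟨τ, ⟨h1, h2⟩, rfl⟩
    by_contra hc
    apply h2
    simp only [mem_union, mem_ofPred_eq, mem_sphere_iff_norm, sub_zero, not_or] at hc
    refine ⟨?_, ?_⟩
    · refine lt_of_le_of_ne h1.1 fun e => hc.2 ?_
      rw [Complex.normSq_eq_norm_sq] at e
      nlinarith [norm_nonneg (τ : ℂ)]
    · refine lt_of_le_of_ne h1.2 fun e => ?_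
      rcases abs_eq (by norm_num : (0 : ℝ) ≤ 1 / 2) |>.mp e with e | e
      · exact hc.1.1 e
      · exact hc.1.2 e
  · refine measure_union_null (measure_union_null (complex_volume_re_eq _)
      (complex_volume_re_eq _)) ?_
    exact Measure.addHaar_sphere _ _ _

/-- A set of representatives of `SL₂(ℤ)` modulo `±1`. -/
def posReps : Set SL(2, ℤ) := {g | 0 < g 1 0 ∨ (g 1 0 = 0 ∧ 0 < g 1 1)}

theorem sl_bottom_ne_zero (g : SL(2, ℤ)) (h : g 1 0 = 0) : g 1 1 ≠ 0 := by
  intro h1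
  have := g.det_coe
  rw [Matrix.det_fin_two, h, h1] at this
  simp at this

theorem mem_posReps_or_neg_mem (g : SL(2, ℤ)) : g ∈ posReps ∨ -g ∈ posReps := by
  have := sl_bottom_ne_zero g
  simp only [posReps, mem_ofPred_eq, Matrix.SpecialLinearGroup.coe_neg, Matrix.neg_apply]
  omega

theorem neg_notMem_posReps {g : SL(2, ℤ)} (h : g ∈ posReps) : -g ∉ posReps := by
  simp only [posReps, mem_ofPred_eq, Matrix.SpecialLinearGroup.coe_neg, Matrix.neg_apply] at *
  omega

theorem eq_of_mem_posReps {g h : SL(2, ℤ)} (hg : g ∈ posReps) (hh : h ∈ posReps)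
    (e : g = h ∨ g = -h) : g = h := by
  rcases e with e | e
  · exact e
  · exact absurd (e ▸ hg) (neg_notMem_posReps hh)

theorem iUnion_posReps_smul_fd :
    ⋃ g : posReps, (fun τ : ℍ => (g : SL(2, ℤ)) • τ) '' 𝒟 = univ := by
  refine eq_univ_of_forall fun τ => ?_
  obtain ⟨g, hg⟩ := ModularGroup.exists_smul_mem_fd τ
  rw [mem_iUnion]
  rcases mem_posReps_or_neg_mem g⁻¹ with h | h
  · exact ⟨⟨_, h⟩, g • τ, hg, inv_smul_smul _ _⟩
  · exact ⟨⟨_, h⟩, g • τ, hg, by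
      simp only [ModularGroup.SL_neg_smul, inv_smul_smul]⟩

/-- If an interior point of one tile lies in another tile, the two group elements agree up to sign,
hence agree in `posReps`; so overlaps lie in the null boundary. -/
theorem aedisjoint_smul_fd : Pairwise (Function.onFun (AEDisjoint volume)
    fun g : posReps => (fun τ : ℍ => (g : SL(2, ℤ)) • τ) '' 𝒟) := by
  intro g h hgh
  have hsub : (fun τ : ℍ => (g : SL(2, ℤ)) • τ) '' 𝒟 ∩ (fun τ : ℍ => (h : SL(2, ℤ)) • τ) '' 𝒟 ⊆
      (fun τ : ℍ => (g : SL(2, ℤ)) • τ) '' (𝒟 \ 𝒟ᵒ) := by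
    rintro _ ⟨⟨τ, hτ, rfl⟩, ⟨w, hw, hwe⟩⟩
    refine ⟨τ, ⟨hτ, fun hτo => hgh (Subtype.ext ?_)⟩, rfl⟩
    have h1 : ((h : SL(2, ℤ))⁻¹ * g) • τ ∈ 𝒟 := by
      simp only at hwe
      rw [mul_smul, ← hwe, inv_smul_smul]
      exact hw
    refine eq_of_mem_posReps g.2 h.2
      ((ModularGroup.eq_one_or_neg_one_of_mem_fdo_mem_fd hτo h1).imp (fun e => ?_) fun e => ?_)
    · exact (inv_mul_eq_one.mp e).symm
    · rw [inv_mul_eq_iff_eq_mul] at e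
      rw [e, mul_neg, mul_one]
  refine measure_mono_null hsub ?_
  rw [← (measurePreserving_sl_smul g).measure_preimage_emb (measurableEmbedding_sl_smul g),
    preimage_image_eq _ (measurableEmbedding_sl_smul g).injective]
  exact volume_fd_diff_fdo

instance countable_sl2Z : Countable SL(2, ℤ) :=
  haveI : Countable (Matrix (Fin 2) (Fin 2) ℤ) := inferInstanceAs (Countable (Fin 2 → Fin 2 → ℤ))
  Subtype.countable

/-- Unfolding over `SL₂(ℤ)` modulo `±1`. -/
theorem hasSum_integral_smul_fd {φ : ℍ → ℂ}
    (hi : ∀ g ∈ posReps, IntegrableOn (fun τ => φ (g • τ)) 𝒟)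
    (hs : Summable fun g : posReps => ∫ τ in 𝒟, ‖φ ((g : SL(2, ℤ)) • τ)‖) :
    Integrable φ ∧ HasSum (fun g : posReps => ∫ τ in 𝒟, φ ((g : SL(2, ℤ)) • τ)) (∫ τ, φ τ) := by
  have hI : ∀ {E : Type} [NormedAddCommGroup E] [NormedSpace ℝ E] (ψ : ℍ → E) (g : SL(2, ℤ)),
      ∫ τ in (fun τ : ℍ => g • τ) '' 𝒟, ψ τ = ∫ τ in 𝒟, ψ (g • τ) := fun ψ g =>
    (measurePreserving_sl_smul g).setIntegral_image_emb (measurableEmbedding_sl_smul g) _ _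
  have hint : IntegrableOn φ (⋃ g : posReps, (fun τ : ℍ => (g : SL(2, ℤ)) • τ) '' 𝒟) := by
    refine integrableOn_iUnion_of_summable_integral_norm (fun g => ?_) ?_
    · exact ((measurePreserving_sl_smul g).integrableOn_image (measurableEmbedding_sl_smul g)).mpr
        (hi g g.2)
    · simpa only [hI] using hs
  have := hasSum_integral_iUnion_ae (fun g : posReps =>
    ((measurableEmbedding_sl_smul g).measurableSet_image.mpr
      ModularGroup.isClosed_fd.measurableSet).nullMeasurableSet) aedisjoint_smul_fd hint
  rw [iUnion_posReps_smul_fd] at this hint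
  rw [integrableOn_univ] at hint
  refine ⟨hint, ?_⟩
  simpa only [hI, Measure.restrict_univ] using this

end Unfolding

/-! ### Coordinates and volume on the upper half plane -/

section Coordinates

open MeasureTheory Set Filter Topology
open scoped Modular

theorem range_coe_upperHalfPlane : range UpperHalfPlane.coe = {z : ℂ | 0 < z.im} := by
  ext z
  exact ⟨by rintro ⟨τ, rfl⟩; exact τ.im_pos, fun h => ⟨⟨z, h⟩, rfl⟩⟩

theorem measurePreserving_coe : MeasurePreserving UpperHalfPlane.coe
    (volume.comap UpperHalfPlane.coe) (volume.restrict (range UpperHalfPlane.coe)) :=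
  ⟨measurable_coe, by rw [measurableEmbedding_coe.map_comap]⟩

/-- Integration over the upper half plane in the coordinates `u + iv`. -/
theorem integral_upperHalfPlane {g : ℍ → ℂ} (hg : Integrable g) :
    ∫ τ, g τ = ∫ v in Ioi (0 : ℝ), ∫ u : ℝ,
      (((v ^ 2)⁻¹ : ℝ) : ℂ) * g (ofComplex (u + v * Complex.I)) := by
  set G : ℂ → ℂ := fun z => (((z.im ^ 2)⁻¹ : ℝ) : ℂ) * g (ofComplex z) with hG
  have hmeas : Measurable fun z : ℍ => (1 / NNReal.mk z.im z.im_pos.le) ^ 2 := by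
    refine Measurable.pow_const (Measurable.div measurable_const ?_) _
    exact continuous_im.measurable.subtype_mk
  have hsm : ∀ z : ℍ, (1 / NNReal.mk z.im z.im_pos.le) ^ 2 • g z = G z := by
    intro z
    simp only [hG, ofComplex_apply, NNReal.smul_def]
    simp
  have hGint : IntegrableOn G (range UpperHalfPlane.coe) := by
    rw [IntegrableOn, ← measurePreserving_coe.integrable_comp_emb measurableEmbedding_coe]
    rw [volume_def, integrable_withDensity_iff_integrable_smul hmeas] at hg
    exact hg.congr (Eventually.of_forall hsm)
  have h1 : ∫ τ, g τ = ∫ z in range UpperHalfPlane.coe, G z := by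
    rw [← measurePreserving_coe.integral_comp measurableEmbedding_coe, volume_def,
      integral_withDensity_eq_integral_smul hmeas]
    exact integral_congr_ae (Eventually.of_forall hsm)
  have hset : Complex.measurableEquivRealProd.symm ⁻¹' range UpperHalfPlane.coe =
      univ ×ˢ Ioi (0 : ℝ) := by
    rw [range_coe_upperHalfPlane]
    ext p
    simp [Complex.measurableEquivRealProd]
  have hmp := Complex.volume_preserving_equiv_real_prod.symm
  have hemb := Complex.measurableEquivRealProd.symm.measurableEmbedding
  have hrestr : (volume : Measure (ℝ × ℝ)).restrict (univ ×ˢ Ioi (0 : ℝ)) =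
      (volume : Measure ℝ).prod (volume.restrict (Ioi (0 : ℝ))) := by
    rw [Measure.volume_eq_prod, ← Measure.prod_restrict, Measure.restrict_univ]
  have hGp : Integrable (fun p : ℝ × ℝ => G (Complex.measurableEquivRealProd.symm p))
      ((volume : Measure ℝ).prod (volume.restrict (Ioi (0 : ℝ)))) := by
    rw [← hrestr, ← hset]
    exact (hmp.integrableOn_comp_preimage hemb).mpr hGint
  rw [h1, ← hmp.setIntegral_preimage_emb hemb, hset, hrestr, integral_prod_symm _ hGp]
  refine setIntegral_congr_fun measurableSet_Ioi fun v _ => ?_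
  refine integral_congr_ae (Eventually.of_forall fun u => ?_)
  have : Complex.measurableEquivRealProd.symm (u, v) = u + v * Complex.I := by
    apply Complex.ext <;> simp [Complex.measurableEquivRealProd]
  simp only [this, hG]
  simp

/-- The domain sits in a half-strip of width one above height `1/2`, on which `y^(-2)` is
integrable. -/
theorem volume_fd_lt_top : volume (𝒟 : Set ℍ) < ⊤ := by
  rw [volume_eq_lintegral]
  have hsub : UpperHalfPlane.coe '' 𝒟 ⊆ Complex.measurableEquivRealProd ⁻¹'
      (Icc (-(1 / 2)) (1 / 2) ×ˢ Ioi (1 / 2 : ℝ)) := by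
    rintro _ ⟨τ, hτ, rfl⟩
    have h1 := hτ.2
    have h2 := ModularGroup.three_le_four_mul_im_sq_of_mem_fd hτ
    have h3 := τ.im_pos
    rw [abs_le] at h1
    refine ⟨⟨h1.1, h1.2⟩, ?_⟩
    show 1 / 2 < τ.im
    nlinarith
  refine (lintegral_mono_set hsub).trans_lt ?_
  have hmp := Complex.volume_preserving_equiv_real_prod
  have hmeas : Measurable fun p : ℝ × ℝ => (((1 / ‖p.2‖₊) ^ 2 : NNReal) : ENNReal) := by
    fun_prop
  have := hmp.setLIntegral_comp_preimage_emb Complex.measurableEquivRealProd.measurableEmbedding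
    (fun p : ℝ × ℝ => (((1 / ‖p.2‖₊) ^ 2 : NNReal) : ENNReal))
    (Icc (-(1 / 2)) (1 / 2) ×ˢ Ioi (1 / 2 : ℝ))
  refine lt_of_eq_of_lt this ?_
  rw [Measure.volume_eq_prod, ← Measure.prod_restrict, lintegral_prod _ hmeas.aemeasurable]
  simp only
  rw [lintegral_const]
  refine ENNReal.mul_lt_top ?_ (by simp)
  have hint : IntegrableOn (fun y : ℝ => y ^ (-2 : ℝ)) (Ioi (1 / 2 : ℝ)) :=
    integrableOn_Ioi_rpow_of_lt (by norm_num) (by norm_num)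
  refine lt_of_le_of_lt (setLIntegral_mono' measurableSet_Ioi fun y hy => ?_) hint.2
  have hy0 : (0 : ℝ) < y := lt_trans (by norm_num) (mem_Ioi.mp hy)
  rw [enorm_eq_nnnorm, ENNReal.coe_le_coe, ← NNReal.coe_le_coe]
  simp [Real.rpow_neg hy0.le, abs_of_pos hy0]

end Coordinates


/-! ### Real embeddings, heights and units -/

section Embeddings

open NumberField Module
open scoped Classical

variable {F : Type*} [Field F]

/-- The infinite place of a real embedding. -/
noncomputable def realPlace (σ : F →+* ℝ) : InfinitePlace F :=
  InfinitePlace.mk (Complex.ofRealHom.comp σ)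

theorem realPlace_apply (σ : F →+* ℝ) (x : F) : realPlace σ x = |σ x| := by
  simp [realPlace, InfinitePlace.apply]

section

variable [NumberField F]

/-- The largest archimedean absolute value of an algebraic integer, at least one. -/
noncomputable def height (x : 𝓞 F) : ℝ := max 1 ‖mixedEmbedding F (x : F)‖

theorem one_le_height (x : 𝓞 F) : 1 ≤ height x := le_max_left _ _

/-- The integers form a lattice of rank `[F : ℚ]` in the mixed space, so inverse powers of the norm
beyond the rank are summable. -/
theorem summable_height {m : ℕ} (hm : finrank ℚ F < m) :
    Summable fun x : 𝓞 F => (height x)⁻¹ ^ m := by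
  classical
  have hrank : finrank ℤ (mixedEmbedding.integerLattice F) = finrank ℚ F := by
    rw [ZLattice.rank ℝ, mixedEmbedding.finrank]
  have h1 := ZLattice.summable_norm_pow_inv (mixedEmbedding.integerLattice F) m (by rwa [hrank])
  let e : 𝓞 F → mixedEmbedding.integerLattice F := fun x => ⟨mixedEmbedding F (x : F), x, rfl⟩
  have he : Function.Injective e := fun x y h =>
    RingOfIntegers.ext (mixedEmbedding_injective F (congrArg Subtype.val h))
  have h2 := h1.comp_injective he
  refine Summable.of_norm_bounded_eventually h2 ?_
  filter_upwards [(Set.finite_singleton (0 : 𝓞 F)).compl_mem_cofinite] with x hx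
  have hx0 : x ≠ 0 := hx
  have hpos : 0 < ‖mixedEmbedding F (x : F)‖ := by
    rw [norm_pos_iff, Ne, map_eq_zero]
    exact RingOfIntegers.coe_ne_zero_iff.mpr hx0
  rw [norm_pow, norm_inv, Real.norm_of_nonneg (zero_le_one.trans (one_le_height x))]
  simp only [Function.comp, e]
  refine pow_le_pow_left₀ (inv_nonneg.mpr (zero_le_one.trans (one_le_height x))) ?_ _
  exact inv_anti₀ hpos (le_max_right 1 ‖mixedEmbedding F (x : F)‖)

theorem abs_embedding_le_norm (x : F) (σ : F →+* ℝ) : |σ x| ≤ ‖mixedEmbedding F x‖ := by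
  classical
  rw [← realPlace_apply, ← mixedEmbedding.normAtPlace_apply,
    mixedEmbedding.norm_eq_sup'_normAtPlace]
  exact Finset.le_sup' (fun w => mixedEmbedding.normAtPlace w (mixedEmbedding F x))
    (Finset.mem_univ _)

end

variable (F) in
theorem realPlace_bijective [IsTotallyReal F] : Function.Bijective (realPlace (F := F)) := by
  constructor
  · intro σ σ' h
    ext x
    rcases InfinitePlace.mk_eq_iff.mp h with h | h
    · exact Complex.ofReal_injective (RingHom.congr_fun h x)
    · have := RingHom.congr_fun h x
      simpa [ComplexEmbedding.conjugate_coe_eq] using this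
  · intro w
    have hw := IsTotallyReal.isReal w
    refine ⟨InfinitePlace.embedding_of_isReal hw, ?_⟩
    rw [realPlace]
    conv_rhs => rw [← InfinitePlace.mk_embedding w]
    congr 1
    ext x
    exact InfinitePlace.embedding_of_isReal_apply hw x

variable (F) in
/-- For a totally real field the real embeddings are the infinite places. -/
noncomputable def realPlaceEquiv [IsTotallyReal F] : (F →+* ℝ) ≃ InfinitePlace F :=
  Equiv.ofBijective _ (realPlace_bijective F)

variable [NumberField F] [IsTotallyReal F]

theorem prod_abs_real_embeddings (x : F) : ∏ σ : F →+* ℝ, |σ x| = |(Algebra.norm ℚ x : ℝ)| := by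
  rw [← Rat.cast_abs, ← InfinitePlace.prod_eq_abs_norm, ← (realPlaceEquiv F).prod_comp]
  refine Finset.prod_congr rfl fun σ _ => ?_
  rw [IsTotallyReal.mult_eq, pow_one]
  exact (realPlace_apply σ x).symm

variable (F) in
theorem card_real_embeddings_eq : Fintype.card (F →+* ℝ) = finrank ℚ F := by
  rw [Fintype.card_congr (realPlaceEquiv F), ← InfinitePlace.sum_mult_eq (K := F)]
  simp [IsTotallyReal.mult_eq]

instance nonempty_real_embeddings : Nonempty (F →+* ℝ) :=
  (realPlaceEquiv F).nonempty

/-- Multiplying by a unit, all archimedean absolute values are bounded in terms of the norm. -/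
theorem exists_unit_mul_pow_le : ∃ C : ℝ, 0 < C ∧ ∀ y : (F →+* ℝ) → ℝ, (∀ σ, 0 < y σ) →
    ∃ u : (𝓞 F)ˣ, ∀ σ, (|σ (u : 𝓞 F)| * y σ) ^ finrank ℚ F ≤ C * ∏ σ, y σ := by
  obtain ⟨C₀, hC₀⟩ := isBounded_iff_forall_norm_le.mp
    (mixedEmbedding.fundamentalCone.isBounded_normLeOne F)
  refine ⟨(max C₀ 1) ^ finrank ℚ F, by positivity, fun y hy => ?_⟩
  have hd : finrank ℚ F ≠ 0 := finrank_pos.ne'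
  -- There are no complex places, so the zero second component carries no data.
  set x : mixedEmbedding.mixedSpace F :=
    (fun w => y ((realPlaceEquiv F).symm w), fun _ => 0) with hx
  have hplace : ∀ σ, mixedEmbedding.normAtPlace (realPlace σ) x = y σ := by
    intro σ
    rw [mixedEmbedding.normAtPlace_apply_of_isReal (IsTotallyReal.isReal _)]
    have : (realPlaceEquiv F).symm (realPlace σ) = σ := (realPlaceEquiv F).symm_apply_apply σ
    simp [hx, this, abs_of_pos (hy σ)]
  have hnorm : mixedEmbedding.norm x = ∏ σ, y σ := by
    rw [mixedEmbedding.norm_apply, ← (realPlaceEquiv F).prod_comp]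
    refine Finset.prod_congr rfl fun σ _ => ?_
    rw [IsTotallyReal.mult_eq, pow_one]
    exact hplace σ
  have hN : 0 < ∏ σ, y σ := Finset.prod_pos fun σ _ => hy σ
  obtain ⟨u, hu⟩ := mixedEmbedding.fundamentalCone.exists_unit_smul_mem (hnorm ▸ hN.ne')
  refine ⟨u, fun σ => ?_⟩
  -- Scaling by `c` brings the norm to `1`. Once a unit has moved the point into the fundamental
  -- cone, it then lies in the bounded set `normLeOne`.
  set c : ℝ := ((∏ σ, y σ)⁻¹) ^ ((finrank ℚ F : ℝ)⁻¹) with hc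
  have hc0 : 0 < c := by positivity
  have hcd : c ^ finrank ℚ F = (∏ σ, y σ)⁻¹ := Real.rpow_inv_natCast_pow (by positivity) hd
  have hmem : c • (u • x) ∈ mixedEmbedding.fundamentalCone.normLeOne F := by
    rw [mixedEmbedding.fundamentalCone.mem_normLeOne]
    refine ⟨mixedEmbedding.fundamentalCone.smul_mem_of_mem hu hc0.ne', ?_⟩
    rw [mixedEmbedding.norm_smul, mixedEmbedding.norm_unit_smul, hnorm, abs_of_pos hc0, hcd,
      inv_mul_cancel₀ hN.ne']
  have h1 : mixedEmbedding.normAtPlace (realPlace σ) (c • (u • x)) ≤ C₀ := by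
    classical
    refine le_trans ?_ (hC₀ _ hmem)
    rw [mixedEmbedding.norm_eq_sup'_normAtPlace]
    exact Finset.le_sup' (fun w => mixedEmbedding.normAtPlace w (c • (u • x))) (Finset.mem_univ _)
  rw [mixedEmbedding.normAtPlace_smul, mixedEmbedding.unitSMul_smul, map_mul, hplace,
    mixedEmbedding.normAtPlace_apply, realPlace_apply, abs_of_pos hc0] at h1
  have h2 := pow_le_pow_left₀ (by have := (hy σ).le; positivity) (h1.trans (le_max_left C₀ 1))
    (finrank ℚ F)
  rw [mul_pow, hcd, inv_mul_le_iff₀ hN] at h2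
  rwa [mul_comm ((max C₀ 1) ^ _)]

theorem exists_abs_embedding_eq_norm (x : F) : ∃ σ : F →+* ℝ, |σ x| = ‖mixedEmbedding F x‖ := by
  classical
  obtain ⟨w, -, hw⟩ := Finset.exists_mem_eq_sup' (Finset.univ_nonempty (α := InfinitePlace F))
    (fun w => mixedEmbedding.normAtPlace w (mixedEmbedding F x))
  refine ⟨(realPlaceEquiv F).symm w, ?_⟩
  rw [mixedEmbedding.norm_eq_sup'_normAtPlace, hw, ← realPlace_apply,
    mixedEmbedding.normAtPlace_apply]
  congr 1
  exact (realPlaceEquiv F).apply_symm_apply w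

/-- Otherwise all conjugates are below `1` in absolute value, and so is the norm, a nonzero integer.
-/
theorem one_le_norm_mixedEmbedding {x : 𝓞 F} (hx : x ≠ 0) : 1 ≤ ‖mixedEmbedding F (x : F)‖ := by
  by_contra! h
  have h1 : ∏ σ : F →+* ℝ, |σ (x : F)| < ∏ σ : F →+* ℝ, 1 := by
    refine Finset.prod_lt_prod_of_nonempty (fun σ _ => ?_) (fun σ _ => ?_) Finset.univ_nonempty
    · rw [abs_pos, Ne, map_eq_zero]
      exact RingOfIntegers.coe_ne_zero_iff.mpr hx
    · exact (abs_embedding_le_norm _ σ).trans_lt h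
  rw [prod_abs_real_embeddings, Finset.prod_const_one,
    show Algebra.norm ℚ (x : F) = ((Algebra.norm ℤ x : ℤ) : ℚ) from
      (Algebra.coe_norm_int x).symm] at h1
  have h2 : Algebra.norm ℤ x ≠ 0 := Algebra.norm_ne_zero_iff.mpr hx
  have h3 := Int.one_le_abs h2
  have h4 : |((Algebra.norm ℤ x : ℤ) : ℝ)| < 1 := by simpa using h1
  rw [← Int.cast_abs] at h4
  have h5 : |Algebra.norm ℤ x| < 1 := by exact_mod_cast h4
  omega

theorem height_mul_height_le {c δ : 𝓞 F} (hc : c ≠ 0) :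
    height c * height δ ≤
      max ‖mixedEmbedding F (c : F)‖ ‖mixedEmbedding F (δ : F)‖ ^ 2 := by
  have h1 := one_le_norm_mixedEmbedding hc
  have hm := h1.trans (le_max_left _ ‖mixedEmbedding F (δ : F)‖)
  rw [sq]
  refine mul_le_mul (max_le hm (le_max_left _ _)) (max_le hm (le_max_right _ _))
    (zero_le_one.trans (one_le_height _)) (zero_le_one.trans hm)

end Embeddings


/-! ### Uniform convergence of the Eisenstein sum on the fundamental domain -/

section PairBound

open NumberField Module
open scoped Classical
open scoped Modular

/-- The linear form `cτ + δ` is bounded below by a multiple of `max |c| |δ|`. -/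
theorem r_mul_max_abs_le (z : ℍ) (c δ : ℝ) :
    EisensteinSeries.r z * max |c| |δ| ≤ ‖(c : ℂ) * z + δ‖ := by
  rcases eq_or_lt_of_le (le_max_of_le_left (abs_nonneg c) : 0 ≤ max |c| |δ|) with h0 | h0
  · rw [← h0, mul_zero]
    exact norm_nonneg _
  set m := max |c| |δ| with hm
  have hfac : (c : ℂ) * z + δ = (((c / m : ℝ) : ℂ) * z + ((δ / m : ℝ) : ℂ)) * (m : ℂ) := by
    have : (m : ℂ) ≠ 0 := by exact_mod_cast h0.ne'
    push_cast
    field_simp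
  rw [hfac, norm_mul, Complex.norm_real, Real.norm_of_nonneg h0.le]
  refine mul_le_mul_of_nonneg_right ?_ h0.le
  have habs : ∀ x : ℝ, |x| = m → 1 ≤ (x / m) ^ 2 := by
    intro x hx
    rw [div_pow, ← sq_abs x, hx, div_self (pow_ne_zero _ h0.ne')]
  rcases max_choice |c| |δ| with h | h
  · exact EisensteinSeries.auxbound1 z (δ / m) (habs c (by rw [hm, h]))
  · exact EisensteinSeries.auxbound2 z (c / m) (habs δ (by rw [hm, h]))

theorem exists_r_lower_bound_fd : ∃ r : ℝ, 0 < r ∧ ∀ τ ∈ 𝒟, r ≤ EisensteinSeries.r τ := by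
  refine ⟨EisensteinSeries.r ⟨⟨1 / 2, 1 / 2⟩, by norm_num⟩, EisensteinSeries.r_pos _,
    fun τ hτ => EisensteinSeries.r_lower_bound_on_verticalStrip τ (by norm_num) ⟨hτ.2, ?_⟩⟩
  have h1 := ModularGroup.three_le_four_mul_im_sq_of_mem_fd hτ
  nlinarith [τ.im_pos]

theorem ofReal_mul_add_ne_zero (τ : ℍ) {c : ℝ} (hc : c ≠ 0) (δ : ℝ) :
    (c : ℂ) * τ + δ ≠ 0 := by
  intro h
  have := congrArg Complex.im h
  simp at this
  exact this.elim hc (fun h => τ.im_ne_zero h)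

variable {F : Type*} [Field F] [NumberField F]

theorem summable_height_mul_height {m : ℕ} (hm : finrank ℚ F < m) :
    Summable fun p : 𝓞 F × 𝓞 F => (height p.1 * height p.2)⁻¹ ^ m := by
  have h := summable_height (F := F) hm
  have h0 : ∀ x : 𝓞 F, 0 ≤ (height x)⁻¹ ^ m := fun x =>
    pow_nonneg (inv_nonneg.mpr (zero_le_one.trans (one_le_height x))) _
  have := h.mul_of_nonneg h h0 h0
  simpa only [mul_inv, mul_pow] using this

theorem finrank_lt_mul {k : ℕ} (hk : Even k) (hk2 : 2 < k) :
    finrank ℚ F < finrank ℚ F * (k / 2) := by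
  have : 0 < finrank ℚ F := finrank_pos
  have h2 : 2 ≤ k / 2 := by obtain ⟨j, rfl⟩ := hk; omega
  nlinarith

variable [IsTotallyReal F]

/-- A unit balances the numbers `|c_σ τ + δ_σ|`, so each of them to the power `d` is bounded by a
multiple of their product. They also dominate `max |c_σ| |δ_σ|` uniformly on the domain, so the
product is at least a multiple of `m^d`, with `m` the larger archimedean size of `uc` and `uδ`.
Finally `m^2` dominates the product of heights; this halves the exponent `dk` and makes the bound
summable over both variables when `k > 2`. -/
theorem exists_unit_norm_pairTerm_le {k : ℕ} (hk : Even k) :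
    ∃ M : ℝ, 0 < M ∧ ∀ τ ∈ 𝒟, ∀ c δ : 𝓞 F, c ≠ 0 → ∃ u : (𝓞 F)ˣ,
      ‖pairTerm k (fun _ => τ) c δ‖ ≤
        M * (height ((u : 𝓞 F) * c) * height ((u : 𝓞 F) * δ))⁻¹ ^ (finrank ℚ F * (k / 2)) := by
  obtain ⟨C, hC, hu⟩ := exists_unit_mul_pow_le (F := F)
  obtain ⟨r, hr, hrD⟩ := exists_r_lower_bound_fd
  set d := finrank ℚ F with hd
  refine ⟨(C / r ^ d) ^ k, by positivity, fun τ hτ c δ hc => ?_⟩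
  set y : (F →+* ℝ) → ℝ := fun σ => ‖((σ (c : F) : ℝ) : ℂ) * τ + ((σ (δ : F) : ℝ) : ℂ)‖ with hy
  have hy0 : ∀ σ, 0 < y σ := fun σ => norm_pos_iff.mpr <| ofReal_mul_add_ne_zero τ
    (by rw [Ne, map_eq_zero]; exact RingOfIntegers.coe_ne_zero_iff.mpr hc) _
  obtain ⟨u, hu⟩ := hu y hy0
  refine ⟨u, ?_⟩
  have hN : 0 < ∏ σ, y σ := Finset.prod_pos fun σ _ => hy0 σ
  set m := max ‖mixedEmbedding F (((u : 𝓞 F) * c : 𝓞 F) : F)‖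
    ‖mixedEmbedding F (((u : 𝓞 F) * δ : 𝓞 F) : F)‖ with hm
  have huc : (u : 𝓞 F) * c ≠ 0 := mul_ne_zero u.ne_zero hc
  have hm1 : 1 ≤ m := (one_le_norm_mixedEmbedding huc).trans (le_max_left _ _)
  have hbound : ∀ σ : F →+* ℝ, (r * max |σ (((u : 𝓞 F) * c : 𝓞 F) : F)|
      |σ (((u : 𝓞 F) * δ : 𝓞 F) : F)|) ^ d ≤ C * ∏ σ, y σ := by
    intro σ
    refine le_trans (pow_le_pow_left₀ (by positivity) ?_ _) (hu σ)
    have h1 := r_mul_max_abs_le τ (σ (c : F)) (σ (δ : F))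
    have h2 : r * max |σ (c : F)| |σ (δ : F)| ≤ y σ :=
      (mul_le_mul_of_nonneg_right (hrD τ hτ) (le_max_of_le_left (abs_nonneg _))).trans h1
    calc _ = |σ (u : 𝓞 F)| * (r * max |σ (c : F)| |σ (δ : F)|) := by
          simp only [map_mul, abs_mul]
          rw [← mul_max_of_nonneg _ _ (abs_nonneg _)]
          ring
      _ ≤ _ := by gcongr
  have hmd : (r * m) ^ d ≤ C * ∏ σ, y σ := by
    rcases max_choice ‖mixedEmbedding F (((u : 𝓞 F) * c : 𝓞 F) : F)‖
      ‖mixedEmbedding F (((u : 𝓞 F) * δ : 𝓞 F) : F)‖ with h | h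
    · obtain ⟨σ, hσ⟩ := exists_abs_embedding_eq_norm (((u : 𝓞 F) * c : 𝓞 F) : F)
      refine le_trans (pow_le_pow_left₀ (by positivity) ?_ _) (hbound σ)
      rw [hm, h, ← hσ]
      gcongr
      exact le_max_left _ _
    · obtain ⟨σ, hσ⟩ := exists_abs_embedding_eq_norm (((u : 𝓞 F) * δ : 𝓞 F) : F)
      refine le_trans (pow_le_pow_left₀ (by positivity) ?_ _) (hbound σ)
      rw [hm, h, ← hσ]
      gcongr
      exact le_max_right _ _
  have hterm : ‖pairTerm k (fun _ => τ) c δ‖ = (∏ σ, y σ)⁻¹ ^ k := by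
    rw [pairTerm, norm_prod, ← Finset.prod_inv_distrib, ← Finset.prod_pow]
    refine Finset.prod_congr rfl fun σ _ => ?_
    rw [norm_zpow, zpow_neg, zpow_natCast, inv_pow]
  rw [hterm]
  have hk2 : k = 2 * (k / 2) := (Nat.two_mul_div_two_of_even hk).symm
  have hh0 : 0 < height ((u : 𝓞 F) * c) * height ((u : 𝓞 F) * δ) :=
    mul_pos (zero_lt_one.trans_le (one_le_height _)) (zero_lt_one.trans_le (one_le_height _))
  have hA : (∏ σ, y σ)⁻¹ ≤ C / r ^ d * (m ^ d)⁻¹ := by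
    rw [inv_le_comm₀ hN (by positivity), mul_inv, inv_inv, inv_div, div_mul_eq_mul_div,
      div_le_iff₀ hC, mul_comm _ C, ← mul_pow]
    exact hmd
  calc (∏ σ, y σ)⁻¹ ^ k ≤ (C / r ^ d * (m ^ d)⁻¹) ^ k :=
        pow_le_pow_left₀ (by positivity) hA _
    _ = (C / r ^ d) ^ k * ((m ^ 2)⁻¹) ^ (d * (k / 2)) := by
        rw [mul_pow]
        congr 1
        rw [inv_pow, inv_pow, ← pow_mul, ← pow_mul]
        congr 2
        conv_lhs => rw [hk2]
        ring
    _ ≤ _ := by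
        refine mul_le_mul_of_nonneg_left (pow_le_pow_left₀ (by positivity) ?_ _) (by positivity)
        exact inv_anti₀ hh0 (height_mul_height_le huc)

/-- The Eisenstein sum over one ideal converges absolutely, uniformly on the fundamental domain. -/
theorem exists_tsum_norm_pairTerm_le {k : ℕ} (hk : Even k) (hk2 : 2 < k) :
    ∃ M : ℝ, ∀ τ ∈ 𝒟, ∀ 𝔞 : Ideal (𝓞 F),
      (Summable fun q : Quotient (pairSetoid 𝔞) =>
        ‖pairTerm k (fun _ => τ) q.out.1.1 q.out.1.2‖) ∧
      ∑' q : Quotient (pairSetoid 𝔞), ‖pairTerm k (fun _ => τ) q.out.1.1 q.out.1.2‖ ≤ M := by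
  obtain ⟨M, hM, h⟩ := exists_unit_norm_pairTerm_le (F := F) hk
  set g : 𝓞 F × 𝓞 F → ℝ := fun p =>
    M * (height p.1 * height p.2)⁻¹ ^ (finrank ℚ F * (k / 2)) with hg
  have hs : Summable g :=
    (summable_height_mul_height (finrank_lt_mul (F := F) hk hk2)).mul_left M
  have h0 : ∀ p, 0 ≤ g p := fun p =>
    mul_nonneg hM.le (pow_nonneg (inv_nonneg.mpr (mul_nonneg
      (zero_le_one.trans (one_le_height _)) (zero_le_one.trans (one_le_height _)))) _)
  have h' : ∀ τ ∈ 𝒟, ∀ c δ : 𝓞 F, c ≠ 0 → ∃ u : (𝓞 F)ˣ,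
      ‖pairTerm k (fun _ => τ) c δ‖ ≤ g ((u : 𝓞 F) * c, (u : 𝓞 F) * δ) := h
  clear_value g
  refine ⟨∑' p : 𝓞 F × 𝓞 F, g p, fun τ hτ 𝔞 => ?_⟩
  choose u hu using fun q : Quotient (pairSetoid 𝔞) => h' τ hτ q.out.1.1 q.out.1.2 q.out.2.2.2
  -- The balancing unit depends on `τ`, but inequivalent pairs stay distinct, so the full sum of `g`
  -- over `𝓞 F × 𝓞 F` bounds every case.
  let e : Quotient (pairSetoid 𝔞) → 𝓞 F × 𝓞 F := fun q =>
    ((u q : 𝓞 F) * q.out.1.1, (u q : 𝓞 F) * q.out.1.2)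
  have he : Function.Injective e := by
    intro q q' hqq
    rw [← q.out_eq, ← q'.out_eq]
    refine Quotient.sound ⟨(u q')⁻¹ * u q, ?_⟩
    have h1 : (u q : 𝓞 F) * q.out.1.1 = (u q' : 𝓞 F) * q'.out.1.1 := congrArg Prod.fst hqq
    have h2 : (u q : 𝓞 F) * q.out.1.2 = (u q' : 𝓞 F) * q'.out.1.2 := congrArg Prod.snd hqq
    rw [Units.val_mul, mul_assoc, mul_assoc, h1, h2, Units.inv_mul_cancel_left,
      Units.inv_mul_cancel_left]
  have hse : Summable fun q => g (e q) := hs.comp_injective he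
  have hsum := Summable.of_nonneg_of_le (fun _ => norm_nonneg _) hu hse
  refine ⟨hsum, (hsum.tsum_le_tsum hu hse).trans ?_⟩
  exact tsum_comp_le_tsum_of_inj hs h0 he

end PairBound


/-! ### Pairs modulo units as slopes with integral ideals -/

section Rearrangement

open NumberField Module
open scoped Modular

variable {F : Type*} [Field F]

/-- The slope `δ / c` of a pair `(c, δ)`. -/
noncomputable def slope {𝔞 : Ideal (𝓞 F)} (p : Pairs 𝔞) : F := (p.1.2 : F) / (p.1.1 : F)

theorem span_pair_ne_bot {𝔞 : Ideal (𝓞 F)} (p : Pairs 𝔞) :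
    Ideal.span {p.1.1, p.1.2} ≠ (⊥ : Ideal (𝓞 F)) := by
  intro h
  have : p.1.1 ∈ (⊥ : Ideal (𝓞 F)) := h ▸ Ideal.subset_span (by simp)
  exact p.2.2.2 ((Submodule.mem_bot _).mp this)

theorem span_singleton_mul_span_pair (x c δ : 𝓞 F) :
    Ideal.span {x} * Ideal.span {c, δ} = Ideal.span {x * c, x * δ} := by
  rw [Ideal.span_insert c, Ideal.span_insert (x * c), Ideal.mul_sup,
    Ideal.span_singleton_mul_span_singleton, Ideal.span_singleton_mul_span_singleton]

theorem slope_eq_of_equiv {𝔞 : Ideal (𝓞 F)} {p p' : Pairs 𝔞} (h : (pairSetoid 𝔞).r p p') :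
    slope p = slope p' := by
  obtain ⟨u, hu⟩ := h
  have huF : ((u : 𝓞 F) : F) ≠ 0 := RingOfIntegers.coe_ne_zero_iff.mpr u.ne_zero
  rw [slope, slope, hu]
  simp only [map_mul]
  exact (mul_div_mul_left _ _ huF).symm

variable [NumberField F]

theorem exists_mul_eq_span_pair {𝔞 : Ideal (𝓞 F)} (p : Pairs 𝔞) :
    ∃ I : Ideal (𝓞 F), I * 𝔞 = Ideal.span {p.1.1, p.1.2} := by
  have h : Ideal.span {p.1.1, p.1.2} ≤ 𝔞 := by
    rw [Ideal.span_le]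
    rintro x (rfl | rfl)
    exacts [p.2.1, p.2.2.1]
  obtain ⟨I, hI⟩ := Ideal.dvd_iff_le.mpr h
  exact ⟨I, by rw [hI, mul_comm]⟩

/-- The integral ideal `(𝓞 c + 𝓞 δ) 𝔞⁻¹`. -/
noncomputable def quotIdeal {𝔞 : Ideal (𝓞 F)} (p : Pairs 𝔞) : Ideal (𝓞 F) :=
  (exists_mul_eq_span_pair p).choose

theorem quotIdeal_mul {𝔞 : Ideal (𝓞 F)} (p : Pairs 𝔞) :
    quotIdeal p * 𝔞 = Ideal.span {p.1.1, p.1.2} :=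
  (exists_mul_eq_span_pair p).choose_spec

theorem quotIdeal_ne_zero {𝔞 : Ideal (𝓞 F)} (p : Pairs 𝔞) : quotIdeal p ≠ 0 := by
  intro h
  have := quotIdeal_mul p
  rw [h, zero_mul] at this
  exact span_pair_ne_bot p this.symm

/-- The pairs modulo units, over all ideal classes. -/
abbrev ClassPairs (F : Type*) [Field F] [NumberField F] : Type _ :=
  Σ C : ClassGroup (𝓞 F), Quotient (pairSetoid (classRep F C))

/-- The slope of a pair together with the ideal `(𝓞 c + 𝓞 δ) 𝔞⁻¹`. -/
noncomputable def slopeIdeal (x : ClassPairs F) : F × (Ideal (𝓞 F))⁰ :=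
  (slope x.2.out, ⟨quotIdeal x.2.out, mem_nonZeroDivisors_of_ne_zero (quotIdeal_ne_zero _)⟩)

/-- Equal slopes give `(c')(c, δ) = (c)(c', δ')`. Cancelling the common ideal leaves `(c')𝔞 =
(c)𝔞'`, so the classes agree; then `c` and `c'` are associated, and the same unit carries `δ` to
`δ'`. -/
theorem slopeIdeal_injective : Function.Injective (slopeIdeal (F := F)) := by
  rintro ⟨C, q⟩ ⟨C', q'⟩ h
  have hβ : slope q.out = slope q'.out := congrArg Prod.fst h
  have hI : quotIdeal q.out = quotIdeal q'.out := congrArg (fun y => (y.2 : Ideal (𝓞 F))) h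
  set p := q.out with hp
  set p' := q'.out with hp'
  have hc : (p.1.1 : F) ≠ 0 := RingOfIntegers.coe_ne_zero_iff.mpr p.2.2.2
  have hc' : (p'.1.1 : F) ≠ 0 := RingOfIntegers.coe_ne_zero_iff.mpr p'.2.2.2
  have hcross : p'.1.1 * p.1.2 = p.1.1 * p'.1.2 := by
    rw [slope, slope, div_eq_div_iff hc hc'] at hβ
    apply RingOfIntegers.ext
    push_cast
    linear_combination hβ
  have hspan : Ideal.span {p'.1.1} * Ideal.span {p.1.1, p.1.2} =
      Ideal.span {p.1.1} * Ideal.span {p'.1.1, p'.1.2} := by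
    rw [span_singleton_mul_span_pair, span_singleton_mul_span_pair, hcross, mul_comm p'.1.1]
  have hcancel : Ideal.span {p'.1.1} * classRep F C = Ideal.span {p.1.1} * classRep F C' := by
    rw [← quotIdeal_mul p, ← quotIdeal_mul p', hI] at hspan
    refine mul_left_cancel₀ (quotIdeal_ne_zero p') ?_
    rw [mul_left_comm, hspan, mul_left_comm]
  have hC : C = C' := by
    rw [← mk0_classRep F C, ← mk0_classRep F C', ClassGroup.mk0_eq_mk0_iff]
    exact ⟨_, _, p'.2.2.2, p.2.2.2, hcancel⟩
  subst hC
  have hassoc := mul_right_cancel₀ (classRep_ne_zero F C) hcancel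
  rw [Ideal.span_singleton_eq_span_singleton] at hassoc
  obtain ⟨u, hu⟩ := hassoc.symm
  have hq : q = q' := by
    rw [← q.out_eq, ← q'.out_eq]
    refine Quotient.sound ⟨u, ?_⟩
    rw [← hp, ← hp']
    refine Prod.ext (by rw [← hu, mul_comm]) ?_
    refine mul_left_cancel₀ p.2.2.2 ?_
    rw [← hcross, ← hu]
    ring
  rw [hq]

theorem quotIdeal_eq_of_span {𝔞 : Ideal (𝓞 F)} (h𝔞 : 𝔞 ≠ 0) {p : Pairs 𝔞} {I : Ideal (𝓞 F)}
    (h : I * 𝔞 = Ideal.span {p.1.1, p.1.2}) : quotIdeal p = I :=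
  mul_right_cancel₀ h𝔞 ((quotIdeal_mul p).trans h.symm)

theorem quotIdeal_eq_of_equiv {𝔞 : Ideal (𝓞 F)} (h𝔞 : 𝔞 ≠ 0) {p p' : Pairs 𝔞}
    (h : (pairSetoid 𝔞).r p p') : quotIdeal p = quotIdeal p' := by
  obtain ⟨u, hu⟩ := h
  refine quotIdeal_eq_of_span h𝔞 ?_
  rw [quotIdeal_mul, hu, ← span_singleton_mul_span_pair,
      Ideal.span_singleton_eq_top.mpr u.isUnit, Ideal.top_mul]

/-- The class must be `[J]/[I]`; `s` and `t` witness the equality of classes. -/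
theorem exists_classRep_mul_span (J I : Ideal (𝓞 F)) (hJ : J ≠ 0) (hI : I ≠ 0) :
    ∃ (C : ClassGroup (𝓞 F)) (s t : 𝓞 F), s ≠ 0 ∧ t ≠ 0 ∧
      Ideal.span {s} * (I * classRep F C) = Ideal.span {t} * J := by
  set J' : (Ideal (𝓞 F))⁰ := ⟨J, mem_nonZeroDivisors_of_ne_zero hJ⟩
  set I' : (Ideal (𝓞 F))⁰ := ⟨I, mem_nonZeroDivisors_of_ne_zero hI⟩
  obtain ⟨C, hC⟩ : ∃ C : ClassGroup (𝓞 F), ClassGroup.mk0 I' * C = ClassGroup.mk0 J' :=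
    ⟨ClassGroup.mk0 J' / ClassGroup.mk0 I', mul_div_cancel _ _⟩
  have hmk : ClassGroup.mk0 (I' * ⟨classRep F C, mem_nonZeroDivisors_of_ne_zero
      (classRep_ne_zero F C)⟩) = ClassGroup.mk0 J' := by
    rw [map_mul, mk0_classRep, hC]
  obtain ⟨s, t, hs, ht, hst⟩ := ClassGroup.mk0_eq_mk0_iff.mp hmk
  exact ⟨C, s, t, hs, ht, hst⟩

/-- Write `β = y/x` and rescale `(x, y)` by `t/s` so that its ideal becomes `I 𝔞` for a chosen
representative `𝔞`. -/
theorem exists_pair_slope_quotIdeal (β : F) (I : Ideal (𝓞 F)) (hI : I ≠ 0) :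
    ∃ (C : ClassGroup (𝓞 F)) (p : Pairs (classRep F C)), slope p = β ∧ quotIdeal p = I := by
  obtain ⟨y, x, hx, hβ⟩ := IsFractionRing.div_surjective (A := 𝓞 F) β
  have hx0 : x ≠ 0 := nonZeroDivisors.ne_zero hx
  have hJ0 : Ideal.span {x, y} ≠ (0 : Ideal (𝓞 F)) := by
    intro h
    have : x ∈ (0 : Ideal (𝓞 F)) := h ▸ Ideal.subset_span (by simp)
    exact hx0 ((Submodule.mem_bot _).mp this)
  obtain ⟨C, s, t, hs, ht, hst⟩ := exists_classRep_mul_span _ I hJ0 hI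
  rw [span_singleton_mul_span_pair] at hst
  obtain ⟨c, hc, hsc⟩ : ∃ z ∈ I * classRep F C, s * z = t * x := by
    rw [← Ideal.mem_span_singleton_mul, hst]
    exact Ideal.subset_span (by simp)
  obtain ⟨δ, hδ, hsδ⟩ : ∃ z ∈ I * classRep F C, s * z = t * y := by
    rw [← Ideal.mem_span_singleton_mul, hst]
    exact Ideal.subset_span (by simp)
  have hc0 : c ≠ 0 := by
    rintro rfl
    rw [mul_zero] at hsc
    exact mul_ne_zero ht hx0 hsc.symm
  have hspan : I * classRep F C = Ideal.span {c, δ} := by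
    refine mul_left_cancel₀ (a := Ideal.span {s}) ?_ ?_
    · simpa using hs
    · rw [hst, span_singleton_mul_span_pair, hsc, hsδ]
  have hle : I * classRep F C ≤ classRep F C := Ideal.mul_le_right
  obtain ⟨p, hp⟩ : ∃ p : Pairs (classRep F C), p.1 = (c, δ) := ⟨⟨(c, δ), hle hc, hle hδ, hc0⟩, rfl⟩
  have hp1 : p.1.1 = c := by rw [hp]
  have hp2 : p.1.2 = δ := by rw [hp]
  refine ⟨C, p, ?_, quotIdeal_eq_of_span (classRep_ne_zero F C) (by rw [hspan, hp1, hp2])⟩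
  rw [slope, ← hβ, hp1, hp2]
  have hxF : algebraMap (𝓞 F) F x ≠ 0 := RingOfIntegers.coe_ne_zero_iff.mpr hx0
  have hcF : algebraMap (𝓞 F) F c ≠ 0 := RingOfIntegers.coe_ne_zero_iff.mpr hc0
  have htF : algebraMap (𝓞 F) F t ≠ 0 := RingOfIntegers.coe_ne_zero_iff.mpr ht
  have hsF : algebraMap (𝓞 F) F s ≠ 0 := RingOfIntegers.coe_ne_zero_iff.mpr hs
  have e1 := congrArg (algebraMap (𝓞 F) F) hsc
  have e2 := congrArg (algebraMap (𝓞 F) F) hsδ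
  simp only [map_mul] at e1 e2
  show algebraMap (𝓞 F) F δ / algebraMap (𝓞 F) F c = _
  rw [div_eq_div_iff hcF hxF]
  refine mul_left_cancel₀ (mul_ne_zero htF hsF) ?_
  linear_combination algebraMap (𝓞 F) F t * algebraMap (𝓞 F) F x * e2 -
      algebraMap (𝓞 F) F t * algebraMap (𝓞 F) F y * e1

theorem slopeIdeal_surjective : Function.Surjective (slopeIdeal (F := F)) := by
  rintro ⟨β, I⟩
  obtain ⟨C, p, hp, hpI⟩ := exists_pair_slope_quotIdeal β (I : Ideal (𝓞 F))
    (nonZeroDivisors.ne_zero I.2)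
  refine ⟨⟨C, Quotient.mk _ p⟩, ?_⟩
  have hequiv := Quotient.exact (Quotient.out_eq (Quotient.mk (pairSetoid (classRep F C)) p))
  exact Prod.ext ((slope_eq_of_equiv hequiv).trans hp)
    (Subtype.ext ((quotIdeal_eq_of_equiv (classRep_ne_zero F C) hequiv).trans hpI))

/-- Pairs modulo units over all ideal classes correspond to a slope and an integral ideal. -/
noncomputable def slopeIdealEquiv : ClassPairs F ≃ F × (Ideal (𝓞 F))⁰ :=
  Equiv.ofBijective _ ⟨slopeIdeal_injective, slopeIdeal_surjective⟩

end Rearrangement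


/-! ### The diagonal Eisenstein series as a sum over slopes -/

section EisensteinExpansion

open NumberField Module
open scoped Modular

variable {F : Type*} [Field F] [NumberField F]

/-- The contribution of `β` to the diagonal restriction of the Eisenstein series. -/
noncomputable def slopeTerm (k : ℕ) (β : F) (τ : ℍ) : ℂ :=
  ((A β : ℚ) : ℂ) ^ (-(k : ℤ)) * prodPow k (fun σ : F →+* ℝ => σ β) τ

theorem A_pos (β : F) : 0 < A β := by
  rw [A, inv_pos]
  refine lt_of_le_of_ne (FractionalIdeal.absNorm_nonneg _) (Ne.symm ?_)
  rw [Ne, FractionalIdeal.absNorm_eq_zero_iff]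
  intro h
  have h1 : (1 : F) ∈ FractionalIdeal.spanSingleton (𝓞 F)⁰ (1 : F) +
      FractionalIdeal.spanSingleton (𝓞 F)⁰ β := by
    rw [FractionalIdeal.mem_add]
    exact ⟨1, FractionalIdeal.mem_spanSingleton_self _ _, 0, FractionalIdeal.zero_mem _, add_zero _⟩
  rw [h, FractionalIdeal.mem_zero_iff] at h1
  exact one_ne_zero h1

theorem coeIdeal_span_pair (c δ : 𝓞 F) :
    ((Ideal.span {c, δ} : Ideal (𝓞 F)) : FractionalIdeal (𝓞 F)⁰ F) =
      FractionalIdeal.spanSingleton (𝓞 F)⁰ (c : F) +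
        FractionalIdeal.spanSingleton (𝓞 F)⁰ (δ : F) := by
  rw [Ideal.span_insert, FractionalIdeal.coeIdeal_sup, FractionalIdeal.coeIdeal_span_singleton,
    FractionalIdeal.coeIdeal_span_singleton]

theorem A_slope {𝔞 : Ideal (𝓞 F)} (p : Pairs 𝔞) :
    A (slope p) = |Algebra.norm ℚ (p.1.1 : F)| /
      ((Ideal.absNorm (quotIdeal p) : ℚ) * (Ideal.absNorm 𝔞 : ℚ)) := by
  rw [slope, A_div _ _ (RingOfIntegers.coe_ne_zero_iff.mpr p.2.2.2), ← coeIdeal_span_pair,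
    FractionalIdeal.coeIdeal_absNorm, ← quotIdeal_mul, map_mul, Nat.cast_mul]

/-- Group the ideals by norm; the zero ideal adds nothing, since `0 ^ (-k) = 0` for `k ≠ 0`. -/
theorem dedekindZeta_eq_tsum {k : ℕ} (hk : k ≠ 0)
    (hs : Summable fun I : (Ideal (𝓞 F))⁰ =>
      ((Ideal.absNorm (I : Ideal (𝓞 F)) : ℕ) : ℂ) ^ (-(k : ℤ))) :
    dedekindZeta F (k : ℂ) =
      ∑' I : (Ideal (𝓞 F))⁰, ((Ideal.absNorm (I : Ideal (𝓞 F)) : ℕ) : ℂ) ^ (-(k : ℤ)) := by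
  set g : Ideal (𝓞 F) → ℂ := fun I => ((Ideal.absNorm I : ℕ) : ℂ) ^ (-(k : ℤ)) with hg
  have hsupp : Function.support g ⊆ ((Ideal (𝓞 F))⁰ : Set (Ideal (𝓞 F))) := by
    intro I hI
    rw [SetLike.mem_coe, mem_nonZeroDivisors_iff_ne_zero]
    rintro rfl
    apply hI
    simp [hg, hk]
  have hsg : Summable g := (Function.Injective.summable_iff Subtype.val_injective (by
    intro I hI
    by_contra h
    exact hI ⟨⟨I, hsupp h⟩, rfl⟩)).mp hs
  have h1 : ∑' I : (Ideal (𝓞 F))⁰, g I = ∑' I, g I :=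
    tsum_subtype_eq_of_support_subset hsupp
  rw [show (∑' I : (Ideal (𝓞 F))⁰, ((Ideal.absNorm (I : Ideal (𝓞 F)) : ℕ) : ℂ) ^ (-(k : ℤ))) =
    ∑' I : (Ideal (𝓞 F))⁰, g I from rfl, h1]
  let e := Equiv.sigmaFiberEquiv (fun I : Ideal (𝓞 F) => Ideal.absNorm I)
  have hse : Summable fun c => g (e c) := e.summable_iff.mpr hsg
  rw [← e.tsum_eq g, hse.tsum_sigma, dedekindZeta, LSeries]
  refine tsum_congr fun n => ?_
  have h2 : ∀ I : {I : Ideal (𝓞 F) // Ideal.absNorm I = n}, g (e ⟨n, I⟩) =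
      (n : ℂ) ^ (-(k : ℤ)) := by
    intro I
    show ((Ideal.absNorm I.1 : ℕ) : ℂ) ^ (-(k : ℤ)) = _
    rw [I.2]
  rw [tsum_congr h2, tsum_const, LSeries.term_def, nsmul_eq_mul]
  split_ifs with h
  · simp [h, hk]
  · rw [zpow_neg, zpow_natCast, Complex.cpow_natCast, div_eq_mul_inv]

variable [IsTotallyReal F]

/-- Factoring out `c` leaves `|Nm c|^(-k)` by evenness, and `|Nm c| = A_β Nm(I) Nm(𝔞)`: the term
separates into a function of the slope and a function of the ideal. -/
theorem absNorm_mul_pairTerm {k : ℕ} (hk : Even k) {𝔞 : Ideal (𝓞 F)} (h𝔞 : 𝔞 ≠ 0)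
    (p : Pairs 𝔞) (τ : ℍ) :
    ((Ideal.absNorm 𝔞 : ℕ) : ℂ) ^ k * pairTerm k (fun _ => τ) p.1.1 p.1.2 =
      slopeTerm k (slope p) τ * ((Ideal.absNorm (quotIdeal p) : ℕ) : ℂ) ^ (-(k : ℤ)) := by
  have hc : (p.1.1 : F) ≠ 0 := RingOfIntegers.coe_ne_zero_iff.mpr p.2.2.2
  have hfac : pairTerm k (fun _ => τ) p.1.1 p.1.2 =
      ((|(Algebra.norm ℚ (p.1.1 : F) : ℝ)| : ℝ) : ℂ) ^ (-(k : ℤ)) *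
        prodPow k (fun σ : F →+* ℝ => σ (slope p)) τ := by
    rw [pairTerm, prodPow, ← prod_abs_real_embeddings, Complex.ofReal_prod, ← Finset.prod_zpow,
      ← Finset.prod_mul_distrib]
    refine Finset.prod_congr rfl fun σ _ => ?_
    have hσ : σ (p.1.1 : F) ≠ 0 := by rwa [Ne, map_eq_zero]
    rw [← Complex.ofReal_zpow, Even.zpow_abs ((Int.even_coe_nat k).mpr hk).neg,
      Complex.ofReal_zpow, ← mul_zpow]
    congr 1
    rw [slope, map_div₀]
    push_cast
    have : ((σ (p.1.1 : F) : ℝ) : ℂ) ≠ 0 := by exact_mod_cast hσ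
    field_simp
  rw [hfac, slopeTerm, A_slope]
  have h1 : (|Algebra.norm ℚ (p.1.1 : F)| : ℚ) ≠ 0 := by simpa using hc
  have h2 : (Ideal.absNorm 𝔞 : ℂ) ≠ 0 := by
    exact_mod_cast fun h => h𝔞 (Ideal.absNorm_eq_zero_iff.mp h)
  have h3 : (Ideal.absNorm (quotIdeal p) : ℂ) ≠ 0 := by
    exact_mod_cast fun h => quotIdeal_ne_zero p (Ideal.absNorm_eq_zero_iff.mp h)
  have h4 : ((|(Algebra.norm ℚ (p.1.1 : F) : ℝ)| : ℝ) : ℂ) =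
      ((|Algebra.norm ℚ (p.1.1 : F)| : ℚ) : ℂ) := by
    rw [← Rat.cast_abs, Complex.ofReal_ratCast]
  have h5 : ((|Algebra.norm ℚ (p.1.1 : F)| : ℚ) : ℂ) ≠ 0 := by exact_mod_cast h1
  rw [h4]
  rw [Rat.cast_div, Rat.cast_mul, Rat.cast_natCast, Rat.cast_natCast]
  generalize ((|Algebra.norm ℚ (p.1.1 : F)| : ℚ) : ℂ) = N at h5 ⊢
  simp only [zpow_neg, zpow_natCast, div_pow, mul_pow]
  field_simp

variable (F) in
theorem summable_classPairs {k : ℕ} (hk : Even k) (hk2 : 2 < k) : ∃ M : ℝ, ∀ τ ∈ 𝒟,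
    (Summable fun x : ClassPairs F => ‖((Ideal.absNorm (classRep F x.1) : ℕ) : ℂ) ^ k *
      pairTerm k (fun _ => τ) x.2.out.1.1 x.2.out.1.2‖) ∧
    ∑' x : ClassPairs F, ‖((Ideal.absNorm (classRep F x.1) : ℕ) : ℂ) ^ k *
      pairTerm k (fun _ => τ) x.2.out.1.1 x.2.out.1.2‖ ≤ M := by
  obtain ⟨M, hM⟩ := exists_tsum_norm_pairTerm_le (F := F) hk hk2
  refine ⟨∑ C : ClassGroup (𝓞 F), ((Ideal.absNorm (classRep F C) : ℕ) : ℝ) ^ k * M,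
    fun τ hτ => ?_⟩
  have hfib : ∀ C : ClassGroup (𝓞 F), Summable fun q : Quotient (pairSetoid (classRep F C)) =>
      ‖((Ideal.absNorm (classRep F C) : ℕ) : ℂ) ^ k *
        pairTerm k (fun _ => τ) q.out.1.1 q.out.1.2‖ := by
    intro C
    simp only [norm_mul]
    exact (hM τ hτ _).1.mul_left _
  have hsum : Summable fun x : ClassPairs F => ‖((Ideal.absNorm (classRep F x.1) : ℕ) : ℂ) ^ k *
      pairTerm k (fun _ => τ) x.2.out.1.1 x.2.out.1.2‖ :=
    (summable_sigma_of_nonneg fun _ => norm_nonneg _).mpr ⟨hfib, Summable.of_finite⟩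
  refine ⟨hsum, ?_⟩
  rw [hsum.tsum_sigma' hfib, tsum_fintype]
  refine Finset.sum_le_sum fun C _ => ?_
  simp only [norm_mul, tsum_mul_left, norm_pow, Complex.norm_natCast]
  exact mul_le_mul_of_nonneg_left (hM τ hτ _).2 (by positivity)

/-- The diagonal restriction of the Eisenstein series as a sum over slopes. -/
theorem heckeEDiag_eq_tsum {k : ℕ} (hk : Even k) (hk2 : 2 < k) : ∃ M : ℝ, ∀ τ ∈ 𝒟,
    (Summable fun β : F => ‖slopeTerm k β τ‖) ∧ ∑' β : F, ‖slopeTerm k β τ‖ ≤ M ∧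
    heckeEDiag F k τ = 1 + ∑' β : F, slopeTerm k β τ := by
  obtain ⟨M, hM⟩ := summable_classPairs F hk hk2
  refine ⟨M, fun τ hτ => ?_⟩
  obtain ⟨hs, hle⟩ := hM τ hτ
  set z : (Ideal (𝓞 F))⁰ → ℂ := fun I =>
    ((Ideal.absNorm (I : Ideal (𝓞 F)) : ℕ) : ℂ) ^ (-(k : ℤ)) with hz
  have hval : ∀ x : ClassPairs F, ((Ideal.absNorm (classRep F x.1) : ℕ) : ℂ) ^ k *
      pairTerm k (fun _ => τ) x.2.out.1.1 x.2.out.1.2 =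
      slopeTerm k (slopeIdealEquiv x).1 τ * z (slopeIdealEquiv x).2 := fun x =>
    absNorm_mul_pairTerm hk (classRep_ne_zero F x.1) x.2.out τ
  have hsn : Summable fun y : F × (Ideal (𝓞 F))⁰ => ‖slopeTerm k y.1 τ * z y.2‖ := by
    rw [← slopeIdealEquiv.summable_iff]
    simpa only [hval, Function.comp_def] using hs
  -- Summability of the product family restricts to each factor: take the unit ideal for the slopes,
  -- and the nonvanishing slope `0` for the zeta series.
  have hz1 : z 1 = 1 := by simp [hz]
  have hβ : Summable fun β : F => ‖slopeTerm k β τ‖ := by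
    have := hsn.comp_injective (i := fun β : F => (β, (1 : (Ideal (𝓞 F))⁰)))
      fun a b h => congrArg Prod.fst h
    simpa [Function.comp_def, hz1] using this
  have hslope0 : slopeTerm k (0 : F) τ ≠ 0 := by
    rw [slopeTerm, prodPow]
    refine mul_ne_zero (zpow_ne_zero _ (by exact_mod_cast (A_pos (0 : F)).ne')) ?_
    refine Finset.prod_ne_zero_iff.mpr fun σ _ => zpow_ne_zero _ ?_
    simpa using UpperHalfPlane.ne_zero τ
  have hzs : Summable fun I => ‖z I‖ := by
    have := hsn.comp_injective (i := fun I : (Ideal (𝓞 F))⁰ => ((0 : F), I))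
      fun a b h => congrArg Prod.snd h
    simp only [Function.comp_def, norm_mul] at this
    exact (summable_mul_left_iff (norm_ne_zero_iff.mpr hslope0)).mp this
  have hζ : dedekindZeta F (k : ℂ) = ∑' I, z I := dedekindZeta_eq_tsum (by omega) hzs.of_norm
  have hζ0 : ∑' I, z I ≠ 0 := by
    have hreal : ∀ I, z I = (((Ideal.absNorm (I : Ideal (𝓞 F)) : ℕ) : ℝ) ^ (-(k : ℤ)) : ℝ) := by
      intro I
      simp [hz]
    have hsr : Summable fun I : (Ideal (𝓞 F))⁰ =>
        ((Ideal.absNorm (I : Ideal (𝓞 F)) : ℕ) : ℝ) ^ (-(k : ℤ)) := by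
      rw [← Complex.summable_ofReal]
      exact (summable_congr hreal).mp hzs.of_norm
    rw [tsum_congr hreal, ← Complex.ofReal_tsum, Ne, Complex.ofReal_eq_zero]
    refine (hsr.tsum_pos (fun I => by positivity) 1 (by simp)).ne'
  refine ⟨hβ, ?_, ?_⟩
  · refine le_trans ?_ hle
    have h1 : ∑' β : F, ‖slopeTerm k β τ‖ ≤
        ∑' y : F × (Ideal (𝓞 F))⁰, ‖slopeTerm k y.1 τ * z y.2‖ := by
      refine hβ.tsum_le_tsum_of_inj (fun β : F => (β, (1 : (Ideal (𝓞 F))⁰)))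
        (fun a b h => congrArg Prod.fst h) (fun _ _ => norm_nonneg _) (fun β => ?_) hsn
      simp [hz1]
    refine h1.trans (le_of_eq ?_)
    rw [← slopeIdealEquiv.tsum_eq (fun y : F × (Ideal (𝓞 F))⁰ => ‖slopeTerm k y.1 τ * z y.2‖)]
    exact tsum_congr fun x => by rw [hval]
  · have h2 : ∑ C : ClassGroup (𝓞 F), ((Ideal.absNorm (classRep F C) : ℕ) : ℂ) ^ k *
        ∑' q : Quotient (pairSetoid (classRep F C)),
          pairTerm k (fun _ => τ) q.out.1.1 q.out.1.2 =
        (∑' β : F, slopeTerm k β τ) * ∑' I, z I := by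
      rw [hβ.of_norm.tsum_mul_tsum hzs.of_norm hsn.of_norm,
        ← slopeIdealEquiv.tsum_eq (fun y : F × (Ideal (𝓞 F))⁰ => slopeTerm k y.1 τ * z y.2)]
      rw [← tsum_congr hval, hs.of_norm.tsum_sigma, tsum_fintype]
      exact Finset.sum_congr rfl fun C _ => tsum_mul_left.symm
    rw [heckeEDiag, heckeE, h2, hζ, mul_comm (∑' β : F, slopeTerm k β τ),
      inv_mul_cancel_left₀ hζ0]

end EisensteinExpansion


/-! ### Action of `SL₂(ℤ)` on slope terms -/

section Transformation

open NumberField Module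
open scoped ModularForm

variable {F : Type*} [Field F]

/-- The right action of `SL₂(ℤ)` on slopes. -/
noncomputable def mobius (β : F) (γ : SL(2, ℤ)) : F :=
  ((γ 0 1 : ℤ) + (γ 1 1 : ℤ) * β) / ((γ 0 0 : ℤ) + (γ 1 0 : ℤ) * β)

theorem mobius_zero (γ : SL(2, ℤ)) : mobius (0 : F) γ = (γ 0 1 : ℤ) / (γ 0 0 : ℤ) := by
  simp [mobius]

theorem sl2Z_det (γ : SL(2, ℤ)) : γ 0 0 * γ 1 1 - γ 0 1 * γ 1 0 = 1 := by
  have := γ.det_coe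
  rwa [Matrix.det_fin_two] at this

variable [NumberField F]

/-- An integral change of generators with integral inverse generates the same fractional ideal. -/
theorem spanSingleton_add_unimodular (γ : SL(2, ℤ)) (x y : F) :
    FractionalIdeal.spanSingleton (𝓞 F)⁰ ((γ 0 0 : ℤ) * x + (γ 1 0 : ℤ) * y) +
      FractionalIdeal.spanSingleton (𝓞 F)⁰ ((γ 0 1 : ℤ) * x + (γ 1 1 : ℤ) * y) =
    FractionalIdeal.spanSingleton (𝓞 F)⁰ x + FractionalIdeal.spanSingleton (𝓞 F)⁰ y := by
  have key : ∀ (a b : ℤ) (u v : F), FractionalIdeal.spanSingleton (𝓞 F)⁰ ((a : F) * u + b * v) ≤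
      FractionalIdeal.spanSingleton (𝓞 F)⁰ u + FractionalIdeal.spanSingleton (𝓞 F)⁰ v := by
    intro a b u v
    rw [FractionalIdeal.spanSingleton_le_iff_mem, FractionalIdeal.mem_add]
    refine ⟨a * u, ?_, b * v, ?_, rfl⟩
    · exact FractionalIdeal.mem_spanSingleton _ |>.mpr ⟨(a : 𝓞 F), by simp [Algebra.smul_def]⟩
    · exact FractionalIdeal.mem_spanSingleton _ |>.mpr ⟨(b : 𝓞 F), by simp [Algebra.smul_def]⟩
  have hdet : ((γ 0 0 : ℤ) : F) * (γ 1 1 : ℤ) - (γ 0 1 : ℤ) * (γ 1 0 : ℤ) = 1 := by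
    exact_mod_cast congrArg (Int.cast : ℤ → F) (sl2Z_det γ)
  have sup : ∀ I J : FractionalIdeal (𝓞 F)⁰ F, I + J = I ⊔ J := fun I J =>
    (FractionalIdeal.sup_eq_add I J).symm
  refine le_antisymm ?_ ?_
  · rw [sup]
    exact sup_le (key _ _ _ _) (key _ _ _ _)
  · rw [sup (FractionalIdeal.spanSingleton (𝓞 F)⁰ x)]
    refine sup_le ?_ ?_
    · convert key (γ 1 1) (-γ 1 0) ((γ 0 0 : ℤ) * x + (γ 1 0 : ℤ) * y)
        ((γ 0 1 : ℤ) * x + (γ 1 1 : ℤ) * y) using 2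
      push_cast
      linear_combination -x * hdet
    · convert key (-γ 0 1) (γ 0 0) ((γ 0 0 : ℤ) * x + (γ 1 0 : ℤ) * y)
        ((γ 0 1 : ℤ) * x + (γ 1 1 : ℤ) * y) using 2
      push_cast
      linear_combination -y * hdet

theorem A_mobius (β : F) (γ : SL(2, ℤ)) (h : ((γ 0 0 : ℤ) : F) + (γ 1 0 : ℤ) * β ≠ 0) :
    A (mobius β γ) = |Algebra.norm ℚ (((γ 0 0 : ℤ) : F) + (γ 1 0 : ℤ) * β)| * A β := by
  have := spanSingleton_add_unimodular γ 1 β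
  rw [mul_one, mul_one] at this
  rw [mobius, A_div _ _ h, this, A, div_eq_mul_inv]

variable [IsTotallyReal F]

/-- Distribute the automorphy factor over the `d` embeddings. Each linear form `γτ + β_σ` becomes
`x_σ (τ + (βγ)_σ)` with `x = γ₀₀ + γ₁₀ β`, and `∏ |x_σ|^(-k)` is exactly the change in `A^(-k)`. -/
theorem slopeTerm_slash {d k : ℕ} (hd : finrank ℚ F = d) (hk : Even k) (β : F) (γ : SL(2, ℤ))
    (h : ((γ 0 0 : ℤ) : F) + (γ 1 0 : ℤ) * β ≠ 0) :
    (slopeTerm k β) ∣[((d * k : ℕ) : ℤ)] γ = slopeTerm k (mobius β γ) := by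
  ext τ
  set x : F := ((γ 0 0 : ℤ) : F) + (γ 1 0 : ℤ) * β with hx
  have hprod : prodPow k (fun σ : F →+* ℝ => σ β) ((γ • τ : ℍ) : ℂ) *
      (((γ 1 0 : ℤ) : ℂ) * τ + (γ 1 1 : ℤ)) ^ (-((d * k : ℕ) : ℤ)) =
      ((|(Algebra.norm ℚ x : ℝ)| : ℝ) : ℂ) ^ (-(k : ℤ)) *
        prodPow k (fun σ : F →+* ℝ => σ (mobius β γ)) τ := by
    have hpow : (((γ 1 0 : ℤ) : ℂ) * τ + (γ 1 1 : ℤ)) ^ (-((d * k : ℕ) : ℤ)) =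
        ∏ _σ : F →+* ℝ, (((γ 1 0 : ℤ) : ℂ) * τ + (γ 1 1 : ℤ)) ^ (-(k : ℤ)) := by
      rw [Finset.prod_const, Finset.card_univ, card_real_embeddings_eq, hd, ← zpow_natCast,
        ← zpow_mul]
      congr 1
      push_cast
      ring
    rw [hpow, prodPow, prodPow, ← prod_abs_real_embeddings, Complex.ofReal_prod,
      ← Finset.prod_zpow, ← Finset.prod_mul_distrib, ← Finset.prod_mul_distrib]
    refine Finset.prod_congr rfl fun σ _ => ?_
    have hσ : σ x ≠ 0 := by rwa [Ne, map_eq_zero]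
    rw [← Complex.ofReal_zpow, Even.zpow_abs ((Int.even_coe_nat k).mpr hk).neg,
      Complex.ofReal_zpow, ← mul_zpow, ← mul_zpow]
    congr 1
    have hden : ((γ 1 0 : ℤ) : ℂ) * τ + (γ 1 1 : ℤ) ≠ 0 := by
      rw [← ModularGroup.denom_apply]
      exact denom_ne_zero _ _
    have hxC : ((σ x : ℝ) : ℂ) ≠ 0 := by exact_mod_cast hσ
    have hxe : ((σ x : ℝ) : ℂ) = ((γ 0 0 : ℤ) : ℂ) + (γ 1 0 : ℤ) * ((σ β : ℝ) : ℂ) := by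
      simp [hx]
    rw [mobius, ← hx, map_div₀, coe_specialLinearGroup_apply]
    simp only [map_add, map_mul, map_intCast, eq_intCast, Complex.ofReal_div, Complex.ofReal_add,
      Complex.ofReal_mul, Complex.ofReal_intCast]
    rw [mul_add ((σ x : ℝ) : ℂ), mul_div_cancel₀ _ hxC, add_mul, div_mul_cancel₀ _ hden, hxe]
    ring
  rw [ModularForm.SL_slash_apply, ModularGroup.denom_apply, slopeTerm, mul_assoc, hprod, slopeTerm,
    A_mobius β γ h, ← mul_assoc]
  congr 1
  rw [Rat.cast_mul, mul_zpow, mul_comm]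
  congr 2
  rw [← Rat.cast_abs, Complex.ofReal_ratCast]

theorem one_slash_S {d k : ℕ} (hd : finrank ℚ F = d) :
    (1 : ℍ → ℂ) ∣[((d * k : ℕ) : ℤ)] ModularGroup.S = slopeTerm k (0 : F) := by
  ext τ
  have hA : A (0 : F) = 1 := by
    rw [A, FractionalIdeal.spanSingleton_zero, add_zero, FractionalIdeal.spanSingleton_one, map_one,
      inv_one]
  rw [ModularForm.SL_slash_apply, ModularGroup.denom_apply, slopeTerm, hA, prodPow]
  simp only [map_zero, Complex.ofReal_zero, add_zero, Finset.prod_const, Finset.card_univ,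
    card_real_embeddings_eq, hd]
  rw [← zpow_natCast, ← zpow_mul]
  simp [ModularGroup.S]
  ring_nf

/-- A level one form is fixed by every element of `SL₂(ℤ)`. -/
theorem cuspForm_slash {w : ℤ} (f : CuspForm 𝒮ℒ w) (γ : SL(2, ℤ)) : (f : ℍ → ℂ) ∣[w] γ = f :=
  SlashInvariantFormClass.slash_action_eq f _ ⟨γ, rfl⟩

theorem petersson_smul_of_slash {w : ℤ} (f : CuspForm 𝒮ℒ w) {g g' : ℍ → ℂ} {γ : SL(2, ℤ)}
    (h : g ∣[w] γ = g') (τ : ℍ) : petersson w f g (γ • τ) = petersson w f g' τ := by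
  rw [← petersson_slash_SL, cuspForm_slash, h]

theorem exists_petersson_slopeTerm_ratCast {d k : ℕ} (hd : finrank ℚ F = d) (hk : Even k)
    (q : ℚ) : ∃ γ : SL(2, ℤ), γ 1 0 = q.den ∧ γ 1 1 = q.num ∧
      ∀ (f : CuspForm 𝒮ℒ ((d * k : ℕ) : ℤ)) (τ : ℍ),
        petersson ((d * k : ℕ) : ℤ) f (slopeTerm k (q : F)) τ =
          petersson ((d * k : ℕ) : ℤ) f 1 (γ • τ) := by
  obtain ⟨γ, h0, h1⟩ := IsCoprime.exists_SL2_row (a := (q.den : ℤ)) (b := q.num)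
    (Int.isCoprime_iff_gcd_eq_one.mpr (by
      rw [Int.gcd_comm]
      exact q.reduced)) 0
  have hne : ((γ 0 0 : ℤ) : F) + (γ 1 0 : ℤ) * 0 ≠ 0 := by
    rw [h0]
    simp
  -- `γ` has top row `(den, num)`, hence takes slope `0` to `q`; `S` takes `∞` to `0` and moves that
  -- row to the bottom.
  refine ⟨ModularGroup.S * γ, ?_, ?_, fun f τ => ?_⟩
  · rw [Matrix.SpecialLinearGroup.coe_mul, ModularGroup.coe_S]
    simp [Matrix.mul_apply, Fin.sum_univ_two, h0]
  · rw [Matrix.SpecialLinearGroup.coe_mul, ModularGroup.coe_S]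
    simp [Matrix.mul_apply, Fin.sum_univ_two, h1]
  · have hm : (q : F) = mobius 0 γ := by
      rw [mobius_zero, h0, h1, Rat.cast_def]
      simp
    rw [hm, mul_smul, petersson_smul_of_slash f (one_slash_S (F := F) hd),
      petersson_smul_of_slash f (slopeTerm_slash hd hk 0 γ hne)]

end Transformation


/-! ### Orbits of slopes and double cosets -/

section Orbits

open NumberField Module

variable {F : Type*} [Field F]

/-- Left cosets of the Borel subgroup are detected by proportionality of bottom rows. -/
theorem mk_eq_mk_iff (g g' : SL(2, F)) :
    DoubleCoset.mk (borelSubgroup F) (sl2Z F) g = DoubleCoset.mk (borelSubgroup F) (sl2Z F) g' ↔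
      ∃ γ : SL(2, ℤ),
        g' 1 0 * (g 1 0 * (γ 0 1 : ℤ) + g 1 1 * (γ 1 1 : ℤ)) =
          g' 1 1 * (g 1 0 * (γ 0 0 : ℤ) + g 1 1 * (γ 1 0 : ℤ)) := by
  have hentry : ∀ (γ : SL(2, ℤ)) (j : Fin 2),
      (g * Matrix.SpecialLinearGroup.map (n := Fin 2) (Int.castRingHom F) γ) 1 j =
        g 1 0 * (γ 0 j : ℤ) + g 1 1 * (γ 1 j : ℤ) := by
    intro γ j
    rw [Matrix.SpecialLinearGroup.coe_mul, Matrix.mul_apply, Fin.sum_univ_two]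
    rfl
  rw [DoubleCoset.eq]
  constructor
  · rintro ⟨h, hh, _, ⟨γ, rfl⟩, rfl⟩
    refine ⟨γ, ?_⟩
    rw [← hentry, ← hentry, mul_assoc]
    have h10 : h 1 0 = 0 := hh
    generalize g * Matrix.SpecialLinearGroup.map (n := Fin 2) (Int.castRingHom F) γ = w
    rw [Matrix.SpecialLinearGroup.coe_mul, Matrix.mul_apply, Matrix.mul_apply, Fin.sum_univ_two,
      Fin.sum_univ_two, h10]
    ring
  · rintro ⟨γ, hγ⟩
    rw [← hentry, ← hentry] at hγ
    refine ⟨g' * (g * Matrix.SpecialLinearGroup.map (n := Fin 2) (Int.castRingHom F) γ)⁻¹, ?_,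
      _, ⟨γ, rfl⟩, by group⟩
    generalize g * Matrix.SpecialLinearGroup.map (n := Fin 2) (Int.castRingHom F) γ = w at hγ ⊢
    show (g' * w⁻¹) 1 0 = 0
    rw [Matrix.SpecialLinearGroup.coe_mul, Matrix.mul_apply, Fin.sum_univ_two,
      Matrix.SpecialLinearGroup.SL2_inv_expl]
    simp only [Matrix.cons_val', Matrix.cons_val_zero, Matrix.cons_val_one,
      Matrix.cons_val_fin_one]
    linear_combination hγ

theorem mobius_num_ne_zero [CharZero F] (β : F) (γ : SL(2, ℤ)) :
    ((γ 0 0 : ℤ) : F) + (γ 1 0 : ℤ) * β = 0 →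
      ((γ 0 1 : ℤ) : F) + (γ 1 1 : ℤ) * β ≠ 0 := by
  intro h h'
  have hdet : ((γ 0 0 : ℤ) : F) * (γ 1 1 : ℤ) - (γ 0 1 : ℤ) * (γ 1 0 : ℤ) = 1 := by
    exact_mod_cast congrArg (Int.cast : ℤ → F) (sl2Z_det γ)
  have : (1 : F) = 0 := by
    rw [← hdet]
    linear_combination ((γ 1 1 : ℤ) : F) * h - ((γ 1 0 : ℤ) : F) * h'
  exact one_ne_zero this

theorem mk_cuspLift_eq_iff [CharZero F] (α β : F) :
    DoubleCoset.mk (borelSubgroup F) (sl2Z F) (cuspLift (β : OnePoint F)) =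
        DoubleCoset.mk (borelSubgroup F) (sl2Z F) (cuspLift (α : OnePoint F)) ↔
      ∃ γ : SL(2, ℤ), ((γ 0 0 : ℤ) : F) + (γ 1 0 : ℤ) * β ≠ 0 ∧ α = mobius β γ := by
  rw [mk_eq_mk_iff]
  simp only [cuspLift_coe, Matrix.of_apply, Matrix.cons_val', Matrix.cons_val_zero,
    Matrix.cons_val_one, Matrix.cons_val_fin_one, one_mul]
  refine exists_congr fun γ => ?_
  have e1 : ((γ 0 0 : ℤ) : F) + (γ 1 0 : ℤ) * β = (γ 0 0 : ℤ) + β * (γ 1 0 : ℤ) := by ring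
  have e2 : ((γ 0 1 : ℤ) : F) + (γ 1 1 : ℤ) * β = (γ 0 1 : ℤ) + β * (γ 1 1 : ℤ) := by ring
  rw [← e1, ← e2]
  constructor
  · intro h
    have hne : ((γ 0 0 : ℤ) : F) + (γ 1 0 : ℤ) * β ≠ 0 := by
      intro h0
      exact mobius_num_ne_zero β γ h0 (by rw [h, h0, mul_zero])
    exact ⟨hne, by rw [mobius, eq_div_iff hne, h]⟩
  · rintro ⟨hne, rfl⟩
    rw [mobius, div_mul_cancel₀ _ hne]

theorem mk_cuspLift_eq_one_iff [CharZero F] (α : F) :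
    DoubleCoset.mk (borelSubgroup F) (sl2Z F) (cuspLift (OnePoint.infty : OnePoint F)) =
        DoubleCoset.mk (borelSubgroup F) (sl2Z F) (cuspLift (α : OnePoint F)) ↔
      ∃ q : ℚ, (q : F) = α := by
  rw [mk_eq_mk_iff]
  simp only [cuspLift_infty, cuspLift_coe, Matrix.of_apply, Matrix.cons_val', Matrix.cons_val_zero,
    Matrix.cons_val_one, Matrix.cons_val_fin_one, one_mul, Matrix.SpecialLinearGroup.coe_one,
    Matrix.one_apply_eq, Matrix.one_apply_ne (one_ne_zero : (1 : Fin 2) ≠ 0), zero_mul, zero_add]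
  constructor
  · rintro ⟨γ, h⟩
    have hc : γ 1 0 ≠ 0 := by
      intro h0
      rw [h0, Int.cast_zero, mul_zero, Int.cast_eq_zero] at h
      exact sl_bottom_ne_zero γ h0 h
    refine ⟨(γ 1 1 : ℚ) / (γ 1 0 : ℚ), ?_⟩
    have hcF : ((γ 1 0 : ℤ) : F) ≠ 0 := by exact_mod_cast hc
    push_cast
    rw [div_eq_iff hcF, h]
  · rintro ⟨q, rfl⟩
    obtain ⟨γ, h0, h1⟩ := IsCoprime.exists_SL2_row (a := (q.den : ℤ)) (b := q.num)
      (Int.isCoprime_iff_gcd_eq_one.mpr (by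
        rw [Int.gcd_comm]
        exact q.reduced)) 1
    refine ⟨γ, ?_⟩
    rw [h0, h1]
    have : ((q.den : ℕ) : F) ≠ 0 := by exact_mod_cast q.den_ne_zero
    conv_rhs => rw [Rat.cast_def]
    push_cast
    rw [div_mul_cancel₀ _ this]

/-- The elements of `F` that are not rational. -/
def irrationals (F : Type*) [Field F] : Set F := (Set.range ((↑) : ℚ → F))ᶜ

theorem mobius_neg (β : F) (γ : SL(2, ℤ)) : mobius β (-γ) = mobius β γ := by
  simp only [mobius, Matrix.SpecialLinearGroup.coe_neg, Matrix.neg_apply, Int.cast_neg, neg_mul]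
  rw [← neg_add, ← neg_add, neg_div_neg_eq]

theorem mobius_denom_ne_zero [CharZero F] {β : F} (hβ : β ∈ irrationals F) (γ : SL(2, ℤ)) :
    ((γ 0 0 : ℤ) : F) + (γ 1 0 : ℤ) * β ≠ 0 := by
  intro h
  by_cases hc : γ 1 0 = 0
  · have hdet := sl2Z_det γ
    rw [hc, Int.cast_zero, zero_mul, add_zero, Int.cast_eq_zero] at h
    rw [hc, h] at hdet
    simp at hdet
  · have hcF : ((γ 1 0 : ℤ) : F) ≠ 0 := by exact_mod_cast hc
    refine hβ ⟨-(γ 0 0 : ℚ) / (γ 1 0 : ℚ), ?_⟩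
    push_cast
    rw [div_eq_iff hcF]
    linear_combination -h

theorem mobius_mem_irrationals [CharZero F] {β : F} (hβ : β ∈ irrationals F) (γ : SL(2, ℤ)) :
    mobius β γ ∈ irrationals F := by
  intro hq
  have h1 := (mk_cuspLift_eq_one_iff (mobius β γ)).mpr hq
  have h2 := (mk_cuspLift_eq_iff (mobius β γ) β).mpr ⟨γ, mobius_denom_ne_zero hβ γ, rfl⟩
  exact hβ ((mk_cuspLift_eq_one_iff β).mp (h1.trans h2.symm))

theorem IsRepSet.subset_irrationals [CharZero F] {S₀ : Set F} (h : IsRepSet S₀) :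
    S₀ ⊆ irrationals F := by
  intro β hβ hq
  have h1 := (mk_cuspLift_eq_one_iff β).mpr hq
  have := h.injOn (Set.mem_insert _ _) (Set.mem_insert_of_mem _ ⟨β, hβ, rfl⟩) h1
  exact OnePoint.infty_ne_coe β this

theorem IsRepSet.exists_mobius_eq [CharZero F] {S₀ : Set F} (h : IsRepSet S₀) {α : F}
    (hα : α ∈ irrationals F) : ∃ β ∈ S₀, ∃ γ ∈ posReps, mobius β γ = α := by
  obtain ⟨p, hp, hpα⟩ := h.surjOn (Set.mem_univ
    (DoubleCoset.mk (borelSubgroup F) (sl2Z F) (cuspLift (α : OnePoint F))))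
  rcases hp with rfl | ⟨β, hβ, rfl⟩
  · exact absurd ((mk_cuspLift_eq_one_iff α).mp hpα) hα
  · obtain ⟨γ, -, hγ⟩ := (mk_cuspLift_eq_iff α β).mp hpα
    rcases mem_posReps_or_neg_mem γ with hm | hm
    · exact ⟨β, hβ, γ, hm, hγ.symm⟩
    · exact ⟨β, hβ, -γ, hm, by rw [mobius_neg, hγ]⟩

/-! ### Freeness of the irrational orbits -/

section Quadratic

open Polynomial (C X)
open scoped Polynomial

variable [NumberField F]

theorem adjoin_eq_top_of_irrational (hF : ∀ K : IntermediateField ℚ F, K = ⊥ ∨ K = ⊤) {β : F}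
    (hβ : β ∈ irrationals F) : IntermediateField.adjoin ℚ {β} = ⊤ := by
  refine (hF _).resolve_left fun h => hβ ?_
  rw [IntermediateField.adjoin_simple_eq_bot_iff, IntermediateField.mem_bot] at h
  obtain ⟨q, hq⟩ := h
  exact ⟨q, by rw [← hq]; simp⟩

/-- A generator of a field of degree at least three satisfies no quadratic equation. -/
theorem quadratic_coeff_eq_zero (hF : ∀ K : IntermediateField ℚ F, K = ⊥ ∨ K = ⊤)
    (h3 : 3 ≤ finrank ℚ F) {β : F} (hβ : β ∈ irrationals F) {x y z : ℤ}
    (h : (x : F) + y * β + z * β ^ 2 = 0) : x = 0 ∧ y = 0 ∧ z = 0 := by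
  set p : ℚ[X] := C (z : ℚ) * X ^ 2 + C (y : ℚ) * X + C (x : ℚ) with hp
  have hp0 : p = 0 := by
    by_contra hne
    have haev : Polynomial.aeval β p = 0 := by
      rw [← h, hp]
      simp
      ring
    have hdeg := minpoly.degree_le_of_ne_zero ℚ β hne haev
    have hnat : (minpoly ℚ β).natDegree ≤ 2 :=
      (Polynomial.natDegree_le_natDegree hdeg).trans Polynomial.natDegree_quadratic_le
    rw [← IntermediateField.adjoin.finrank (Algebra.IsIntegral.isIntegral (R := ℚ) β),
      adjoin_eq_top_of_irrational hF hβ, IntermediateField.finrank_top'] at hnat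
    omega
  have hcoeff : ∀ a b c : ℚ, C a * X ^ 2 + C b * X + C c = 0 → c = 0 ∧ b = 0 ∧ a = 0 := by
    intro a b c h
    have h0 := congrArg (fun p => Polynomial.coeff p 0) h
    have h1 := congrArg (fun p => Polynomial.coeff p 1) h
    have h2 := congrArg (fun p => Polynomial.coeff p 2) h
    simp [Polynomial.coeff_X, Polynomial.coeff_C, Polynomial.coeff_X_pow] at h0 h1 h2
    exact ⟨h0, h1, h2⟩
  exact_mod_cast hcoeff z y x hp0

/-- Equality of two translates of `β` clears to a quadratic equation with integer coefficients. All
coefficients vanish, which forces the matrices to be proportional, and the determinants make the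
factor `±1`. -/
theorem mobius_injOn (hF : ∀ K : IntermediateField ℚ F, K = ⊥ ∨ K = ⊤)
    (h3 : 3 ≤ finrank ℚ F) {β : F} (hβ : β ∈ irrationals F) :
    Set.InjOn (mobius β) posReps := by
  intro γ hγ γ' hγ' h
  refine eq_of_mem_posReps hγ hγ' ?_
  rw [mobius, mobius, div_eq_div_iff (mobius_denom_ne_zero hβ γ) (mobius_denom_ne_zero hβ γ')] at h
  obtain ⟨hx, hy, hz⟩ := quadratic_coeff_eq_zero hF h3 hβ
    (x := γ 0 1 * γ' 0 0 - γ' 0 1 * γ 0 0)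
    (y := γ 0 1 * γ' 1 0 + γ 1 1 * γ' 0 0 - γ' 0 1 * γ 1 0 - γ' 1 1 * γ 0 0)
    (z := γ 1 1 * γ' 1 0 - γ' 1 1 * γ 1 0) (by push_cast; linear_combination h)
  have d1 := sl2Z_det γ
  have d2 := sl2Z_det γ'
  set a := γ 0 0
  set b := γ 0 1
  set c := γ 1 0
  set e := γ 1 1
  set a' := γ' 0 0
  set b' := γ' 0 1
  set c' := γ' 1 0
  set e' := γ' 1 1
  -- The scalar is the upper left entry of `γ' γ⁻¹`.
  have ha : a' = (a' * e - b' * c) * a := by linear_combination -a' * d1 - c * hx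
  have hb : b' = (a' * e - b' * c) * b := by linear_combination -b' * d1 - e * hx
  have hc : c' = (a' * e - b' * c) * c := by linear_combination -c' * d1 + a * hz - c * hy
  have he : e' = (a' * e - b' * c) * e := by linear_combination -e' * d1 + b * hz - e * hy
  have hsq : (a' * e - b' * c) ^ 2 = 1 := by
    linear_combination (a' * e - b' * c) * hy + (b' * a - a' * b) * hz +
      (a * e - b * c) * d2 + d1
  have key : ∀ s : ℤ, a' = s * a → b' = s * b → c' = s * c → e' = s * e → (s = 1 ∨ s = -1) →
      γ = γ' ∨ γ = -γ' := by
    rintro s h1 h2 h3 h4 (rfl | rfl)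
    · left
      ext i j
      fin_cases i <;> fin_cases j
      · show a = a'; rw [h1, one_mul]
      · show b = b'; rw [h2, one_mul]
      · show c = c'; rw [h3, one_mul]
      · show e = e'; rw [h4, one_mul]
    · right
      ext i j
      fin_cases i <;> fin_cases j
      · show a = -a'; rw [h1]; ring
      · show b = -b'; rw [h2]; ring
      · show c = -c'; rw [h3]; ring
      · show e = -e'; rw [h4]; ring
  exact key _ ha hb hc he (by
    simpa using sq_eq_sq_iff_eq_or_eq_neg.mp (hsq.trans (one_pow 2).symm))

/-- The slopes in the orbits of `S₀` exhaust the irrational elements without repetition. -/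
theorem IsRepSet.bijective_mobius (hF : ∀ K : IntermediateField ℚ F, K = ⊥ ∨ K = ⊤)
    (h3 : 3 ≤ finrank ℚ F) {S₀ : Set F} (h : IsRepSet S₀) :
    Function.Bijective (fun x : S₀ × posReps =>
      (⟨mobius x.1.1 x.2.1, mobius_mem_irrationals (h.subset_irrationals x.1.2) x.2.1⟩ :
        irrationals F)) := by
  constructor
  · rintro ⟨⟨β, hβ⟩, ⟨γ, hγ⟩⟩ ⟨⟨β', hβ'⟩, ⟨γ', hγ'⟩⟩ heq
    have heq' : mobius β γ = mobius β' γ' := congrArg Subtype.val heq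
    have h1 := (mk_cuspLift_eq_iff (mobius β γ) β).mpr
      ⟨γ, mobius_denom_ne_zero (h.subset_irrationals hβ) γ, rfl⟩
    have h2 := (mk_cuspLift_eq_iff (mobius β γ) β').mpr
      ⟨γ', mobius_denom_ne_zero (h.subset_irrationals hβ') γ', heq'⟩
    have hββ : β = β' := OnePoint.coe_injective
      (h.injOn (Set.mem_insert_of_mem _ ⟨β, hβ, rfl⟩) (Set.mem_insert_of_mem _ ⟨β', hβ', rfl⟩)
        (h1.trans h2.symm))
    subst hββ
    have := mobius_injOn hF h3 (h.subset_irrationals hβ) hγ hγ' heq'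
    subst this
    rfl
  · rintro ⟨α, hα⟩
    obtain ⟨β, hβ, γ, hγ, hm⟩ := h.exists_mobius_eq hα
    exact ⟨⟨⟨β, hβ⟩, ⟨γ, hγ⟩⟩, Subtype.ext hm⟩

/-- An embedding is determined by its value on the generator `β`. This makes all poles of the slope
term distinct. -/
theorem embeddings_injective_of_irrational (hF : ∀ K : IntermediateField ℚ F, K = ⊥ ∨ K = ⊤)
    {β : F} (hβ : β ∈ irrationals F) : Function.Injective (fun σ : F →+* ℝ => σ β) := by
  intro σ τ h
  have hadj : Algebra.adjoin ℚ {β} = ⊤ := by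
    rw [← IntermediateField.adjoin_simple_toSubalgebra_of_isAlgebraic
      (Algebra.IsAlgebraic.isAlgebraic β), adjoin_eq_top_of_irrational hF hβ,
      IntermediateField.top_toSubalgebra]
  have : (σ.toRatAlgHom : F →ₐ[ℚ] ℝ) = τ.toRatAlgHom :=
    AlgHom.ext_of_adjoin_eq_top hadj (by rintro x rfl; exact h)
  ext x
  exact DFunLike.congr_fun this x

end Quadratic

/-! ### The rational slopes -/

theorem sl_eq_of_bottom_row {γ γ' : SL(2, ℤ)} (h0 : γ 1 0 = γ' 1 0) (h1 : γ 1 1 = γ' 1 1) :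
    ∃ n : ℤ, γ = ModularGroup.T ^ n * γ' := by
  have d1 := sl2Z_det γ
  have d2 := sl2Z_det γ'
  -- The upper right entry of `γ γ'⁻¹`.
  refine ⟨γ 0 1 * γ' 0 0 - γ 0 0 * γ' 0 1, ?_⟩
  rw [h0, h1] at d1
  ext i j
  rw [Matrix.SpecialLinearGroup.coe_mul, ModularGroup.coe_T_zpow, Matrix.mul_apply,
    Fin.sum_univ_two]
  fin_cases i <;> fin_cases j
  · simp
    linear_combination γ' 0 0 * d1 - γ 0 0 * d2
  · simp
    linear_combination γ' 0 1 * d1 - γ 0 1 * d2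
  · simpa using h0
  · simpa using h1

theorem T_zpow_mul_bottom (n : ℤ) (γ : SL(2, ℤ)) (j : Fin 2) :
    (ModularGroup.T ^ n * γ) 1 j = γ 1 j := by
  rw [Matrix.SpecialLinearGroup.coe_mul, ModularGroup.coe_T_zpow, Matrix.mul_apply,
    Fin.sum_univ_two]
  simp

/-- Coset representatives indexed by `ℙ¹(ℚ)`, times translations, exhaust `SL₂(ℤ)` up to sign. -/
theorem bijective_translate_mul (r : Option ℚ → SL(2, ℤ)) (hn : r none = 1)
    (hr : ∀ q : ℚ, r (some q) 1 0 = q.den ∧ r (some q) 1 1 = q.num) :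
    ∃ h : ∀ x : Option ℚ × ℤ, ModularGroup.T ^ x.2 * r x.1 ∈ posReps,
      Function.Bijective (fun x : Option ℚ × ℤ =>
        (⟨ModularGroup.T ^ x.2 * r x.1, h x⟩ : posReps)) := by
  have hmem : ∀ x : Option ℚ × ℤ, ModularGroup.T ^ x.2 * r x.1 ∈ posReps := by
    rintro ⟨_ | q, n⟩
    · right
      rw [T_zpow_mul_bottom, T_zpow_mul_bottom, hn]
      simp
    · left
      rw [T_zpow_mul_bottom, (hr q).1]
      exact_mod_cast q.den_pos
  refine ⟨hmem, ?_, ?_⟩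
  · rintro ⟨p, n⟩ ⟨p', n'⟩ h
    have h' : ModularGroup.T ^ n * r p = ModularGroup.T ^ n' * r p' := congrArg Subtype.val h
    have hb : ∀ j, r p 1 j = r p' 1 j := fun j => by
      rw [← T_zpow_mul_bottom n, h', T_zpow_mul_bottom]
    have hp : p = p' := by
      rcases p with _ | q <;> rcases p' with _ | q'
      · rfl
      · have := hb 0
        rw [hn, (hr q').1] at this
        simp at this
        exact absurd this.symm (by exact_mod_cast q'.den_ne_zero)
      · have := hb 0
        rw [hn, (hr q).1] at this
        simp at this
      · have e0 := hb 0
        have e1 := hb 1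
        rw [(hr q).1, (hr q').1] at e0
        rw [(hr q).2, (hr q').2] at e1
        exact congrArg some (Rat.ext e1 (by exact_mod_cast e0))
    subst hp
    have hT := mul_right_cancel h'
    have := congrArg (fun M : SL(2, ℤ) => M 0 1) hT
    simp only [ModularGroup.coe_T_zpow] at this
    simp at this
    rw [this]
  · rintro ⟨γ, hγ⟩
    rcases hγ with hc | ⟨hc, hd⟩
    · have hcop : IsCoprime (γ 1 0) (γ 1 1) :=
        ⟨-γ 0 1, γ 0 0, by linear_combination sl2Z_det γ⟩
      have hgcd : Int.gcd (γ 1 1) (γ 1 0) = 1 := by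
        rw [Int.gcd_comm]
        exact Int.isCoprime_iff_gcd_eq_one.mp hcop
      set q : ℚ := (γ 1 1 : ℚ) / (γ 1 0 : ℚ) with hq
      have hnum : q.num = γ 1 1 := Rat.num_div_eq_of_coprime hc hgcd
      have hden : (q.den : ℤ) = γ 1 0 := Rat.den_div_eq_of_coprime hc hgcd
      obtain ⟨n, hn'⟩ := sl_eq_of_bottom_row (γ := γ) (γ' := r (some q))
        (by rw [(hr q).1, hden]) (by rw [(hr q).2, hnum])
      exact ⟨(some q, n), Subtype.ext hn'.symm⟩
    · have hd1 : γ 1 1 = 1 := by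
        have hdet := sl2Z_det γ
        rw [hc, mul_zero, sub_zero] at hdet
        exact Int.eq_one_of_mul_eq_one_left hd.le hdet
      obtain ⟨n, hn'⟩ := sl_eq_of_bottom_row (γ := γ) (γ' := r none)
        (by rw [hn, hc]; simp) (by rw [hn, hd1]; simp)
      exact ⟨(none, n), Subtype.ext hn'.symm⟩

end Orbits


/-! ### Termwise integration and unfolding to a strip -/

section Unfolding

open MeasureTheory Filter Topology
open scoped Modular

/-- The fundamental domain has finite volume, so a uniform bound on the sum of norms bounds the sum
of the integrals of the norms. -/
theorem hasSum_setIntegral_fd {ι : Type*} [Countable ι] {φ : ι → ℍ → ℂ}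
    (hc : ∀ i, Continuous (φ i)) {M : ℝ}
    (hs : ∀ τ ∈ 𝒟, (Summable fun i => ‖φ i τ‖) ∧ ∑' i, ‖φ i τ‖ ≤ M) :
    (∀ i, IntegrableOn (φ i) 𝒟) ∧ (Summable fun i => ∫ τ in 𝒟, ‖φ i τ‖) ∧
      IntegrableOn (fun τ => ∑' i, φ i τ) 𝒟 ∧
      HasSum (fun i => ∫ τ in 𝒟, φ i τ) (∫ τ in 𝒟, ∑' i, φ i τ) := by
  have hfin : IsFiniteMeasure (volume.restrict (𝒟 : Set ℍ)) :=
    ⟨by rw [Measure.restrict_apply_univ]; exact volume_fd_lt_top⟩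
  have hmeas : MeasurableSet (𝒟 : Set ℍ) := ModularGroup.isClosed_fd.measurableSet
  have hbound : ∀ (s : Finset ι), ∀ τ ∈ 𝒟, ∑ i ∈ s, ‖φ i τ‖ ≤ M := fun s τ hτ =>
    ((hs τ hτ).1.sum_le_tsum s fun _ _ => norm_nonneg _).trans (hs τ hτ).2
  have hint : ∀ i, IntegrableOn (φ i) 𝒟 := by
    intro i
    refine Integrable.of_bound (hc i).aestronglyMeasurable M ?_
    filter_upwards [ae_restrict_mem hmeas] with τ hτ
    simpa using hbound {i} τ hτ
  have hsum : Summable fun i => ∫ τ in 𝒟, ‖φ i τ‖ := by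
    refine summable_of_sum_le (c := ∫ _τ in 𝒟, M) (fun i => by positivity) fun s => ?_
    rw [← integral_finsetSum _ fun i _ => (hint i).norm]
    refine setIntegral_mono_on (integrable_finsetSum _ fun i _ => (hint i).norm)
      (integrable_const _) hmeas fun τ hτ => hbound s τ hτ
  refine ⟨hint, hsum, ?_, hasSum_integral_of_summable_integral_norm hint hsum⟩
  refine Integrable.of_bound ?_ M ?_
  · refine aestronglyMeasurable_of_tendsto_ae (u := (atTop : Filter (Finset ι)))
      (f := fun s τ => ∑ i ∈ s, φ i τ) (fun s => ?_) ?_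
    · exact (continuous_finsetSum _ fun i _ => hc i).aestronglyMeasurable
    · filter_upwards [ae_restrict_mem hmeas] with τ hτ
      exact (hs τ hτ).1.of_norm.hasSum
  · filter_upwards [ae_restrict_mem hmeas] with τ hτ
    exact (norm_tsum_le_tsum_norm (hs τ hτ).1).trans (hs τ hτ).2

/-- The strip `0 ≤ re τ < 1`. -/
def strip : Set ℍ := {τ | 0 ≤ τ.re ∧ τ.re < 1}

theorem measurableSet_strip : MeasurableSet strip := by
  have h : Measurable (UpperHalfPlane.re) := UpperHalfPlane.continuous_re.measurable
  exact (measurableSet_le measurable_const h).inter (measurableSet_lt h measurable_const)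

theorem T_zpow_smul_mem_strip (n : ℤ) (τ : ℍ) :
    ModularGroup.T ^ n • τ ∈ strip ↔ ⌊τ.re⌋ = -n := by
  rw [strip, Set.mem_ofPred_eq, ModularGroup.re_T_zpow_smul, Int.floor_eq_iff]
  push_cast
  constructor <;> rintro ⟨h1, h2⟩ <;> constructor <;> linarith

/-- Each `r • τ` has exactly one integer translate in the strip, so the indicator sets partition
`ℍ`. -/
theorem hasSum_integral_strip {E : Type*} [NormedAddCommGroup E] [NormedSpace ℝ E] {H : ℍ → E}
    (r : SL(2, ℤ)) (hi : IntegrableOn H 𝒟) :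
    HasSum (fun n : ℤ => ∫ τ in 𝒟,
      {τ : ℍ | (ModularGroup.T ^ n * r) • τ ∈ strip}.indicator H τ) (∫ τ in 𝒟, H τ) := by
  set s : ℤ → Set ℍ := fun n => {τ : ℍ | (ModularGroup.T ^ n * r) • τ ∈ strip} with hsdef
  have hs : ∀ n, MeasurableSet (s n) := fun n =>
    (measurableEmbedding_sl_smul (ModularGroup.T ^ n * r)).measurable measurableSet_strip
  have hmem : ∀ n τ, τ ∈ s n ↔ ⌊(r • τ).re⌋ = -n := fun n τ => by
    rw [hsdef, Set.mem_ofPred_eq, mul_smul, T_zpow_smul_mem_strip]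
  have hun : ⋃ n, s n = Set.univ := by
    refine Set.eq_univ_of_forall fun τ => Set.mem_iUnion.mpr ⟨-⌊(r • τ).re⌋, ?_⟩
    rw [hmem, neg_neg]
  have hd : Pairwise (Function.onFun Disjoint s) := by
    intro m n hmn
    rw [Function.onFun, Set.disjoint_left]
    intro τ h1 h2
    rw [hmem] at h1 h2
    exact hmn (by linarith)
  have := hasSum_integral_iUnion (μ := volume.restrict (𝒟 : Set ℍ)) (f := H) hs hd
    (by rw [hun]; exact hi.integrableOn)
  rw [hun, Measure.restrict_univ] at this
  convert this using 2 with n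
  exact integral_indicator (hs n)

/-- Unfolding modulo translations, reduced to the full tiling: cut `G` off to the strip and write
each group element, up to sign, uniquely as `T ^ n * r p`. Summing over `n` first removes the
cut-off. -/
theorem tsum_integral_translates {G : ℍ → ℂ}
    (hG : ∀ (n : ℤ) (τ : ℍ), G (ModularGroup.T ^ n • τ) = G τ)
    (r : Option ℚ → SL(2, ℤ)) (hn : r none = 1)
    (hr : ∀ q : ℚ, r (some q) 1 0 = q.den ∧ r (some q) 1 1 = q.num)
    (hi : ∀ p, IntegrableOn (fun τ => G (r p • τ)) 𝒟)
    (hs : Summable fun p => ∫ τ in 𝒟, ‖G (r p • τ)‖) :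
    Integrable (strip.indicator G) ∧
      ∑' p, ∫ τ in 𝒟, G (r p • τ) = ∫ τ, strip.indicator G τ := by
  obtain ⟨hmem, hbij⟩ := bijective_translate_mul r hn hr
  let e := Equiv.ofBijective _ hbij
  have hval : ∀ (x : Option ℚ × ℤ) (τ : ℍ), strip.indicator G ((e x : SL(2, ℤ)) • τ) =
      {τ : ℍ | (ModularGroup.T ^ x.2 * r x.1) • τ ∈ strip}.indicator
        (fun τ => G (r x.1 • τ)) τ := by
    intro x τ
    show strip.indicator G ((ModularGroup.T ^ x.2 * r x.1) • τ) = _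
    simp only [Set.indicator, Set.mem_ofPred_eq]
    split_ifs with h
    · rw [mul_smul, hG]
    · rfl
  have hmeas : ∀ x : Option ℚ × ℤ,
      MeasurableSet {τ : ℍ | (ModularGroup.T ^ x.2 * r x.1) • τ ∈ strip} := fun x =>
    (measurableEmbedding_sl_smul _).measurable measurableSet_strip
  have hint : ∀ g ∈ posReps, IntegrableOn (fun τ => strip.indicator G (g • τ)) 𝒟 := by
    intro g hg
    obtain ⟨x, hx⟩ := e.surjective ⟨g, hg⟩
    have : (fun τ => strip.indicator G (g • τ)) =
        {τ : ℍ | (ModularGroup.T ^ x.2 * r x.1) • τ ∈ strip}.indicator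
          (fun τ => G (r x.1 • τ)) := funext fun τ => by
      rw [← hval x τ, hx]
    rw [this]
    exact IntegrableOn.indicator (hi x.1) (hmeas x)
  have hnorm : ∀ p, HasSum (fun n : ℤ => ∫ τ in 𝒟, ‖strip.indicator G ((e (p, n) : SL(2, ℤ)) • τ)‖)
      (∫ τ in 𝒟, ‖G (r p • τ)‖) := by
    intro p
    refine (hasSum_integral_strip (r p) (hi p).norm).congr_fun fun n => ?_
    refine integral_congr_ae (Eventually.of_forall fun τ => ?_)
    show ‖strip.indicator G ((e (p, n) : SL(2, ℤ)) • τ)‖ = _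
    rw [hval (p, n) τ, norm_indicator_eq_indicator_norm]
  have hsum : Summable fun g : posReps => ∫ τ in 𝒟, ‖strip.indicator G ((g : SL(2, ℤ)) • τ)‖ := by
    rw [← e.summable_iff]
    refine (summable_prod_of_nonneg fun x => integral_nonneg fun _ => norm_nonneg _).mpr
      ⟨fun p => (hnorm p).summable, ?_⟩
    exact hs.congr fun p => ((hnorm p).tsum_eq).symm
  obtain ⟨h1, h2⟩ := hasSum_integral_smul_fd hint hsum
  refine ⟨h1, ?_⟩
  have h3 := (e.hasSum_iff (f := fun g : posReps =>
    ∫ τ in 𝒟, strip.indicator G ((g : SL(2, ℤ)) • τ))).mpr h2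
  have h4 := h3.prod_fiberwise (g := fun p => ∫ τ in 𝒟, G (r p • τ)) fun p => by
    refine (hasSum_integral_strip (r p) (hi p)).congr_fun fun n => ?_
    exact integral_congr_ae (Eventually.of_forall fun τ => hval (p, n) τ)
  exact h4.tsum_eq

end Unfolding


/-! ### Bounds and the constant term of cusp forms -/

section CuspForms

open MeasureTheory Filter Topology
open scoped Modular ModularForm

/-- Exponential decay at the cusp beats the power of `v`, so `conj f * v^w` is bounded on the
fundamental domain. -/
theorem exists_norm_petersson_le {w : ℕ} (f : CuspForm 𝒮ℒ (w : ℤ)) :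
    ∃ C : ℝ, 0 ≤ C ∧ ∀ (g : ℍ → ℂ), ∀ τ ∈ 𝒟, ‖petersson w f g τ‖ ≤ C * ‖g τ‖ := by
  have hcont : Continuous (petersson w f 1) := by
    unfold petersson
    have := f.holo'.continuous
    fun_prop
  have hO : petersson w f 1 =O[atImInfty] fun z => z.im ^ (0 : ℝ) := by
    have h1 := CuspFormClass.exp_decay_atImInfty (h := 1) f one_pos
      (by simp)
    have h2 : (fun τ : ℍ => τ.im ^ w * Real.exp (-2 * Real.pi * τ.im / 1)) =O[atImInfty]
        fun _ => (1 : ℝ) := by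
      have h3 : Tendsto (fun x : ℝ => x ^ w * Real.exp (-(2 * Real.pi) * x)) atTop (𝓝 0) := by
        have := tendsto_rpow_mul_exp_neg_mul_atTop_nhds_zero (w : ℝ) (2 * Real.pi)
          Real.two_pi_pos
        simpa using this
      have h4 := (h3.comp tendsto_comap).isBigO_one ℝ (l := atImInfty)
      refine h4.congr_left fun τ => ?_
      simp only [Function.comp_apply]
      congr 2
      ring
    have h5 : petersson w f 1 =O[atImInfty]
        fun τ : ℍ => τ.im ^ w * Real.exp (-2 * Real.pi * τ.im / 1) := by
      refine ((Asymptotics.isBigO_refl (fun τ : ℍ => τ.im ^ w)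
        atImInfty).mul h1.norm_left).congr_left
        (f₂ := fun τ => ‖petersson w f 1 τ‖) (fun τ => ?_) |>.of_norm_left
      simp [petersson, abs_of_pos τ.im_pos, mul_comm]
    simpa using h5.trans h2
  obtain ⟨C, hC⟩ := ModularGroup.exists_bound_fundamental_domain_of_isBigO hcont hO
  simp only [Real.rpow_zero, mul_one] at hC
  refine ⟨max C 0, le_max_right _ _, fun g τ hτ => ?_⟩
  have : petersson w f g τ = petersson w f 1 τ * g τ := by
    simp [petersson]
    ring
  rw [this, norm_mul]
  gcongr
  exact (hC τ hτ).trans (le_max_left _ _)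

theorem petersson_one_T_zpow {w : ℤ} (f : CuspForm 𝒮ℒ w) (n : ℤ) (τ : ℍ) :
    petersson w f 1 (ModularGroup.T ^ n • τ) = petersson w f 1 τ := by
  refine petersson_smul_of_slash f ?_ τ
  ext z
  rw [ModularForm.SL_slash_apply, ModularGroup.denom_apply]
  simp [ModularGroup.coe_T_zpow]

/-- On each horizontal segment the integral is a multiple of the conjugate of the zeroth Fourier
coefficient. -/
theorem integral_strip_petersson_one {w : ℤ} (f : CuspForm 𝒮ℒ w)
    (hi : Integrable (strip.indicator (petersson w f 1))) :
    ∫ τ, strip.indicator (petersson w f 1) τ = 0 := by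
  rw [integral_upperHalfPlane hi]
  refine setIntegral_eq_zero_of_forall_eq_zero fun v hv => ?_
  have hv' : 0 < v := hv
  have hind : (fun u : ℝ => (((v ^ 2)⁻¹ : ℝ) : ℂ) *
      strip.indicator (petersson w f 1) (ofComplex (u + v * Complex.I))) =
      (Set.Ico (0 : ℝ) 1).indicator fun u => (((v ^ 2)⁻¹ : ℝ) : ℂ) * (v : ℂ) ^ w *
        conj (f ⟨u + v * Complex.I, by simpa using hv'⟩) := by
    ext u
    have him : 0 < ((u : ℂ) + v * Complex.I).im := by simpa using hv'
    rw [ofComplex_apply_of_im_pos him]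
    have hst : (⟨(u : ℂ) + v * Complex.I, him⟩ : ℍ) ∈ strip ↔ u ∈ Set.Ico (0 : ℝ) 1 := by
      rw [strip, Set.mem_ofPred_eq, ← coe_re]
      simp
    by_cases h : u ∈ Set.Ico (0 : ℝ) 1
    · rw [Set.indicator_of_mem (hst.mpr h), Set.indicator_of_mem h, petersson]
      rw [← coe_im]
      simp
      ring
    · rw [Set.indicator_of_notMem (fun h' => h (hst.mp h')), Set.indicator_of_notMem h, mul_zero]
  rw [hind, integral_indicator measurableSet_Ico, integral_const_mul, integral_conj]
  have h0 := CuspFormClass.qExpansion_coeff_zero f (h := 1) one_pos (by simp)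
  rw [ModularFormClass.qExpansion_coeff_eq_intervalIntegral f one_pos (by simp) 0 hv'] at h0
  simp only [Complex.ofReal_one, pow_zero, div_one, one_mul] at h0
  rw [intervalIntegral.integral_of_le zero_le_one, ← integral_Ico_eq_integral_Ioc] at h0
  rw [h0, map_zero, mul_zero]

end CuspForms


/-! ### Splitting the inner product into orbits -/

section Main

open MeasureTheory Filter Topology NumberField Module
open scoped Modular ModularForm

variable {F : Type*} [Field F] [NumberField F]

theorem hasSum_option {ι E : Type*} [NormedAddCommGroup E] {f : Option ι → E} {a : E}
    (h : HasSum (fun i => f (some i)) a) : HasSum f (f none + a) := by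
  rw [← (Equiv.optionEquivSumPUnit.{0} ι).symm.hasSum_iff, add_comm]
  exact HasSum.sum h (hasSum_unique _)

theorem continuous_slopeTerm (k : ℕ) (β : F) : Continuous (slopeTerm k β) := by
  unfold slopeTerm prodPow
  refine continuous_const.mul (continuous_finsetProd _ fun σ _ => ?_)
  refine Continuous.zpow₀ (by fun_prop) _ fun τ => Or.inl ?_
  intro h
  have := congrArg Complex.im h
  simp at this
  exact τ.im_ne_zero this

theorem continuous_petersson_cuspForm {w : ℤ} (f : CuspForm 𝒮ℒ w) {g : ℍ → ℂ}
    (hg : Continuous g) : Continuous (petersson w f g) := by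
  have := f.holo'.continuous
  unfold petersson
  refine Continuous.mul (by fun_prop) (Continuous.zpow₀ (by fun_prop) _ fun τ => Or.inl ?_)
  exact_mod_cast τ.im_ne_zero

variable [IsTotallyReal F]

/-- The slope `β`, or the constant term for `none`, paired with the cusp form. -/
noncomputable def peterssonTerm (k : ℕ) {w : ℤ} (f : CuspForm 𝒮ℒ w) (p : Option F) : ℍ → ℂ :=
  petersson w f (p.elim 1 (slopeTerm k))

theorem summable_peterssonTerm {k w : ℕ} (hk : Even k) (hk2 : 2 < k) (f : CuspForm 𝒮ℒ (w : ℤ)) :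
    (∀ p : Option F, IntegrableOn (peterssonTerm k f p) 𝒟) ∧
      (Summable fun p : Option F => ∫ τ in 𝒟, ‖peterssonTerm k f p τ‖) ∧
      IntegrableOn (petersson w f (heckeEDiag F k)) 𝒟 ∧
      HasSum (fun p : Option F => ∫ τ in 𝒟, peterssonTerm k f p τ)
        (∫ τ in 𝒟, petersson w f (heckeEDiag F k) τ) := by
  obtain ⟨M, hM⟩ := heckeEDiag_eq_tsum (F := F) hk hk2
  obtain ⟨C, hC0, hC⟩ := exists_norm_petersson_le f
  have : Countable F := by
    exact (finBasis ℚ F).equivFun.injective.countable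
  have hsum1 : ∀ τ ∈ 𝒟, Summable fun p : Option F => ‖(p.elim 1 (slopeTerm k) : ℍ → ℂ) τ‖ := by
    intro τ hτ
    exact (hasSum_option (hM τ hτ).1.hasSum).summable
  have htsum : ∀ τ ∈ 𝒟, ∑' p : Option F, ‖(p.elim 1 (slopeTerm k) : ℍ → ℂ) τ‖ ≤ 1 + M := by
    intro τ hτ
    rw [(hasSum_option (f := fun p : Option F => ‖(p.elim 1 (slopeTerm k) : ℍ → ℂ) τ‖)
      (hM τ hτ).1.hasSum).tsum_eq]
    simpa using (hM τ hτ).2.1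
  have hE : ∀ τ ∈ 𝒟, heckeEDiag F k τ = ∑' p : Option F, (p.elim 1 (slopeTerm k) : ℍ → ℂ) τ := by
    intro τ hτ
    rw [(hasSum_option (f := fun p : Option F => (p.elim 1 (slopeTerm k) : ℍ → ℂ) τ)
      (hM τ hτ).1.of_norm.hasSum).tsum_eq, (hM τ hτ).2.2]
    rfl
  have hP : ∀ τ ∈ 𝒟, ∑' p : Option F, peterssonTerm k f p τ = petersson w f (heckeEDiag F k) τ := by
    intro τ hτ
    simp only [peterssonTerm, petersson, hE τ hτ]
    rw [tsum_mul_right, tsum_mul_left]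
  have hcont : ∀ p : Option F, Continuous (peterssonTerm k f p) := by
    intro p
    refine continuous_petersson_cuspForm f ?_
    rcases p with _ | β
    · exact continuous_const
    · exact continuous_slopeTerm k β
  have hbound : ∀ τ ∈ 𝒟, (Summable fun p : Option F => ‖peterssonTerm k f p τ‖) ∧
      ∑' p : Option F, ‖peterssonTerm k f p τ‖ ≤ C * (1 + M) := by
    intro τ hτ
    have hle : ∀ p : Option F, ‖peterssonTerm k f p τ‖ ≤
        C * ‖(p.elim 1 (slopeTerm k) : ℍ → ℂ) τ‖ := fun p => hC _ τ hτ
    have hs := Summable.of_nonneg_of_le (fun _ => norm_nonneg _) hle ((hsum1 τ hτ).mul_left C)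
    refine ⟨hs, (hs.tsum_le_tsum hle ((hsum1 τ hτ).mul_left C)).trans ?_⟩
    rw [tsum_mul_left]
    exact mul_le_mul_of_nonneg_left (htsum τ hτ) hC0
  obtain ⟨h1, h2, h3, h4⟩ := hasSum_setIntegral_fd hcont hbound
  have hmeas : MeasurableSet (𝒟 : Set ℍ) := ModularGroup.isClosed_fd.measurableSet
  refine ⟨h1, h2, h3.congr_fun hP hmeas, ?_⟩
  rwa [setIntegral_congr_fun hmeas hP] at h4

/-- The constant term and the rational slopes form the orbit of `∞`, which unfolds to the vanishing
strip integral. -/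
theorem tsum_integral_ratCast_eq_zero {d k : ℕ} (hd : finrank ℚ F = d) (hk : Even k)
    (hk2 : 2 < k) (f : CuspForm 𝒮ℒ ((d * k : ℕ) : ℤ)) :
    ∑' p : Option ℚ, ∫ τ in 𝒟, peterssonTerm k f (p.map ((↑) : ℚ → F)) τ = 0 := by
  obtain ⟨h1, h2, -, -⟩ := summable_peterssonTerm (F := F) hk hk2 f
  choose r hr0 hr1 hr using fun q : ℚ => exists_petersson_slopeTerm_ratCast (F := F) hd hk q
  set r' : Option ℚ → SL(2, ℤ) := fun p => p.elim 1 r with hr'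
  have hval : ∀ (p : Option ℚ) (τ : ℍ), peterssonTerm k f (p.map ((↑) : ℚ → F)) τ =
      petersson ((d * k : ℕ) : ℤ) f 1 (r' p • τ) := by
    rintro (_ | q) τ
    · simp [peterssonTerm, hr']
    · exact hr q f τ
  have hinj : Function.Injective (Option.map ((↑) : ℚ → F)) :=
    Option.map_injective Rat.cast_injective
  obtain ⟨hi, ht⟩ := tsum_integral_translates (G := petersson ((d * k : ℕ) : ℤ) f 1)
    (petersson_one_T_zpow f) r' rfl (fun q => ⟨hr0 q, hr1 q⟩)
    (fun p => by
      rw [← (funext (hval p) : peterssonTerm k f (p.map ((↑) : ℚ → F)) = _)]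
      exact h1 _)
    (by simpa only [Function.comp_def, hval] using h2.comp_injective hinj)
  simp only [hval]
  rw [ht, integral_strip_petersson_one f hi]

/-- Translating `τ` by `g` replaces the slope `β` by its translate. Injectivity makes the orbit a
subfamily of the summable family of all slopes, as unfolding requires. -/
theorem hasSum_integral_mobius {d k : ℕ} (hd : finrank ℚ F = d) (hk : Even k)
    (hk2 : 2 < k) (f : CuspForm 𝒮ℒ ((d * k : ℕ) : ℤ)) {β : F} (hβ : β ∈ irrationals F)
    (hinj : Set.InjOn (mobius β) posReps) :
    Integrable (peterssonTerm k f (some β)) ∧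
      HasSum (fun g : posReps => ∫ τ in 𝒟, peterssonTerm k f (some (mobius β g)) τ)
        (∫ τ, peterssonTerm k f (some β) τ) := by
  obtain ⟨h1, h2, -, -⟩ := summable_peterssonTerm (F := F) hk hk2 f
  have hval : ∀ (g : SL(2, ℤ)) (τ : ℍ), peterssonTerm k f (some β) (g • τ) =
      peterssonTerm k f (some (mobius β g)) τ := fun g τ =>
    petersson_smul_of_slash f (slopeTerm_slash hd hk β g (mobius_denom_ne_zero hβ g)) τ
  have hi : Function.Injective fun g : posReps => some (mobius β (g : SL(2, ℤ))) :=
    fun a b h => Subtype.ext (hinj a.2 b.2 (Option.some_injective _ h))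
  have := hasSum_integral_smul_fd (φ := peterssonTerm k f (some β))
    (fun g _ => by simpa only [hval] using h1 (some (mobius β g)))
    (by simpa only [Function.comp_def, hval] using h2.comp_injective hi)
  simpa only [hval] using this

/-- The inner product with the Eisenstein series as a sum of integrals over the upper half plane. -/
theorem hasSum_integral_repSet {d k : ℕ} (hd : finrank ℚ F = d) (h3 : 3 ≤ d)
    (hF : ∀ K : IntermediateField ℚ F, K = ⊥ ∨ K = ⊤) (hk : Even k)
    (hk2 : 2 < k) (f : CuspForm 𝒮ℒ ((d * k : ℕ) : ℤ)) {S₀ : Set F} (hS₀ : IsRepSet S₀) :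
    HasSum (fun β : S₀ => ∫ τ, peterssonTerm k f (some (β : F)) τ)
      (∫ τ in 𝒟, petersson ((d * k : ℕ) : ℤ) f (heckeEDiag F k) τ) := by
  obtain ⟨h1, h2, -, h4⟩ := summable_peterssonTerm (F := F) hk hk2 f
  rw [← hd] at h3
  set I : Option F → ℂ := fun p => ∫ τ in 𝒟, peterssonTerm k f p τ with hI
  set R : Set (Option F) := Set.range (Option.map ((↑) : ℚ → F)) with hR
  have hRinj : Function.Injective (Option.map ((↑) : ℚ → F)) :=
    Option.map_injective Rat.cast_injective
  have hRsum : ∑' p : R, I p = 0 := by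
    rw [hR, tsum_range I hRinj]
    exact tsum_integral_ratCast_eq_zero hd hk hk2 f
  let e := Equiv.ofBijective _ (hS₀.bijective_mobius hF h3)
  let e' : irrationals F ≃ (Rᶜ : Set (Option F)) := Equiv.ofBijective
    (fun β => ⟨some (β : F), by
      rintro ⟨_ | q, hq⟩
      · simp at hq
      · exact β.2 ⟨q, Option.some_injective _ hq⟩⟩)
    ⟨fun a b h => Subtype.ext (Option.some_injective _ (congrArg Subtype.val h)), by
      rintro ⟨_ | β, hβ⟩
      · exact absurd ⟨none, rfl⟩ hβ
      · exact ⟨⟨β, fun ⟨q, hq⟩ => hβ ⟨some q, congrArg some hq⟩⟩, rfl⟩⟩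
  -- The rational part `R` sums to zero, so its complement carries the whole sum.
  have hIsum : HasSum (fun p : (Rᶜ : Set (Option F)) => I p) (∑' p, I p) := by
    have hs : Summable fun p : (Rᶜ : Set (Option F)) => I p :=
      h4.summable.comp_injective Subtype.val_injective
    have : ∑' p : R, I p + ∑' p : (Rᶜ : Set (Option F)), I p = ∑' p, I p :=
      (h4.summable.subtype R).tsum_add_tsum_compl (h4.summable.subtype Rᶜ)
    rw [hRsum, zero_add] at this
    rw [← this]
    exact hs.hasSum
  rw [h4.tsum_eq] at hIsum
  have h5 : HasSum (fun x : S₀ × posReps => I (some (mobius (x.1 : F) x.2)))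
      (∫ τ in 𝒟, petersson ((d * k : ℕ) : ℤ) f (heckeEDiag F k) τ) := by
    have := ((e.trans e').hasSum_iff (f := fun p : (Rᶜ : Set (Option F)) => I p)).mpr hIsum
    exact this
  exact h5.prod_fiberwise fun β => (hasSum_integral_mobius hd hk hk2 f
    (hS₀.subset_irrationals β.2) (mobius_injOn hF h3 (hS₀.subset_irrationals β.2))).2

end Main


/-! ### Pairing the `q`-expansion with the product -/

section FourierExpansion

open MeasureTheory Filter Topology

theorem exists_norm_coeff_le {w : ℤ} (f : CuspForm 𝒮ℒ w) :
    ∃ C : ℝ, ∀ n : ℕ+, ‖coeff f n‖ ≤ C * (n : ℝ) ^ ((w : ℝ) / 2) := by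
  have h := CuspFormClass.qExpansion_isBigO f
  rw [Subgroup.strictWidthInfty_SL2Z] at h
  obtain ⟨C, -, hC⟩ := Asymptotics.bound_of_isBigO_nat_atTop h
  refine ⟨C, fun n => ?_⟩
  have hn : (0 : ℝ) < ((n : ℕ) : ℝ) := by exact_mod_cast n.pos
  have := hC (x := (n : ℕ)) (Real.rpow_pos_of_pos hn _).ne'
  rwa [Real.norm_of_nonneg (Real.rpow_nonneg hn.le _)] at this

theorem hasSum_coeff_mul_cexp {w : ℤ} (f : CuspForm 𝒮ℒ w) (τ : ℍ) :
    HasSum (fun n : ℕ+ => coeff f n * Complex.exp (2 * Real.pi * Complex.I * (n : ℕ) * τ))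
      (f τ) := by
  have h := ModularForm.hasSum_qExpansion f (h := 1) one_pos (by simp) τ
  rw [← Function.Injective.hasSum_iff PNat.coe_injective] at h
  · refine h.congr_fun fun n => ?_
    simp only [Function.comp_apply, coeff, Function.Periodic.qParam]
    rw [← Complex.exp_nat_mul]
    congr 2
    push_cast
    ring
  · intro n hn
    have : n = 0 := by
      by_contra h0
      exact hn ⟨⟨n, Nat.pos_of_ne_zero h0⟩, rfl⟩
    rw [this, CuspFormClass.qExpansion_coeff_zero f one_pos (by simp), zero_mul]

/-- Hecke's bound `c(n) = O(n^(dk/2))` leaves exponent at most `dk/2 - (d-1)k ≤ -k/2 < -1`, using `d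
≥ 3` and `k > 2`. -/
theorem summable_dirichletTerm {d k : ℕ} (hd : 3 ≤ d) (hk2 : 2 < k)
    (f : CuspForm 𝒮ℒ ((d * k : ℕ) : ℤ)) (x : ℝ) (l : ℕ) :
    Summable (dirichletTerm f x ((d - 1) * k + l)) := by
  obtain ⟨C, hC⟩ := exists_norm_coeff_le f
  have hs : Summable fun n : ℕ+ => C * ((n : ℕ) : ℝ) ^ (-(k : ℝ) / 2) := by
    refine Summable.mul_left _ ?_
    refine (Real.summable_nat_rpow.mpr ?_).comp_injective PNat.coe_injective
    have : (2 : ℝ) < k := by exact_mod_cast hk2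
    linarith
  refine Summable.of_norm_bounded hs fun n => ?_
  have hn1 : (1 : ℝ) ≤ ((n : ℕ) : ℝ) := by exact_mod_cast n.pos
  have hn : (0 : ℝ) < ((n : ℕ) : ℝ) := by linarith
  have he : ‖e ((n : ℕ) * x)‖ = 1 := by
    rw [e, Complex.norm_exp]
    simp
  have hC0 : 0 ≤ C := by
    have h1 := (norm_nonneg _).trans (hC n)
    exact nonneg_of_mul_nonneg_left h1 (Real.rpow_pos_of_pos hn _)
  rw [dirichletTerm, norm_div, norm_mul, he, one_mul, Complex.norm_conj, norm_pow,
    Complex.norm_natCast, div_le_iff₀ (pow_pos hn _), mul_assoc, ← Real.rpow_natCast,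
    ← Real.rpow_add hn]
  refine (hC n).trans (mul_le_mul_of_nonneg_left ?_ hC0)
  refine Real.rpow_le_rpow_of_exponent_le hn1 ?_
  have h3 : (3 : ℝ) ≤ d := by exact_mod_cast hd
  have hk0 : (0 : ℝ) ≤ k := by positivity
  have hl : (0 : ℝ) ≤ l := by positivity
  rw [Nat.cast_add, Nat.cast_mul (d - 1), Nat.cast_sub (by omega : 1 ≤ d)]
  push_cast
  nlinarith

variable {ι : Type*} [Fintype ι] [DecidableEq ι] [Nonempty ι]

/-- Insert the `q`-expansion and integrate termwise. One factor `exp(-2πnv)` comes from `conj f`,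
the other from the Fourier coefficient of the product. -/
theorem hasSum_integral_conj_mul_prodPow {w : ℤ} (f : CuspForm 𝒮ℒ w) {k : ℕ} (hk : 2 ≤ k)
    {b : ι → ℝ} (hb : Function.Injective b) {v : ℝ} (hv : 0 < v) :
    HasSum (fun n : ℕ+ => conj (coeff f n) * laplaceDensity k b (n : ℕ) *
        Complex.exp (-(4 * Real.pi * (n : ℕ)) * v))
      (∫ u : ℝ, conj (f (ofComplex (u + v * Complex.I))) * prodPow k b (u + v * Complex.I)) := by
  set G : ℕ+ → ℝ → ℂ := fun n u =>
    (conj (coeff f n) * Complex.exp (-(2 * Real.pi * v * (n : ℕ)))) *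
      (prodPow k b (u + v * Complex.I) *
        Complex.exp (-(2 * Real.pi * Complex.I * (n : ℕ) * u))) with hG
  have hexp1 : ∀ (n : ℕ+) (u : ℝ),
      ‖Complex.exp (-(2 * Real.pi * Complex.I * (n : ℕ) * u))‖ = 1 := by
    intro n u
    rw [Complex.norm_exp]
    simp
  have hE1 : ∀ (n : ℕ+) (u : ℝ),
      conj (Complex.exp (2 * Real.pi * Complex.I * (n : ℕ) * (u + v * Complex.I))) =
        Complex.exp (-(2 * Real.pi * v * (n : ℕ))) *
          Complex.exp (-(2 * Real.pi * Complex.I * (n : ℕ) * u)) := by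
    intro n u
    rw [← Complex.exp_conj, ← Complex.exp_add]
    simp only [map_mul, map_ofNat, Complex.conj_ofReal, Complex.conj_I, map_natCast, map_add]
    congr 1
    linear_combination (2 * Real.pi * (n : ℕ) * v : ℂ) * Complex.I_sq
  have hE2 : ∀ n : ℕ+, Complex.exp (2 * Real.pi * Complex.I * (n : ℕ) * (v * Complex.I)) =
      Complex.exp (-(2 * Real.pi * v * (n : ℕ))) := by
    intro n
    congr 1
    linear_combination (2 * Real.pi * (n : ℕ) * v : ℂ) * Complex.I_sq
  have hE3 : ∀ n : ℕ+, Complex.exp (-(4 * Real.pi * (n : ℕ)) * v) =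
      Complex.exp (-(2 * Real.pi * v * (n : ℕ))) * Complex.exp (-(2 * Real.pi * v * (n : ℕ))) := by
    intro n
    rw [← Complex.exp_add]
    congr 1
    ring
  have hint : ∀ n, Integrable (G n) := by
    intro n
    refine ((integrable_prodPow hk b hv).mul_bdd (c := 1) ?_ ?_).const_mul _
    · exact Continuous.aestronglyMeasurable (by fun_prop)
    · exact Eventually.of_forall fun u => (hexp1 n u).le
  have hpt : ∀ u : ℝ, HasSum (fun n => G n u)
      (conj (f (ofComplex (u + v * Complex.I))) * prodPow k b (u + v * Complex.I)) := by
    intro u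
    have him : 0 < ((u : ℂ) + v * Complex.I).im := by simpa using hv
    have h := (hasSum_coeff_mul_cexp f (ofComplex (u + v * Complex.I))).star.mul_right
      (prodPow k b (u + v * Complex.I))
    refine h.congr_fun fun n => ?_
    rw [ofComplex_apply_of_im_pos him]
    simp only [hG, Complex.star_def, map_mul, hE1]
    generalize Complex.exp (-(2 * Real.pi * v * (n : ℕ))) = X
    generalize Complex.exp (-(2 * Real.pi * Complex.I * (n : ℕ) * u)) = Y
    ring
  have hsum : Summable fun n => ∫ u, ‖G n u‖ := by
    have h1 : ∀ n, ∫ u, ‖G n u‖ = ‖coeff f n * Complex.exp (-(2 * Real.pi * v * (n : ℕ)))‖ *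
        ∫ u : ℝ, ‖prodPow k b (u + v * Complex.I)‖ := by
      intro n
      rw [← integral_const_mul]
      refine integral_congr_ae (Eventually.of_forall fun u => ?_)
      simp only [hG, norm_mul, hexp1, mul_one, Complex.norm_conj]
    simp only [h1, ← hE2]
    -- The coefficients with this decay are the terms of the `q`-expansion at `iv`, which converges
    -- absolutely.
    exact (hasSum_coeff_mul_cexp f ⟨v * Complex.I, by simpa using hv⟩).summable.norm.mul_right _
  have h := hasSum_integral_of_summable_integral_norm hint hsum
  rw [integral_congr_ae (Eventually.of_forall fun u => (hpt u).tsum_eq)] at h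
  refine h.congr_fun fun n => ?_
  have hn : (0 : ℝ) < ((n : ℕ) : ℝ) := by exact_mod_cast n.pos
  have := integral_prodPow_mul_cexp hk hb hv hn
  rw [Complex.ofReal_natCast] at this
  simp only [hG]
  rw [integral_const_mul, this, hE3]
  generalize Complex.exp (-(2 * Real.pi * v * (n : ℕ))) = X
  ring

/-- The Laplace kernels are positive, so the integral of the norm of each term is the norm of its
integral; the hypothesis is then exactly what termwise integration needs. -/
theorem hasSum_integral_pow_mul_tsum {c : ℕ+ → ℂ} (m : ℕ)
    (hc : Summable fun n => c n * ((m.factorial : ℂ) / (4 * Real.pi * (n : ℕ)) ^ (m + 1))) :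
    HasSum (fun n => c n * ((m.factorial : ℂ) / (4 * Real.pi * (n : ℕ)) ^ (m + 1)))
      (∫ v in Set.Ioi (0 : ℝ), (v : ℂ) ^ m *
        ∑' n, c n * Complex.exp (-(4 * Real.pi * (n : ℕ)) * v)) := by
  have hn : ∀ n : ℕ+, (0 : ℝ) < 4 * Real.pi * (n : ℕ) := fun n => by
    have : (0 : ℝ) < ((n : ℕ) : ℝ) := by exact_mod_cast n.pos
    positivity
  have hre : ∀ n : ℕ+, (-(4 * Real.pi * (n : ℕ) : ℂ)).re < 0 := fun n => by
    have := hn n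
    simpa using this
  have hint : ∀ n : ℕ+, IntegrableOn (fun v : ℝ => c n *
      ((v : ℂ) ^ m * Complex.exp (-(4 * Real.pi * (n : ℕ)) * v))) (Set.Ioi 0) := fun n =>
    (integrableOn_pow_mul_cexp m (hre n)).const_mul _
  have hnorm : ∀ n : ℕ+, ∫ v in Set.Ioi (0 : ℝ), ‖c n *
      ((v : ℂ) ^ m * Complex.exp (-(4 * Real.pi * (n : ℕ)) * v))‖ =
      ‖c n * ((m.factorial : ℂ) / (4 * Real.pi * (n : ℕ)) ^ (m + 1))‖ := by
    intro n
    have h1 := Real.integral_rpow_mul_exp_neg_mul_Ioi (a := m + 1) (by positivity) (hn n)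
    rw [Real.Gamma_nat_eq_factorial] at h1
    have h2 : ∀ v ∈ Set.Ioi (0 : ℝ), ‖c n *
        ((v : ℂ) ^ m * Complex.exp (-(4 * Real.pi * (n : ℕ)) * v))‖ =
        ‖c n‖ * (v ^ ((m : ℝ) + 1 - 1) * Real.exp (-(4 * Real.pi * (n : ℕ) * v))) := by
      intro v hv
      rw [norm_mul, norm_mul, norm_pow, Complex.norm_real, Real.norm_of_nonneg (le_of_lt hv),
        Complex.norm_exp, add_sub_cancel_right, Real.rpow_natCast]
      simp
    rw [setIntegral_congr_fun measurableSet_Ioi h2, integral_const_mul, h1, norm_mul, norm_div,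
      norm_pow, Complex.norm_natCast]
    have h3 : ‖(4 * Real.pi * (n : ℕ) : ℂ)‖ = 4 * Real.pi * (n : ℕ) := by
      have := Complex.norm_of_nonneg (hn n).le
      push_cast at this
      exact this
    rw [h3, ← Nat.cast_add_one, Real.rpow_natCast, one_div, inv_pow]
    ring
  have h := hasSum_integral_of_summable_integral_norm hint (by
    simpa only [hnorm] using hc.norm)
  have h4 : ∀ v : ℝ, ∑' n : ℕ+, c n * ((v : ℂ) ^ m * Complex.exp (-(4 * Real.pi * (n : ℕ)) * v)) =
      (v : ℂ) ^ m * ∑' n : ℕ+, c n * Complex.exp (-(4 * Real.pi * (n : ℕ)) * v) := by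
    intro v
    rw [← tsum_mul_left]
    exact tsum_congr fun n => by ring
  simp only [h4] at h
  refine h.congr_fun fun n => ?_
  rw [integral_const_mul, integral_pow_mul_cexp m (hre n), neg_neg]

end FourierExpansion


/-! ### Evaluation of the integral attached to one slope -/

section LocalIntegral

open MeasureTheory Filter Topology NumberField Module

theorem laplaceDensity_mul_eq_sum {ι : Type*} [Fintype ι] [DecidableEq ι] {d k m : ℕ} (hd : 1 ≤ d)
    (hm : m + 2 = d * k) (f : ℍ → ℂ) (b : ι → ℝ) (n : ℕ+) :
    conj (coeff f n) * laplaceDensity k b (n : ℕ) *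
        ((m.factorial : ℂ) / (4 * Real.pi * (n : ℕ)) ^ (m + 1)) =
      ∑ l ∈ Finset.range k, ∑ j, (m.factorial : ℂ) / (4 * Real.pi) ^ (m + 1) *
        ((fracCoeff k b j l : ℂ) *
          ((-(2 * Real.pi * Complex.I)) ^ (k - l) / ((k - l - 1).factorial : ℂ))) *
        dirichletTerm f (b j) ((d - 1) * k + l) n := by
  rw [laplaceDensity, Finset.mul_sum, Finset.sum_mul, Finset.sum_comm]
  refine Finset.sum_congr rfl fun j _ => ?_
  rw [Finset.mul_sum, Finset.sum_mul]
  refine Finset.sum_congr rfl fun l hl => ?_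
  have hlk : l < k := Finset.mem_range.mp hl
  have hn : ((n : ℕ) : ℂ) ≠ 0 := by exact_mod_cast n.ne_zero
  -- The Gamma integral gives `n^(-(dk-1))`, and the monomial in `laplaceDensity` gives back
  -- `n^(k-l-1)`.
  have hexp : m + 1 = (d - 1) * k + l + (k - l - 1) := by
    obtain ⟨d', rfl⟩ : ∃ d', d = d' + 1 := ⟨d - 1, by omega⟩
    rw [add_mul, one_mul] at hm
    rw [Nat.add_sub_cancel]
    omega
  have he : Complex.exp (2 * Real.pi * Complex.I * (b j) * (((n : ℕ) : ℝ) : ℂ)) =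
      e ((n : ℕ) * b j) := by
    rw [e]
    congr 1
    push_cast
    ring
  rw [dirichletTerm, he, mul_pow _ ((n : ℕ) : ℂ), Complex.ofReal_natCast]
  nth_rewrite 2 [hexp]
  rw [pow_add ((n : ℕ) : ℂ)]
  have h1 : ((n : ℕ) : ℂ) ^ (k - l - 1) ≠ 0 := pow_ne_zero _ hn
  have h2 : ((n : ℕ) : ℂ) ^ ((d - 1) * k + l) ≠ 0 := pow_ne_zero _ hn
  field_simp

/-- The signs `(-1)^l` and `(-1)^(k-l)` cancel for even `k`; one factor `2πi` against one `4π` gives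
`i/2`, and the factorials assemble into the binomial coefficient over `(k-1)!`. -/
theorem fracCoeff_constant {k l m : ℕ} (hk : Even k) (hl : l < k) (R D : ℂ) :
    (m.factorial : ℂ) / (4 * Real.pi) ^ (m + 1) *
        (((-1) ^ l * R / (l.factorial : ℂ)) *
          ((-(2 * Real.pi * Complex.I)) ^ (k - l) / ((k - l - 1).factorial : ℂ))) * D =
      Complex.I * (m.factorial : ℂ) / (2 * (4 * Real.pi) ^ m * ((k - 1).factorial : ℂ)) *
        (((k - 1).choose l : ℂ) * (2 * Real.pi * Complex.I) ^ (k - 1 - l) * (R * D)) := by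
  have hsign : (-1 : ℂ) ^ l * (-1) ^ (k - l) = 1 := by
    rw [← pow_add, Nat.add_sub_cancel' hl.le, hk.neg_one_pow]
  have hpow : (2 * Real.pi * Complex.I) ^ (k - l) =
      (2 * Real.pi * Complex.I) * (2 * Real.pi * Complex.I) ^ (k - 1 - l) := by
    rw [← pow_succ']
    congr 1
    omega
  have hch : ((k - 1).choose l : ℂ) =
      ((k - 1).factorial : ℂ) / ((l.factorial : ℂ) * ((k - 1 - l).factorial : ℂ)) :=
    Nat.cast_choose ℂ (by omega)
  have hf1 : ((k - 1).factorial : ℂ) ≠ 0 := by exact_mod_cast Nat.factorial_ne_zero _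
  have hf2 : ((k - 1 - l).factorial : ℂ) ≠ 0 := by exact_mod_cast Nat.factorial_ne_zero _
  have hf3 : (l.factorial : ℂ) ≠ 0 := by exact_mod_cast Nat.factorial_ne_zero _
  have hpi : (Real.pi : ℂ) ≠ 0 := by exact_mod_cast Real.pi_ne_zero
  have hp4 : ((4 * Real.pi : ℂ)) ^ m ≠ 0 := pow_ne_zero _ (mul_ne_zero (by norm_num) hpi)
  rw [neg_pow (2 * Real.pi * Complex.I : ℂ), hpow, hch,
    show k - l - 1 = k - 1 - l by omega, pow_succ]
  generalize (2 * Real.pi * Complex.I : ℂ) ^ (k - 1 - l) = X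
  generalize (4 * Real.pi : ℂ) ^ m = Y at hp4 ⊢
  generalize (-1 : ℂ) ^ (k - l) = s at hsign ⊢
  generalize (-1 : ℂ) ^ l = s' at hsign ⊢
  field_simp
  linear_combination (4 * (m.factorial : ℂ) * R * X * D) * hsign

variable {F : Type*} [Field F] [NumberField F] [IsTotallyReal F]

open scoped Classical in
theorem integral_peterssonTerm {d k : ℕ} (hd3 : 3 ≤ d) (hk : Even k) (hk2 : 2 < k)
    (f : CuspForm 𝒮ℒ ((d * k : ℕ) : ℤ)) {β : F}
    (hβ : Function.Injective fun σ : F →+* ℝ => σ β)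
    (hi : Integrable (peterssonTerm k f (some β))) :
    ∫ τ, peterssonTerm k f (some β) τ =
      Complex.I * (Real.Gamma ((d * k : ℕ) - 1 : ℝ) : ℂ) /
          (2 * (4 * Real.pi) ^ (d * k - 2) * (Real.Gamma (k : ℝ) : ℂ)) * betaTerm d k f β := by
  -- The exponent of `v` left after the weight `v^(dk)` meets the measure `v^(-2)`.
  obtain ⟨m, hm⟩ : ∃ m, m + 2 = d * k := ⟨d * k - 2, by
    have : 3 * 2 ≤ d * k := Nat.mul_le_mul hd3 hk2.le
    omega⟩
  set b : (F →+* ℝ) → ℝ := fun σ => σ β with hb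
  set c : ℕ+ → ℂ := fun n => conj (coeff f n) * laplaceDensity k b (n : ℕ) with hc
  set K : ℂ := ((A β : ℚ) : ℂ) ^ (-(k : ℤ)) with hK
  have hinner : ∀ v ∈ Set.Ioi (0 : ℝ), ∫ u : ℝ, (((v ^ 2)⁻¹ : ℝ) : ℂ) *
      peterssonTerm k f (some β) (ofComplex (u + v * Complex.I)) =
      K * ((v : ℂ) ^ m * ∑' n, c n * Complex.exp (-(4 * Real.pi * (n : ℕ)) * v)) := by
    intro v hv
    have hv' : 0 < v := hv
    have hv0 : (v : ℂ) ≠ 0 := by exact_mod_cast hv'.ne'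
    rw [(hasSum_integral_conj_mul_prodPow f hk2.le hβ hv').tsum_eq, ← mul_assoc,
      ← integral_const_mul]
    refine integral_congr_ae (Eventually.of_forall fun u => ?_)
    have him : 0 < ((u : ℂ) + v * Complex.I).im := by simpa using hv'
    have himv : (⟨(u : ℂ) + v * Complex.I, him⟩ : ℍ).im = v := by
      rw [← coe_im]
      simp
    simp only
    rw [ofComplex_apply_of_im_pos him, peterssonTerm, petersson, Option.elim_some, slopeTerm, himv,
      zpow_natCast]
    have hpow : (v : ℂ) ^ (d * k) = (v : ℂ) ^ m * (v : ℂ) ^ 2 := by rw [← hm, pow_add]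
    rw [hpow]
    push_cast
    field_simp
    rw [hK, hb]
  have hsummable : ∀ l σ, Summable (dirichletTerm f (b σ) ((d - 1) * k + l)) := fun l σ =>
    summable_dirichletTerm hd3 hk2 f (b σ) l
  have hterm : ∀ n, c n * ((m.factorial : ℂ) / (4 * Real.pi * (n : ℕ)) ^ (m + 1)) = _ := fun n =>
    laplaceDensity_mul_eq_sum (by omega : 1 ≤ d) hm f b n
  have htot := hasSum_sum (s := Finset.range k) fun l _ =>
    hasSum_sum (s := (Finset.univ : Finset (F →+* ℝ))) fun σ _ =>
      (hsummable l σ).hasSum.mul_left ((m.factorial : ℂ) / (4 * Real.pi) ^ (m + 1) *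
        ((fracCoeff k b σ l : ℂ) *
          ((-(2 * Real.pi * Complex.I)) ^ (k - l) / ((k - l - 1).factorial : ℂ))))
  have htot' := htot.congr_fun hterm
  have hint := hasSum_integral_pow_mul_tsum (c := c) m htot'.summable
  have hG1 : Real.Gamma ((d * k : ℕ) - 1 : ℝ) = m.factorial := by
    rw [← Real.Gamma_nat_eq_factorial, ← hm]
    congr 1
    push_cast
    ring
  have hG2 : Real.Gamma (k : ℝ) = (k - 1).factorial := by
    rw [← Real.Gamma_nat_eq_factorial, Nat.cast_sub (by omega)]
    congr 1
    push_cast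
    ring
  rw [integral_upperHalfPlane hi, setIntegral_congr_fun measurableSet_Ioi hinner,
    integral_const_mul, hint.unique htot', betaTerm, ← hK, hG1, hG2,
    show d * k - 2 = m by omega, mul_left_comm _ K]
  congr 1
  rw [Finset.mul_sum]
  refine Finset.sum_congr rfl fun l hl => ?_
  rw [Finset.mul_sum, Finset.mul_sum]
  refine Finset.sum_congr rfl fun σ _ => ?_
  have := fracCoeff_eq hk hβ σ l
  rw [this]
  push_cast
  rw [fracCoeff_constant hk (Finset.mem_range.mp hl)]
  rfl

end LocalIntegral

end HeckeDiagonal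

theorem proposition3p1 {F : Type*} [Field F] [NumberField F] [NumberField.IsTotallyReal F]
    (d : ℕ) (hd : Module.finrank ℚ F = d) (hd3 : 3 ≤ d)
    (hF : ∀ K : IntermediateField ℚ F, K = ⊥ ∨ K = ⊤)
    (k : ℕ) (hk : Even k) (hk2 : 2 < k)
    (S₀ : Set F) (hS₀ : HeckeDiagonal.IsRepSet S₀)
    (f : CuspForm 𝒮ℒ ((d * k : ℕ) : ℤ)) :
    MeasureTheory.IntegrableOn
      (UpperHalfPlane.petersson ((d * k : ℕ) : ℤ) f (HeckeDiagonal.heckeEDiag F k))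
      ModularGroup.fd ∧
    (∀ β ∈ S₀, ∀ σ : F →+* ℝ, ∀ l < k,
      Summable (HeckeDiagonal.dirichletTerm f (σ β) ((d - 1) * k + l))) ∧
    Summable (fun β : S₀ => HeckeDiagonal.betaTerm d k f (β : F)) ∧
    HeckeDiagonal.peterssonInner ((d * k : ℕ) : ℤ) (HeckeDiagonal.heckeEDiag F k) f =
      Complex.I * (Real.Gamma ((d * k : ℕ) - 1 : ℝ) : ℂ) /
          (2 * (4 * Real.pi) ^ (d * k - 2) * (Real.Gamma (k : ℝ) : ℂ)) *
        ∑' β : S₀, HeckeDiagonal.betaTerm d k f (β : F) := by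
  have hd3' : 3 ≤ Module.finrank ℚ F := hd ▸ hd3
  have hval : ∀ β : S₀, _ := fun β : S₀ =>
    have hβ := hS₀.subset_irrationals β.2
    HeckeDiagonal.integral_peterssonTerm hd3 hk hk2 f
      (HeckeDiagonal.embeddings_injective_of_irrational hF hβ)
      (HeckeDiagonal.hasSum_integral_mobius hd hk hk2 f hβ
        (HeckeDiagonal.mobius_injOn hF hd3' hβ)).1
  have hsum := (HeckeDiagonal.hasSum_integral_repSet hd hd3 hF hk hk2 f hS₀).congr_fun
    fun β => (hval β).symm
  -- Nonvanishing of the constant transfers summability from the integrals to `betaTerm`.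
  have hconst : Complex.I * (Real.Gamma ((d * k : ℕ) - 1 : ℝ) : ℂ) /
      (2 * (4 * Real.pi) ^ (d * k - 2) * (Real.Gamma (k : ℝ) : ℂ)) ≠ 0 := by
    have hdk : 3 * 2 ≤ d * k := Nat.mul_le_mul hd3 hk2.le
    have h1 : Real.Gamma ((d * k : ℕ) - 1 : ℝ) ≠ 0 := by
      refine (Real.Gamma_pos_of_pos ?_).ne'
      have : (6 : ℝ) ≤ (d * k : ℕ) := by exact_mod_cast hdk
      linarith
    have h2 : Real.Gamma (k : ℝ) ≠ 0 :=
      (Real.Gamma_pos_of_pos (by exact_mod_cast (by omega : 0 < k))).ne'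
    have h3 : (Real.pi : ℂ) ≠ 0 := by exact_mod_cast Real.pi_ne_zero
    refine div_ne_zero (mul_ne_zero Complex.I_ne_zero (by exact_mod_cast h1)) ?_
    exact mul_ne_zero (mul_ne_zero two_ne_zero (pow_ne_zero _ (mul_ne_zero (by norm_num) h3)))
      (by exact_mod_cast h2)
  refine ⟨(HeckeDiagonal.summable_peterssonTerm hk hk2 f).2.2.1,
    fun β _ σ l _ => HeckeDiagonal.summable_dirichletTerm hd3 hk2 f (σ β) l,
    (summable_mul_left_iff hconst).mp hsum.summable, ?_⟩
  rw [← tsum_mul_left, hsum.tsum_eq]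
  rfl
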